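/- **Notation.** Put $J_1=(\log\frac18,\log 4)$, $J_2=(\log\frac12,\log 2)$, $J_3=(\log\frac58,\log\frac{11}8)$, $\widehat h(k)=(2\pi)^{-1/2}\int_{\mathbb R}e^{-ik\xi}h(\xi)\,d\xi$ and $$\rho_0(k)=\frac12\int_{\mathbb R}\Big(\frac1{|1-e^{-h}|}-\frac1{1+e^{-h}}\Big)e^{-h}\,(1-e^{-ikh})\,dh =\frac12\Big(\log 4+\Psi\big(\tfrac12-\tfrac{ik}2\big)+\Psi\big(1+\tfrac{ik}2\big)+2\gamma_E\Big),$$ where $\Psi$ is the digamma function and $\gamma_E$ is Euler's constant. Let $P$ be the pseudodifferential operator with symbol $p(\xi,k)=-e^{-\xi/2}\rho_0(k)$, that is $P h(\xi)=(2\pi)^{-1/2}\int_{\mathbb R}\widehat h(k)e^{ik\xi}p(\xi,k)\,dk$ in the sense of distributions, and let $T_1$ be the Fourier multiplier $\widehat{T_1h}(k)=-\widehat h(k)\,\mathrm{Re}\,\rho_0(k)\,\mathbf 1_{|k|>1}$. For $\sigma\ge 0$ put $\|h\|_{H^\sigma}^2=\int|\widehat h|^2(1+|k|^2)^\sigma dk$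 and $\|h\|_{H^\sigma_{\log^{-1}}}^2=\int|\widehat h|^2(1+|k|^2)^\sigma(1+\log(1+|k|))^{-1}dk$. Let $\chi_0\in C^\infty(\mathbb R;\mathbb R)$ with $\chi_0=1$ on $J_3$ and $\chi_0=0$ outside $J_2$, and let $\sigma\ge0$. If $\sigma>1$, assume also that $\chi_0$ has a $C^\infty$ $n$-th root for every $n\ge1$ (as the usual cutoff functions built from $e^{-1/x}$ have). For $T>0$, a *solution on* $(0,T)$ is a pair of functions $(w,Q)$ of $(t,\xi)$ such that $w\in L^\infty((0,T)\times J_1)\cap H^1((0,T);L^2(J_2))$, $w=0$ for $\xi\notin J_1$, $Q(t)\in L^1_{loc}(J_2)$ for a.e. $t$, and $$\partial_t w=P(w)+Q\ \text{ on }(0,T)\times J_2\ \text{ (in the sense of distributions in $\xi$ for a.e. $t$)},\qquad w(0)=0\ \text{ on }J_2.$$ **Theorem.** There is a constant $C$, depending only on $\sigma$ and $\chi_0$, such that the following holds, with $\widetilde w=\chi_0w$. (i) If $(w,Q)$ is a solution on $(0,1)$ and $\chi_0Q\in L^2((0,1);H^\sigma_{\log^{-1}})$, then $$\int_0^1\|\widetilde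 w(t)\|_{H^\sigma}^2dt\le C\int_0^1\|w(t)\|_{L^\infty(J_1)}^2dt+C\int_0^1\|\chi_0Q(t)\|_{H^\sigma_{\log^{-1}}}^2dt.$$ (ii) If $T_{\max}>0$, $(w,Q)$ is a solution on $(0,T_{\max})$ and $\chi_0Q\in L^2((0,T_{\max});H^\sigma_{\log^{-1}})$, then $$\sup_{0\le T\le T_{\max}}\Big(\int_T^{\min(T+1,T_{\max})}\|\widetilde w\|_{H^\sigma}^2dt\Big)^{1/2}\le C\Big(\int_0^{T_{\max}}\|w\|_{L^\infty(J_1)}^2dt\Big)^{1/2}+C\sup_{0\le T\le T_{\max}}\Big(\int_T^{\min(T+1,T_{\max})}\|\chi_0Q\|_{H^\sigma_{\log^{-1}}}^2dt\Big)^{1/2}.$$ (iii) If $T_{\max}>0$, $(w,Q)$ is a solution on $(0,T_{\max})$ and $\chi_0Q\in L^2((0,T_{\max});H^\sigma)$, then $$\sup_{0\le T\le T_{\max}}\Big(\int_T^{\min(T+1,T_{\max})}\|T_1\widetilde w\|_{H^\sigma}^2dt\Big)^{1/2}\le C\Big(\int_0^{T_{\max}}\|w\|_{L^\infty(J_1)}^2dt\Big)^{1/2}+C\sup_{0\le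 T\le T_{\max}}\Big(\int_T^{\min(T+1,T_{\max})}\|\chi_0Q\|_{H^\sigma}^2dt\Big)^{1/2}.$$ Functions in $L^2((0,T);H)$ are measurable in $(t,\xi)$ and, for a.e. $t$, integrable in $\xi$. -/

import Mathlib

open MeasureTheory Set Filter
open scoped ENNReal NNReal ContDiff

noncomputable section

namespace LogKinetic

/-! ### The intervals and the cutoff function (logarithmic variable `ξ = log X`) -/

/-- `log (1/8, 4)`. -/
def J₁ : Set ℝ := Ioo (Real.log (1 / 8)) (Real.log 4)

/-- `log (1/2, 2)`. -/
def J₂ : Set ℝ := Ioo (Real.log (1 / 2)) (Real.log 2)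

/-- `log (5/8, 11/8)`. -/
def J₃ : Set ℝ := Ioo (Real.log (5 / 8)) (Real.log (11 / 8))

/-- A smooth cutoff function, equal to `1` on `J₃` and to `0` outside `J₂`. -/
structure IsCutoff (χ : ℝ → ℝ) : Prop where
  smooth : ContDiff ℝ ∞ χ
  eq_one : ∀ ξ ∈ J₃, χ ξ = 1
  eq_zero : ∀ ξ, ξ ∉ J₂ → χ ξ = 0

/-- `χ` has a smooth `n`-th root for every `n ≥ 1`, as the usual cutoff functions built
from `exp (-1/x)` have. -/
def HasSmoothRoots (χ : ℝ → ℝ) : Prop :=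
  ∀ n : ℕ, 1 ≤ n → ∃ ψ : ℝ → ℝ, ContDiff ℝ ∞ ψ ∧ ∀ ξ, χ ξ = ψ ξ ^ n

/-- The product of a cutoff function of `ξ` and a function of `(t, ξ)`. -/
def localize (χ : ℝ → ℝ) (f : ℝ → ℝ → ℂ) : ℝ → ℝ → ℂ := fun t ξ => (χ ξ : ℂ) * f t ξ

/-! ### Fourier transform, the symbol, the operator `P` -/

/-- `ĥ(k) = (2π)^{-1/2} ∫ e^{-ikξ} h(ξ) dξ`. -/
def hat (h : ℝ → ℂ) (k : ℝ) : ℂ :=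
  ((Real.sqrt (2 * Real.pi))⁻¹ : ℝ) * ∫ ξ : ℝ, Complex.exp (-(Complex.I * k * ξ)) * h ξ

/-- The kernel of the collision operator in logarithmic variables. -/
def kernel (h : ℝ) : ℝ :=
  (1 / |1 - Real.exp (-h)| - 1 / (1 + Real.exp (-h))) * Real.exp (-h)

/-- `ρ₀(k) = ½ ∫ (1/|1 - e^{-h}| - 1/(1 + e^{-h})) e^{-h} (1 - e^{-ikh}) dh`; the integral converges
absolutely, since the kernel is `O(1/|h|)` at `0` and decays exponentially. -/
def rho0 (k : ℝ) : ℂ :=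
  (1 / 2 : ℂ) * ∫ h : ℝ, (kernel h : ℂ) * (1 - Complex.exp (-(Complex.I * k * h)))

/-- The symbol `p(ξ, k) = -e^{-ξ/2} ρ₀(k)`. -/
def symbol (ξ k : ℝ) : ℂ := -(Real.exp (-ξ / 2) : ℂ) * rho0 k

/-- The distribution `P h`, where
`P h (ξ) = (2π)^{-1/2} ∫ ĥ(k) e^{ikξ} p(ξ, k) dk`, tested against `φ`: the integral in `ξ` is
performed first, so that the integral in `k` converges absolutely for integrable `h` and
`φ` smooth with compact support. -/
def pairP (h φ : ℝ → ℂ) : ℂ :=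
  ∫ k : ℝ, hat h k *
    (((Real.sqrt (2 * Real.pi))⁻¹ : ℝ) *
      ∫ ξ : ℝ, φ ξ * symbol ξ k * Complex.exp (Complex.I * k * ξ))

/-- Fourier transform of `T₁ h`, where `T₁` is the Fourier multiplier
`-Re ρ₀(k) 1_{|k| > 1}`. -/
def hatT₁ (h : ℝ → ℂ) (k : ℝ) : ℂ :=
  -(hat h k * ((rho0 k).re : ℂ) * (if 1 < |k| then 1 else 0))

/-! ### Sobolev norms -/

/-- `∫ |F(k)|² m(k) dk`, for a Fourier transform `F` and a weight `m`. -/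
def weightedSq (m : ℝ → ℝ) (F : ℝ → ℂ) : ℝ≥0∞ :=
  ∫⁻ k : ℝ, ENNReal.ofReal (‖F k‖ ^ 2 * m k)

/-- The weight of `H^σ`. -/
def weightH (σ : ℝ) (k : ℝ) : ℝ := (1 + |k| ^ 2) ^ σ

/-- The weight of `H^σ_{log⁻¹}`. -/
def weightHLogInv (σ : ℝ) (k : ℝ) : ℝ :=
  (1 + |k| ^ 2) ^ σ * (1 + Real.log (1 + |k|))⁻¹

/-- `‖h‖²` in `H^σ(ℝ)`. -/
def normSqH (σ : ℝ) (h : ℝ → ℂ) : ℝ≥0∞ := weightedSq (weightH σ) (hat h)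

/-- `‖h‖²` in `H^σ_{log⁻¹}(ℝ)`. -/
def normSqHLogInv (σ : ℝ) (h : ℝ → ℂ) : ℝ≥0∞ := weightedSq (weightHLogInv σ) (hat h)

/-- `‖T₁ h‖²` in `H^σ(ℝ)`. -/
def normSqHT₁ (σ : ℝ) (h : ℝ → ℂ) : ℝ≥0∞ := weightedSq (weightH σ) (hatT₁ h)

/-- `‖h‖²` in `L^∞(J₁)`. -/
def normSqLinf (h : ℝ → ℂ) : ℝ≥0∞ := eLpNorm h ⊤ (volume.restrict J₁) ^ 2

/-- `f ∈ L²((0, T); H)`, for the space `H` of integrable functions on `ℝ` whose squared norm is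
`N`. -/
structure MemL2Time (N : (ℝ → ℂ) → ℝ≥0∞) (T : ℝ) (f : ℝ → ℝ → ℂ) : Prop where
  aestronglyMeasurable :
    AEStronglyMeasurable (Function.uncurry f) (volume.restrict (Ioo 0 T ×ˢ (univ : Set ℝ)))
  integrable : ∀ᵐ t ∂(volume.restrict (Ioo 0 T)), Integrable (f t)
  lintegral_lt_top : ∫⁻ t in Ioo 0 T, N (f t) < ⊤

/-- The supremum over `0 ≤ T ≤ Tmax` of the `L²` norms in time of `f` on the windows
`(T, min (T + 1) Tmax)`, when `N` is the square of the norm in space. -/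
def supWindow (N : (ℝ → ℂ) → ℝ≥0∞) (Tmax : ℝ) (f : ℝ → ℝ → ℂ) : ℝ≥0∞ :=
  ⨆ T ∈ Icc 0 Tmax, (∫⁻ t in Ioo T (min (T + 1) Tmax), N (f t)) ^ (1 / 2 : ℝ)

/-! ### Solutions -/

/-- `w ∈ H¹((0, T); L²(I))`, with time derivative `g` and value `w₀` at `t = 0`:
`g ∈ L²((0, T); L²(I))`, `w₀ ∈ L²(I)` and `w(t) = w₀ + ∫₀ᵗ g(s) ds`. -/
structure HasH1TimeDeriv (T : ℝ) (I : Set ℝ) (w g : ℝ → ℝ → ℂ) (w₀ : ℝ → ℂ) : Prop where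
  memLp_deriv : MemLp (Function.uncurry g) 2 (volume.restrict (Ioo 0 T ×ˢ I))
  memLp_init : MemLp w₀ 2 (volume.restrict I)
  eq_integral : ∀ᵐ x : ℝ × ℝ ∂(volume.restrict (Ioo 0 T ×ˢ I)),
    w x.1 x.2 = w₀ x.2 + ∫ s in (0 : ℝ)..x.1, g s x.2

/-- `w ∈ L^∞((0, T) × J₁) ∩ H¹((0, T); L²(J₂))` vanishes for `ξ ∉ J₁` and satisfies
`∂ₜ w = P w + Q` on `(0, T) × J₂`, in the sense of distributions in `ξ` for almost every `t`,
and `w(0) = 0` on `J₂`. -/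
structure IsSolution (T : ℝ) (w Q : ℝ → ℝ → ℂ) : Prop where
  bounded : MemLp (Function.uncurry w) ⊤ (volume.restrict (Ioo 0 T ×ˢ J₁))
  support : ∀ t ∈ Ioo 0 T, ∀ ξ, ξ ∉ J₁ → w t ξ = 0
  locallyIntegrable : ∀ᵐ t ∂(volume.restrict (Ioo 0 T)), LocallyIntegrableOn (Q t) J₂
  equation : ∃ g : ℝ → ℝ → ℂ, HasH1TimeDeriv T J₂ w g 0 ∧
    ∀ᵐ t ∂(volume.restrict (Ioo 0 T)), ∀ φ : ℝ → ℂ,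
      ContDiff ℝ ∞ φ → HasCompactSupport φ → tsupport φ ⊆ J₂ →
        ∫ ξ, g t ξ * φ ξ = pairP (w t) φ + ∫ ξ, Q t ξ * φ ξ

end LogKinetic

end

noncomputable section

/-! Up to the factor `e^{-ξ/2}`, `P` is the Fourier multiplier `-ρ₀`, and `Re ρ₀` grows like `log
|k|`. Write `ℓ = 1 + log (1 + |k|)` and `u = χ₀ w`. An energy estimate with weight `m` then
dissipates `‖m √ℓ û‖²` and needs the source only in the norm with weight `m / √ℓ`. Taking `m` close
to `|k|^σ` gives (i) and (ii); taking `m` close to `|k|^σ √ℓ` gives (iii), because `|ρ₀| ≤ 2 ℓ`.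
Coercivity (`ell_div_two_sub_one_le_re_rho0`), growth (`norm_rho0_le`) and the symbol estimates for
`ρ₀` (`norm_rhoCoeff_le`, `norm_rhoRem_le`) are all read off the partial fraction series
`hasSum_rho0`.

Three errors must be absorbed by the dissipation.

The variable coefficient. The equation is multiplied by `b = e^{ξ/2}`, which makes `P` a pure
multiplier, and the energy is the quadratic form of `b` at `m(D) u`. The commutator of `m(D)` with
`b` gains a full order. It acts on `∂ₜ u`, which the equation bounds at the cost of a logarithm only
(`exists_energy_inequality`).

The localization. The commutator of `ρ₀(D)` with `χ₀` acts on `w`, which has no regularity outside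
the cutoff. Let `χ₀ = ψ^n` with `n ≥ σ`, and let `ν` be a truncation of `|k|^{σ/n}`. Expand `ρ₀(k) -
ρ₀(l)` to order `n`. The `j`-th term carries a factor `O(|k|^{-j})` and the `j`-th derivative of
`ψ^n`, which still contains `ψ^{n-j}`, so it is bounded by the norm of `ν^{n-j}(D)(ψ^{n-j} w)`
(`exists_l2_rhoComm_le`). The numbers `A j = ‖ν^j(D)(ψ^j w)‖` are logarithmically convex up to lower
order terms (`exists_interpolation_step`). Hence each `A j` with `j < n` is at most a small multiple
of `A n`, which the dissipation absorbs, plus a multiple of `A 0 = ‖w‖`, which is controlled by the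
`L^∞` norm on `J₁`.

Low frequencies, where the logarithm is not large, are again bounded by `‖w‖`
(`exists_nrm_low_frequency_le`).

What remains is an inequality `E' + c D + c E ≤ S` with `E(0) = 0` and `E ≥ 0`, which bounds `∫ D`
over unit windows by the largest window integral of `S` (`window_dissipation_le`).

To keep all quantities finite the weights are truncated at frequency `N`. The constants depend on a
weight only through the Lipschitz constant of `log m` as a function of `log (1 + |k|)`, so they do
not depend on `N`, and Fatou's lemma removes the truncation. -/

namespace LogKinetic

/-! ### Slowly varying weights -/

/-- `1 + |k|`. -/
def jap (k : ℝ) : ℝ := 1 + |k|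

lemma one_le_jap (k : ℝ) : 1 ≤ jap k := by unfold jap; linarith [abs_nonneg k]

lemma jap_pos (k : ℝ) : 0 < jap k := lt_of_lt_of_le one_pos (one_le_jap k)

lemma log_jap_nonneg (k : ℝ) : 0 ≤ Real.log (jap k) := Real.log_nonneg (one_le_jap k)

lemma abs_le_jap (k : ℝ) : |k| ≤ jap k := by unfold jap; linarith

lemma continuous_jap : Continuous jap := by unfold jap; fun_prop

lemma jap_sub_comm (k l : ℝ) : jap (k - l) = jap (l - k) := by simp [jap, abs_sub_comm]

lemma jap_le_mul (k l : ℝ) : jap k ≤ jap (k - l) * jap l := by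
  have h : |k| ≤ |k - l| + |l| := by simpa using abs_add_le (k - l) l
  unfold jap
  nlinarith [abs_nonneg (k - l), abs_nonneg l, mul_nonneg (abs_nonneg (k - l)) (abs_nonneg l)]

lemma log_jap_sub_le (k l : ℝ) : Real.log (jap k) - Real.log (jap l) ≤ Real.log (jap (k - l)) := by
  have h := Real.log_le_log (jap_pos k) (jap_le_mul k l)
  rw [Real.log_mul (jap_pos _).ne' (jap_pos _).ne'] at h
  linarith

lemma abs_log_jap_sub_le (k l : ℝ) :
    |Real.log (jap k) - Real.log (jap l)| ≤ Real.log (jap (k - l)) := by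
  rw [abs_sub_le_iff]
  exact ⟨log_jap_sub_le k l, by rw [jap_sub_comm]; exact log_jap_sub_le l k⟩

lemma log_jap_sub_le_div (k l : ℝ) :
    Real.log (jap k) - Real.log (jap l) ≤ |k - l| / jap l := by
  rw [← Real.log_div (jap_pos _).ne' (jap_pos _).ne']
  refine (Real.log_le_sub_one_of_pos (div_pos (jap_pos _) (jap_pos _))).trans ?_
  rw [div_sub_one (jap_pos l).ne']
  gcongr
  · exact (jap_pos l).le
  · have h : |k| ≤ |k - l| + |l| := by simpa using abs_add_le (k - l) l
    unfold jap
    linarith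

/-- The logarithm of `1 + |k|` has slope of size `1 / (1 + |k|)`. One sign of the difference
produces `jap k` in the denominator; it is exchanged for `jap l` at the cost of a second factor `jap
(k - l)`. The gain `1 / jap l` is the order won by commutators. -/
lemma abs_log_jap_sub_le_div (k l : ℝ) :
    |Real.log (jap k) - Real.log (jap l)| ≤ jap (k - l) ^ 2 / jap l := by
  have h1 := one_le_jap (k - l)
  have h2 := abs_le_jap (k - l)
  rw [abs_sub_le_iff]
  constructor
  · refine (log_jap_sub_le_div k l).trans ?_
    gcongr
    · exact (jap_pos l).le
    · nlinarith
  · refine (log_jap_sub_le_div l k).trans ?_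
    rw [div_le_div_iff₀ (jap_pos _) (jap_pos _), abs_sub_comm]
    have h3 := jap_le_mul l k
    rw [jap_sub_comm] at h3
    calc |k - l| * jap l ≤ jap (k - l) * (jap (k - l) * jap k) := by
          gcongr
          exact (jap_pos l).le
      _ = _ := by ring

/-- A positive weight whose logarithm is Lipschitz with respect to `log (1 + |k|)`. -/
structure Slow (p : ℕ) (m : ℝ → ℝ) : Prop where
  pos : ∀ k, 0 < m k
  lip : ∀ k l, |Real.log (m k) - Real.log (m l)| ≤ p * |Real.log (jap k) - Real.log (jap l)|

namespace Slow

variable {p q : ℕ} {m m' : ℝ → ℝ}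

/-- Peetre's inequality for slow weights. The loss depends on `k - l` only, where the rapid decay of
`sharp φ (k - l)` absorbs it, and it involves the weight only through `p`. -/
lemma le_mul (h : Slow p m) (k l : ℝ) : m k ≤ jap (k - l) ^ p * m l := by
  rw [← Real.log_le_log_iff (h.pos k) (mul_pos (pow_pos (jap_pos _) _) (h.pos l)),
    Real.log_mul (pow_pos (jap_pos _) _).ne' (h.pos l).ne', Real.log_pow]
  have h1 := (le_abs_self _).trans (h.lip k l)
  have h2 := mul_le_mul_of_nonneg_left (abs_log_jap_sub_le k l) (Nat.cast_nonneg (α := ℝ) p)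
  linarith

/-- With `X = log (m k / m l)` this is `|e^X - 1| ≤ |X| e^{|X|}`: the factor `|X|` provides the gain
`1 / jap l`, and the exponential provides the Peetre loss. -/
lemma abs_sub_le (h : Slow p m) (k l : ℝ) :
    |m k - m l| ≤ jap (k - l) ^ (p + 2) * (p * (m l / jap l)) := by
  set X := Real.log (m k) - Real.log (m l) with hX
  have hk : m k = m l * Real.exp X := by
    rw [hX, Real.exp_sub, Real.exp_log (h.pos k), Real.exp_log (h.pos l)]
    field_simp [(h.pos l).ne']
  have hexp : |Real.exp X - 1| ≤ |X| * Real.exp |X| := by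
    rcases le_total 0 X with h0 | h0
    · rw [abs_of_nonneg h0, abs_of_nonneg (by linarith [Real.add_one_le_exp X])]
      have := Real.add_one_le_exp (-X)
      have h3 : Real.exp (-X) * Real.exp X = 1 := by rw [← Real.exp_add]; simp
      nlinarith [Real.exp_pos X]
    · rw [abs_of_nonpos h0, abs_of_nonpos (by linarith [Real.exp_le_one_iff.2 h0])]
      have := Real.add_one_le_exp X
      have h3 : 1 ≤ Real.exp (-X) := Real.one_le_exp (by linarith)
      nlinarith
  have hX1 : |X| ≤ p * (jap (k - l) ^ 2 / jap l) :=
    (h.lip k l).trans (mul_le_mul_of_nonneg_left (abs_log_jap_sub_le_div k l) (Nat.cast_nonneg p))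
  have hX2 : Real.exp |X| ≤ jap (k - l) ^ p := by
    rw [← Real.exp_log (pow_pos (jap_pos (k - l)) p), Real.log_pow]
    exact Real.exp_le_exp.2 ((h.lip k l).trans
      (mul_le_mul_of_nonneg_left (abs_log_jap_sub_le k l) (Nat.cast_nonneg p)))
  have hl := h.pos l
  rw [hk, show m l * Real.exp X - m l = m l * (Real.exp X - 1) by ring, abs_mul, abs_of_pos hl]
  calc m l * |Real.exp X - 1| ≤ m l * ((p * (jap (k - l) ^ 2 / jap l)) * jap (k - l) ^ p) := by
        gcongr
        refine hexp.trans ?_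
        have : 0 ≤ (p : ℝ) * (jap (k - l) ^ 2 / jap l) := (abs_nonneg X).trans hX1
        gcongr
    _ = _ := by ring

lemma mul (h : Slow p m) (h' : Slow q m') : Slow (p + q) (fun k => m k * m' k) where
  pos k := mul_pos (h.pos k) (h'.pos k)
  lip k l := by
    rw [Real.log_mul (h.pos k).ne' (h'.pos k).ne', Real.log_mul (h.pos l).ne' (h'.pos l).ne']
    have := abs_add_le (Real.log (m k) - Real.log (m l)) (Real.log (m' k) - Real.log (m' l))
    have h1 := h.lip k l
    have h2 := h'.lip k l
    push_cast
    rw [add_mul]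
    rw [show Real.log (m k) + Real.log (m' k) - (Real.log (m l) + Real.log (m' l)) =
      (Real.log (m k) - Real.log (m l)) + (Real.log (m' k) - Real.log (m' l)) by ring]
    linarith

lemma pow (h : Slow p m) (j : ℕ) : Slow (j * p) (fun k => m k ^ j) where
  pos k := pow_pos (h.pos k) _
  lip k l := by
    rw [Real.log_pow, Real.log_pow, ← mul_sub, abs_mul, Nat.abs_cast]
    push_cast
    rw [mul_assoc]
    exact mul_le_mul_of_nonneg_left (h.lip k l) (Nat.cast_nonneg j)

lemma inv (h : Slow p m) : Slow p (fun k => (m k)⁻¹) where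
  pos k := inv_pos.2 (h.pos k)
  lip k l := by
    rw [Real.log_inv, Real.log_inv, neg_sub_neg, abs_sub_comm]
    exact h.lip k l

lemma mono (h : Slow p m) (hpq : p ≤ q) : Slow q m where
  pos := h.pos
  lip k l := (h.lip k l).trans (by gcongr)

end Slow

lemma slow_jap : Slow 1 jap where
  pos := jap_pos
  lip k l := by simp

/-- `1 + log (1 + |k|)`. -/
def ell (k : ℝ) : ℝ := 1 + Real.log (jap k)

lemma one_le_ell (k : ℝ) : 1 ≤ ell k := by unfold ell; linarith [log_jap_nonneg k]

lemma ell_pos (k : ℝ) : 0 < ell k := lt_of_lt_of_le one_pos (one_le_ell k)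

lemma ell_le_jap (k : ℝ) : ell k ≤ jap k := by
  unfold ell
  linarith [Real.log_le_sub_one_of_pos (jap_pos k)]

lemma continuous_ell : Continuous ell :=
  continuous_const.add (continuous_jap.log fun k => (jap_pos k).ne')

lemma slow_ell : Slow 1 ell where
  pos := ell_pos
  lip k l := by
    have key : ∀ k l, Real.log (ell k) - Real.log (ell l) ≤
        |Real.log (jap k) - Real.log (jap l)| := by
      intro k l
      rw [← Real.log_div (ell_pos _).ne' (ell_pos _).ne']
      refine (Real.log_le_sub_one_of_pos (div_pos (ell_pos _) (ell_pos _))).trans ?_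
      rw [div_sub_one (ell_pos l).ne', div_le_iff₀ (ell_pos l)]
      have h1 := le_abs_self (Real.log (jap k) - Real.log (jap l))
      have h2 := one_le_ell l
      have h3 : ell k - ell l = Real.log (jap k) - Real.log (jap l) := by unfold ell; ring
      rw [h3]
      nlinarith [abs_nonneg (Real.log (jap k) - Real.log (jap l))]
    rw [Nat.cast_one, one_mul, abs_sub_le_iff]
    exact ⟨key k l, by rw [abs_sub_comm (Real.log (jap k))]; exact key l k⟩

/-- The square root of `1 + log (1 + |k|)`. -/
def sell (k : ℝ) : ℝ := Real.sqrt (ell k)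

lemma sell_sq (k : ℝ) : sell k ^ 2 = ell k := Real.sq_sqrt (ell_pos k).le

lemma one_le_sell (k : ℝ) : 1 ≤ sell k := by
  rw [sell, Real.one_le_sqrt]; exact one_le_ell k

lemma sell_pos (k : ℝ) : 0 < sell k := lt_of_lt_of_le one_pos (one_le_sell k)

lemma continuous_sell : Continuous sell := continuous_ell.sqrt

lemma sell_le_ell (k : ℝ) : sell k ≤ ell k := by
  rw [← sell_sq]; nlinarith [one_le_sell k]

lemma slow_sell : Slow 1 sell where
  pos := sell_pos
  lip k l := by
    refine le_trans ?_ (slow_ell.lip k l)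
    rw [sell, sell, Real.log_sqrt (ell_pos k).le, Real.log_sqrt (ell_pos l).le, ← sub_div, abs_div,
      abs_of_pos (by norm_num : (0 : ℝ) < 2)]
    linarith [abs_nonneg (Real.log (ell k) - Real.log (ell l))]

lemma slow_jap_rpow {a : ℝ} (ha : 0 ≤ a) (ha1 : a ≤ 1) : Slow 1 (fun k => jap k ^ a) where
  pos k := Real.rpow_pos_of_pos (jap_pos k) a
  lip k l := by
    rw [Real.log_rpow (jap_pos k), Real.log_rpow (jap_pos l), ← mul_sub, abs_mul, abs_of_nonneg ha,
      Nat.cast_one]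
    gcongr

/-- The truncation factor `min (1, N / (1 + |k|))`. -/
def trunc (N : ℝ) (k : ℝ) : ℝ := min 1 (N / jap k)

lemma trunc_pos {N : ℝ} (hN : 0 < N) (k : ℝ) : 0 < trunc N k :=
  lt_min one_pos (div_pos hN (jap_pos k))

lemma trunc_le_one (N k : ℝ) : trunc N k ≤ 1 := min_le_left _ _

/-- The logarithm of the truncation is `min 0 (log N - log jap)`, and taking a minimum with a
constant is 1-Lipschitz. The constant is therefore the same for all `N`. -/
lemma slow_trunc {N : ℝ} (hN : 0 < N) : Slow 1 (trunc N) where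
  pos := trunc_pos hN
  lip k l := by
    have key : ∀ k, Real.log (trunc N k) = min 0 (Real.log N - Real.log (jap k)) := by
      intro k
      unfold trunc
      rw [← Real.log_div hN.ne' (jap_pos k).ne', ← Real.log_one]
      rcases le_total 1 (N / jap k) with h | h
      · rw [min_eq_left h, min_eq_left (Real.log_le_log one_pos h)]
      · rw [min_eq_right h, min_eq_right (Real.log_le_log (div_pos hN (jap_pos k)) h)]
    rw [key, key, Nat.cast_one, one_mul, abs_sub_comm (Real.log (jap k))]
    refine (abs_min_sub_min_le_max _ _ _ _).trans ?_
    rw [sub_self, abs_zero, max_eq_right (abs_nonneg _)]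
    apply le_of_eq
    congr 1
    ring

/-- The truncated power weight `(1 + |k|) ^ a * min (1, N / (1 + |k|)) ^ 4`. -/
def omega (a N : ℝ) (k : ℝ) : ℝ := jap k ^ a * trunc N k ^ 4

/-- The index `5 = 1 + 4` depends neither on `a` nor on `N`, so every estimate that sees the weight
through slowness is uniform in the truncation. The fourth power of the truncation makes `omega`
decay like `jap⁻³` when `a ≤ 1`. -/
lemma slow_omega {a N : ℝ} (ha : 0 ≤ a) (ha1 : a ≤ 1) (hN : 0 < N) : Slow 5 (omega a N) :=
  (slow_jap_rpow ha ha1).mul ((slow_trunc hN).pow 4)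

lemma continuous_omega (a N : ℝ) : Continuous (omega a N) := by
  unfold omega trunc
  refine (continuous_jap.rpow_const fun k => Or.inl (jap_pos k).ne').mul
    ((continuous_const.min (continuous_const.div continuous_jap fun k => (jap_pos k).ne')).pow 4)

lemma omega_le_jap_rpow {a N : ℝ} (hN : 0 < N) (k : ℝ) : omega a N k ≤ jap k ^ a :=
  mul_le_of_le_one_right (Real.rpow_nonneg (jap_pos k).le a)
    (pow_le_one₀ (trunc_pos hN k).le (trunc_le_one N k))

lemma omega_le_jap {a N : ℝ} (ha1 : a ≤ 1) (hN : 0 < N) (k : ℝ) : omega a N k ≤ jap k := by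
  refine (omega_le_jap_rpow hN k).trans ?_
  simpa using Real.rpow_le_rpow_of_exponent_le (one_le_jap k) ha1

/-- The decay of `ω ^ n`. -/
lemma omega_pow_le {a N : ℝ} (ha1 : a ≤ 1) (hN : 0 < N) {n : ℕ} (hn : 1 ≤ n) (k : ℝ) :
    omega a N k ^ n ≤ N ^ (4 * n) / jap k ^ 3 := by
  have hJ := jap_pos k
  have h1 : omega a N k ≤ N ^ 4 / jap k ^ 3 := by
    have h2 : jap k ^ a ≤ jap k := by
      simpa using Real.rpow_le_rpow_of_exponent_le (one_le_jap k) ha1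
    have h3 : trunc N k ^ 4 ≤ (N / jap k) ^ 4 :=
      pow_le_pow_left₀ (trunc_pos hN k).le (min_le_right _ _) 4
    calc omega a N k ≤ jap k * (N / jap k) ^ 4 := by
          unfold omega
          gcongr
      _ = N ^ 4 / jap k ^ 3 := by field_simp
  have h0 : 0 ≤ omega a N k :=
    mul_nonneg (Real.rpow_nonneg hJ.le a) (pow_nonneg (trunc_pos hN k).le 4)
  calc omega a N k ^ n ≤ (N ^ 4 / jap k ^ 3) ^ n := pow_le_pow_left₀ h0 h1 n
    _ = N ^ (4 * n) / (jap k ^ 3) ^ n := by rw [div_pow, pow_mul]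
    _ ≤ N ^ (4 * n) / jap k ^ 3 := by
      gcongr
      exact le_self_pow₀ (one_le_pow₀ (one_le_jap k)) (by omega)

/-! ### The series for `ρ₀` -/

lemma _root_.HasSum.congr_terms {f g : ℕ → ℂ} {a : ℂ} (h : HasSum f a) (hfg : ∀ n, g n = f n) :
    HasSum g a := by
  rwa [show g = f from funext hfg]

/-- The sign `i (-1) ^ (n + 1)`. -/
def sgnI (n : ℕ) : ℂ := if Even n then -Complex.I else Complex.I

/-- The denominators `n + 1 ± i k` of the series for `ρ₀`. -/
def den (n : ℕ) (k : ℝ) : ℂ := (n + 1 : ℂ) + sgnI n * k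

/-- The half line on which the `n`-th exponential occurs in the kernel. -/
def halfLine (n : ℕ) : Set ℝ := if Even n then Iio 0 else Ioi 0

lemma norm_sgnI (n : ℕ) : ‖sgnI n‖ = 1 := by
  unfold sgnI; split_ifs <;> simp

lemma sgnI_re (n : ℕ) : (sgnI n).re = 0 := by
  unfold sgnI; split_ifs <;> simp

lemma sgnI_im_abs (n : ℕ) : |(sgnI n).im| = 1 := by
  unfold sgnI; split_ifs <;> simp

lemma den_re (n : ℕ) (k : ℝ) : (den n k).re = n + 1 := by
  simp [den, sgnI_re]

lemma den_im_abs (n : ℕ) (k : ℝ) : |(den n k).im| = |k| := by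
  simp [den, sgnI_re, abs_mul, sgnI_im_abs]

lemma den_ne_zero (n : ℕ) (k : ℝ) : den n k ≠ 0 := by
  intro h
  have := den_re n k
  rw [h, Complex.zero_re] at this
  have h2 : (0 : ℝ) ≤ n := Nat.cast_nonneg n
  linarith

lemma le_norm_den (n : ℕ) (k : ℝ) : (n + jap k) / 2 ≤ ‖den n k‖ := by
  have h1 := Complex.abs_re_le_norm (den n k)
  have h2 := Complex.abs_im_le_norm (den n k)
  rw [den_im_abs] at h2
  have h3 := (le_abs_self _).trans h1
  rw [den_re] at h3
  unfold jap
  linarith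

/-- The terms of the exponential expansion of the integrand in the definition of `ρ₀`. -/
def expTerm (k : ℝ) (n : ℕ) (x : ℝ) : ℂ :=
  (halfLine n).indicator
    (fun x => 2 * (Real.exp (-(n + 1) * |x|) : ℂ) * (1 - Complex.exp (-(Complex.I * k * x)))) x

lemma measurableSet_halfLine (n : ℕ) : MeasurableSet (halfLine n) := by
  unfold halfLine; split_ifs <;> measurability

lemma norm_one_sub_exp_le (k x : ℝ) :
    ‖1 - Complex.exp (-(Complex.I * k * x))‖ ≤ |k| * |x| := by
  have := Real.norm_exp_I_mul_ofReal_sub_one_le (x := -(k * x))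
  rw [norm_sub_rev]
  have h : Complex.exp (-(Complex.I * k * x)) = Complex.exp (Complex.I * ((-(k * x) : ℝ) : ℂ)) := by
    congr 1; push_cast; ring
  rw [h]
  simpa [abs_mul] using this

lemma integrable_exp_neg_mul_abs {a : ℝ} (ha : 0 < a) : Integrable (fun x : ℝ => Real.exp (-a * |x|)) := by
  have h1 : IntegrableOn (fun x : ℝ => Real.exp (-a * |x|)) (Ioi 0) := by
    refine (exp_neg_integrableOn_Ioi 0 ha).congr_fun (fun x hx => ?_) measurableSet_Ioi
    simp [abs_of_pos (show (0 : ℝ) < x from hx)]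
  have h2 : IntegrableOn (fun x : ℝ => Real.exp (-a * |x|)) (Iic 0) := by
    refine (integrableOn_exp_mul_Iic ha 0).congr_fun (fun x hx => ?_) measurableSet_Iic
    simp [abs_of_nonpos (show x ≤ 0 from hx)]
  rw [← integrableOn_univ, ← Iic_union_Ioi (a := (0 : ℝ))]
  exact h2.union h1

lemma integral_exp_neg_mul_abs {a : ℝ} (ha : 0 < a) : ∫ x : ℝ, Real.exp (-a * |x|) = 2 / a := by
  rw [integral_comp_abs (f := fun x => Real.exp (-a * x)), integral_exp_mul_Ioi (by linarith)]
  simp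
  ring

/-- Half of the exponential absorbs the factor `|x|` from `|1 - e^{-ikx}| ≤ |k| |x|`, by `y e^{-y} ≤
1`. This yields one factor `1/(n+1)`; integrating the other half yields a second one, hence a
summable series. -/
lemma norm_expTerm_le (k : ℝ) (n : ℕ) (x : ℝ) :
    ‖expTerm k n x‖ ≤ 4 * |k| / (n + 1) * Real.exp (-((n + 1) / 2) * |x|) := by
  have hn : (0 : ℝ) < n + 1 := by positivity
  unfold expTerm
  refine (norm_indicator_le_norm_self _ _).trans ?_
  rw [norm_mul, norm_mul, Complex.norm_real, Real.norm_of_nonneg (Real.exp_pos _).le,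
    Complex.norm_two]
  have h1 := norm_one_sub_exp_le k x
  have h2 : (n + 1) / 2 * |x| ≤ Real.exp ((n + 1) / 2 * |x|) := by
    linarith [Real.add_one_le_exp ((n + 1) / 2 * |x|)]
  have h3 : Real.exp (-(n + 1) * |x|) =
      Real.exp (-((n + 1) / 2) * |x|) * Real.exp (-((n + 1) / 2 * |x|)) := by
    rw [← Real.exp_add]; congr 1; ring
  have h4 : Real.exp ((n + 1) / 2 * |x|) * Real.exp (-((n + 1) / 2 * |x|)) = 1 := by
    rw [← Real.exp_add]; simp
  have h5 : |x| * Real.exp (-((n + 1) / 2 * |x|)) ≤ 2 / (n + 1) := by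
    rw [le_div_iff₀ hn]
    nlinarith [Real.exp_pos (-((n + 1) / 2 * |x|))]
  calc 2 * Real.exp (-(n + 1) * |x|) * ‖1 - Complex.exp (-(Complex.I * k * x))‖
      ≤ 2 * Real.exp (-(n + 1) * |x|) * (|k| * |x|) := by gcongr
    _ = 2 * |k| * Real.exp (-((n + 1) / 2) * |x|) * (|x| * Real.exp (-((n + 1) / 2 * |x|))) := by
        rw [h3]; ring
    _ ≤ 2 * |k| * Real.exp (-((n + 1) / 2) * |x|) * (2 / (n + 1)) := by gcongr
    _ = _ := by ring

lemma integrable_expTerm (k : ℝ) (n : ℕ) : Integrable (expTerm k n) := by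
  have hn : (0 : ℝ) < (n + 1) / 2 := by positivity
  refine ((integrable_exp_neg_mul_abs hn).const_mul (4 * |k| / (n + 1))).mono' ?_
    (Eventually.of_forall (norm_expTerm_le k n))
  refine AEStronglyMeasurable.indicator ?_ (measurableSet_halfLine n)
  exact (Continuous.aestronglyMeasurable (by fun_prop))

lemma summable_integral_norm_expTerm (k : ℝ) : Summable fun n => ∫ x, ‖expTerm k n x‖ := by
  have hs : Summable fun n : ℕ => 16 * |k| * (1 / ((n : ℝ) + 1) ^ 2) := by
    refine Summable.mul_left _ ?_
    have := (summable_nat_add_iff 1).2 (Real.summable_one_div_nat_pow.2 (by norm_num : 1 < 2))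
    simpa using this
  refine Summable.of_nonneg_of_le (fun n => integral_nonneg fun x => norm_nonneg _) (fun n => ?_) hs
  have hn : (0 : ℝ) < (n + 1) / 2 := by positivity
  calc ∫ x, ‖expTerm k n x‖ ≤ ∫ x, 4 * |k| / (n + 1) * Real.exp (-((n + 1) / 2) * |x|) :=
        integral_mono (integrable_expTerm k n).norm
          ((integrable_exp_neg_mul_abs hn).const_mul _) (norm_expTerm_le k n)
    _ = _ := by
        rw [integral_const_mul, integral_exp_neg_mul_abs hn]
        field_simp
        ring

lemma integral_expTerm (k : ℝ) (n : ℕ) :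
    ∫ x, expTerm k n x = 2 * (1 / (n + 1 : ℂ) - 1 / den n k) := by
  have hpos : (0 : ℝ) < n + 1 := by positivity
  have hne : (n + 1 : ℂ) ≠ 0 := by exact_mod_cast hpos.ne'
  have hd := den_ne_zero n k
  unfold expTerm
  rw [integral_indicator (measurableSet_halfLine n)]
  unfold halfLine den at *
  unfold sgnI at *
  split_ifs with h
  · rw [if_pos h] at hd
    rw [← integral_Iic_eq_integral_Iio]
    have e1 : ∀ x ∈ Iic (0 : ℝ), 2 * (Real.exp (-(n + 1) * |x|) : ℂ) *
        (1 - Complex.exp (-(Complex.I * k * x))) =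
        2 * (Complex.exp ((n + 1 : ℂ) * x) - Complex.exp ((n + 1 + -Complex.I * k) * x)) := by
      intro x hx
      rw [abs_of_nonpos hx]
      push_cast
      rw [mul_assoc, mul_sub, mul_one, ← Complex.exp_add]
      congr 2
      · congr 1; ring
      · congr 1; ring
    rw [setIntegral_congr_fun measurableSet_Iic e1, integral_const_mul, integral_sub,
      integral_exp_mul_complex_Iic (by simpa using hpos),
      integral_exp_mul_complex_Iic (by simpa using hpos)]
    · simp
    · exact integrableOn_exp_mul_complex_Iic (by simpa using hpos) 0
    · exact integrableOn_exp_mul_complex_Iic (by simpa using hpos) 0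
  · rw [if_neg h] at hd
    have e1 : ∀ x ∈ Ioi (0 : ℝ), 2 * (Real.exp (-(n + 1) * |x|) : ℂ) *
        (1 - Complex.exp (-(Complex.I * k * x))) =
        2 * (Complex.exp (-(n + 1 : ℂ) * x) - Complex.exp (-(n + 1 + Complex.I * k) * x)) := by
      intro x hx
      rw [abs_of_pos hx]
      push_cast
      rw [mul_assoc, mul_sub, mul_one, ← Complex.exp_add]
      congr 3
      ring
    rw [setIntegral_congr_fun measurableSet_Ioi e1, integral_const_mul, integral_sub,
      integral_exp_mul_complex_Ioi (by simp; linarith),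
      integral_exp_mul_complex_Ioi (by simp; linarith)]
    · simp only [Complex.ofReal_zero, mul_zero, Complex.exp_zero]
      rw [neg_div_neg_eq, neg_div_neg_eq]
    · exact integrableOn_exp_mul_complex_Ioi (by simp; linarith) 0
    · exact integrableOn_exp_mul_complex_Ioi (by simp; linarith) 0

/-- A closed form of a geometric series in `e^{-2x}`. For positive `x` the exponents are `2, 4, 6,
…`; for negative `x` they are `1, 3, 5, …` in `|x|`. This is why the parity of `n` decides the half
line and the sign of `i` in `den`. -/
lemma kernel_of_pos {x : ℝ} (hx : 0 < x) :
    kernel x = 2 * Real.exp (-x) ^ 2 * (1 - Real.exp (-x) ^ 2)⁻¹ := by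
  have h1 : Real.exp (-x) < 1 := Real.exp_lt_one_iff.2 (by linarith)
  have h0 := Real.exp_pos (-x)
  unfold kernel
  set r := Real.exp (-x)
  rw [abs_of_pos (by linarith)]
  have h2 : 1 - r ≠ 0 := by linarith
  have h3 : 1 + r ≠ 0 := by linarith
  have h4 : 1 - r ^ 2 ≠ 0 := by
    rw [show 1 - r ^ 2 = (1 - r) * (1 + r) by ring]; exact mul_ne_zero h2 h3
  rw [show 1 - r ^ 2 = (1 - r) * (1 + r) by ring]
  field_simp
  ring

lemma kernel_of_neg {x : ℝ} (hx : x < 0) :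
    kernel x = 2 * Real.exp x * (1 - Real.exp x ^ 2)⁻¹ := by
  have h1 : Real.exp x < 1 := Real.exp_lt_one_iff.2 hx
  have h0 := Real.exp_pos x
  unfold kernel
  rw [Real.exp_neg]
  set r := Real.exp x
  have h5 : 1 < r⁻¹ := (one_lt_inv₀ h0).2 h1
  rw [abs_of_neg (by linarith)]
  have h2 : 1 - r ≠ 0 := by linarith
  have h3 : 1 + r ≠ 0 := by linarith
  have h6 : -(1 - r⁻¹) = (1 - r) / r := by field_simp; ring
  have h7 : 1 + r⁻¹ = (1 + r) / r := by field_simp; ring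
  rw [h6, h7, show 1 - r ^ 2 = (1 - r) * (1 + r) by ring]
  field_simp
  ring

lemma hasSum_expTerm (k : ℝ) {x : ℝ} (hx : x ≠ 0) :
    HasSum (fun n => expTerm k n x)
      ((kernel x : ℂ) * (1 - Complex.exp (-(Complex.I * k * x)))) := by
  set c := 1 - Complex.exp (-(Complex.I * k * x))
  rcases lt_or_gt_of_ne hx with h | h
  · have h1 : Real.exp x ^ 2 < 1 := pow_lt_one₀ (Real.exp_pos x).le (Real.exp_lt_one_iff.2 h) (by norm_num)
    have hg : HasSum (fun m : ℕ => 2 * Real.exp x * (Real.exp x ^ 2) ^ m) (kernel x) := by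
      rw [kernel_of_neg h]
      exact (hasSum_geometric_of_lt_one (sq_nonneg _) h1).mul_left _
    have he : HasSum (fun m : ℕ => expTerm k (2 * m) x) (kernel x * c) := by
      refine ((Complex.hasSum_ofReal.2 hg).mul_right c).congr_terms fun m => ?_
      simp only [expTerm, halfLine]
      rw [if_pos (by simp), indicator_of_mem (by exact h), abs_of_neg h]
      have : Real.exp (-(((2 * m : ℕ) : ℝ) + 1) * -x) = Real.exp x * (Real.exp x ^ 2) ^ m := by
        rw [← Real.exp_nat_mul, ← Real.exp_nat_mul, ← Real.exp_add]
        congr 1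
        push_cast
        ring
      rw [this]
      push_cast
      ring
    have ho : HasSum (fun m : ℕ => expTerm k (2 * m + 1) x) 0 := by
      refine hasSum_zero.congr_terms fun m => ?_
      simp only [expTerm, halfLine]
      rw [if_neg (by simp), indicator_of_notMem (by simpa using h.le)]
    have := HasSum.even_add_odd (f := fun n => expTerm k n x) he ho
    rwa [add_zero] at this
  · have h1 : Real.exp (-x) ^ 2 < 1 :=
      pow_lt_one₀ (Real.exp_pos _).le (Real.exp_lt_one_iff.2 (by linarith)) (by norm_num)
    have hg : HasSum (fun m : ℕ => 2 * Real.exp (-x) ^ 2 * (Real.exp (-x) ^ 2) ^ m) (kernel x) := by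
      rw [kernel_of_pos h]
      exact (hasSum_geometric_of_lt_one (sq_nonneg _) h1).mul_left _
    have ho : HasSum (fun m : ℕ => expTerm k (2 * m + 1) x) (kernel x * c) := by
      refine ((Complex.hasSum_ofReal.2 hg).mul_right c).congr_terms fun m => ?_
      simp only [expTerm, halfLine]
      rw [if_neg (by simp), indicator_of_mem (by exact h), abs_of_pos h]
      have : Real.exp (-(((2 * m + 1 : ℕ) : ℝ) + 1) * x) =
          Real.exp (-x) ^ 2 * (Real.exp (-x) ^ 2) ^ m := by
        rw [← Real.exp_nat_mul, ← Real.exp_nat_mul, ← Real.exp_add]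
        congr 1
        push_cast
        ring
      rw [this]
      push_cast
      ring
    have he : HasSum (fun m : ℕ => expTerm k (2 * m) x) 0 := by
      refine hasSum_zero.congr_terms fun m => ?_
      simp only [expTerm, halfLine]
      rw [if_pos (by simp), indicator_of_notMem (by simpa using h.le)]
    have := HasSum.even_add_odd (f := fun n => expTerm k n x) he ho
    rwa [zero_add] at this

/-- The series of partial fractions for `ρ₀`. -/
theorem hasSum_rho0 (k : ℝ) : HasSum (fun n : ℕ => 1 / (n + 1 : ℂ) - 1 / den n k) (rho0 k) := by
  have h := hasSum_integral_of_summable_integral_norm (integrable_expTerm k)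
    (summable_integral_norm_expTerm k)
  have e : ∫ x, ∑' n, expTerm k n x =
      ∫ x : ℝ, (kernel x : ℂ) * (1 - Complex.exp (-(Complex.I * k * x))) := by
    refine integral_congr_ae ?_
    have : ∀ᵐ x : ℝ, x ≠ 0 := by simp [ae_iff]
    filter_upwards [this] with x hx using (hasSum_expTerm k hx).tsum_eq
  rw [e] at h
  have h2 := h.mul_left (1 / 2 : ℂ)
  unfold rho0
  refine h2.congr_terms fun n => ?_
  rw [integral_expTerm]
  ring

/-! ### Bounds and expansions of `ρ₀` -/

/-- Comparison with a telescoping series: each term is at most `2 x^{-(j-1)}` times the difference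
of `1/(n+x)` at consecutive integers. -/
lemma summable_tail {x : ℝ} (hx : 1 ≤ x) {j : ℕ} (hj : 1 ≤ j) :
    (Summable fun n : ℕ => 1 / (n + x) ^ (j + 1)) ∧ ∑' n : ℕ, 1 / (n + x) ^ (j + 1) ≤ 2 / x ^ j := by
  have hpos : ∀ n : ℕ, 0 < n + x := fun n => by positivity
  have hterm : ∀ n : ℕ, 1 / (n + x) ^ (j + 1) ≤
      2 / x ^ (j - 1) * (1 / (n + x) - 1 / ((n + 1 : ℕ) + x)) := by
    intro n
    obtain ⟨i, rfl⟩ : ∃ i, j = i + 1 := ⟨j - 1, by omega⟩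
    have h1 : x ≤ n + x := by linarith [(Nat.cast_nonneg n : (0 : ℝ) ≤ n)]
    have h2 := hpos n
    have h3 : 1 / (n + x) - 1 / ((n + 1 : ℕ) + x) = 1 / ((n + x) * (n + x + 1)) := by
      push_cast
      have : (n : ℝ) + 1 + x ≠ 0 := by positivity
      field_simp
      ring
    rw [h3, Nat.add_sub_cancel, ← mul_div_mul_comm, div_le_div_iff₀ (by positivity) (by positivity),
      mul_one, one_mul]
    calc x ^ i * ((n + x) * (n + x + 1)) ≤ (n + x) ^ i * ((n + x) * (2 * (n + x))) := by
          gcongr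
          linarith
      _ = _ := by ring
  have hsum : ∀ M : ℕ, ∑ n ∈ Finset.range M, 1 / (n + x) ^ (j + 1) ≤ 2 / x ^ j := by
    intro M
    refine (Finset.sum_le_sum fun n _ => hterm n).trans ?_
    rw [← Finset.mul_sum, Finset.sum_range_sub' (fun n : ℕ => 1 / (n + x))]
    have h4 : 0 ≤ 1 / ((M : ℝ) + x) := by have := hpos M; positivity
    calc 2 / x ^ (j - 1) * (1 / ((0 : ℕ) + x) - 1 / (M + x)) ≤ 2 / x ^ (j - 1) * (1 / x) := by
          gcongr
          push_cast
          rw [zero_add]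
          linarith
      _ = 2 / x ^ j := by
          obtain ⟨i, rfl⟩ : ∃ i, j = i + 1 := ⟨j - 1, by omega⟩
          rw [Nat.add_sub_cancel, ← mul_div_mul_comm, mul_one, pow_succ]
  have hnn : ∀ n : ℕ, 0 ≤ 1 / (n + x) ^ (j + 1) := fun n => by have := hpos n; positivity
  exact ⟨summable_of_sum_range_le hnn hsum, Real.tsum_le_of_sum_range_le hnn hsum⟩

lemma norm_inv_den_pow_le (n j : ℕ) (k : ℝ) : ‖(1 / den n k) ^ j‖ ≤ 2 ^ j / (n + jap k) ^ j := by
  have h1 : 0 < n + jap k := by have := jap_pos k; positivity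
  rw [norm_pow, ← div_pow]
  refine pow_le_pow_left₀ (norm_nonneg _) ?_ j
  rw [norm_div, norm_one, div_le_div_iff₀ (norm_pos_iff.2 (den_ne_zero n k)) h1]
  linarith [le_norm_den n k]

lemma norm_inv_den_le (n : ℕ) (k : ℝ) : ‖1 / den n k‖ ≤ 2 / (n + jap k) := by
  simpa using norm_inv_den_pow_le n 1 k

/-- The `j`-th Taylor coefficient of `ρ₀` at `k`, up to sign. -/
def rhoCoeff (j : ℕ) (k : ℝ) : ℂ := ∑' n, sgnI n ^ j * (1 / den n k) ^ (j + 1)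

/-- The Taylor remainder of order `N` of `ρ₀`, divided by `(k - l) ^ N`. -/
def rhoRem (N : ℕ) (k l : ℝ) : ℂ := ∑' n, sgnI n ^ N * (1 / den n k) ^ N * (1 / den n l)

lemma norm_rhoCoeff_term_le (j n : ℕ) (k : ℝ) :
    ‖sgnI n ^ j * (1 / den n k) ^ (j + 1)‖ ≤ 2 ^ (j + 1) * (1 / (n + jap k) ^ (j + 1)) := by
  rw [norm_mul, norm_pow, norm_sgnI, one_pow, one_mul]
  refine (norm_inv_den_pow_le n (j + 1) k).trans (le_of_eq ?_)
  ring

/-- The single denominator taken at `l` is moved to `k` at the cost of one factor `jap (k - l)`, so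
the remainder decays in `k` one order faster per term before summation. -/
lemma norm_rhoRem_term_le (N n : ℕ) (k l : ℝ) :
    ‖sgnI n ^ N * (1 / den n k) ^ N * (1 / den n l)‖ ≤
      2 ^ (N + 1) * jap (k - l) * (1 / (n + jap k) ^ (N + 1)) := by
  have hk : 0 < n + jap k := by have := jap_pos k; positivity
  have hl : 0 < n + jap l := by have := jap_pos l; positivity
  rw [norm_mul, norm_mul, norm_pow, norm_sgnI, one_pow, one_mul]
  have h1 : (n + jap k) ≤ jap (k - l) * (n + jap l) := by
    have := jap_le_mul k l
    have h2 := one_le_jap (k - l)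
    have h3 : (0 : ℝ) ≤ n := Nat.cast_nonneg n
    nlinarith
  calc ‖(1 / den n k) ^ N‖ * ‖1 / den n l‖
      ≤ 2 ^ N / (n + jap k) ^ N * (2 / (n + jap l)) := by
        gcongr
        · exact norm_inv_den_pow_le n N k
        · exact norm_inv_den_le n l
    _ ≤ 2 ^ N / (n + jap k) ^ N * (2 * jap (k - l) / (n + jap k)) := by
        gcongr ?_ * ?_
        rw [div_le_div_iff₀ hl hk]
        linarith
    _ = _ := by
        rw [pow_succ, pow_succ, ← mul_div_mul_comm]
        ring

lemma summable_rhoCoeff {j : ℕ} (hj : 1 ≤ j) (k : ℝ) :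
    Summable fun n => sgnI n ^ j * (1 / den n k) ^ (j + 1) :=
  Summable.of_norm_bounded ((summable_tail (one_le_jap k) hj).1.mul_left _)
    fun n => norm_rhoCoeff_term_le j n k

lemma summable_rhoRem {N : ℕ} (hN : 1 ≤ N) (k l : ℝ) :
    Summable fun n => sgnI n ^ N * (1 / den n k) ^ N * (1 / den n l) :=
  Summable.of_norm_bounded ((summable_tail (one_le_jap k) hN).1.mul_left _)
    fun n => norm_rhoRem_term_le N n k l

/-- The symbol estimate: although `ρ₀` grows logarithmically, its `j`-th derivative decays like
`|k|^{-j}`, since `∑ (n + |k|)^{-(j+1)}` is of that size. -/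
lemma norm_rhoCoeff_le {j : ℕ} (hj : 1 ≤ j) (k : ℝ) :
    ‖rhoCoeff j k‖ ≤ 2 ^ (j + 2) / jap k ^ j := by
  have h := summable_tail (one_le_jap k) hj
  refine (tsum_of_norm_bounded (h.1.mul_left (2 ^ (j + 1))).hasSum
    fun n => norm_rhoCoeff_term_le j n k).trans ?_
  rw [tsum_mul_left]
  calc (2 : ℝ) ^ (j + 1) * _ ≤ 2 ^ (j + 1) * (2 / jap k ^ j) := by gcongr; exact h.2
    _ = _ := by ring

lemma norm_rhoRem_le {N : ℕ} (hN : 1 ≤ N) (k l : ℝ) :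
    ‖rhoRem N k l‖ ≤ 2 ^ (N + 2) * jap (k - l) / jap k ^ N := by
  have h := summable_tail (one_le_jap k) hN
  have := jap_pos (k - l)
  refine (tsum_of_norm_bounded (h.1.mul_left (2 ^ (N + 1) * jap (k - l))).hasSum
    fun n => norm_rhoRem_term_le N n k l).trans ?_
  rw [tsum_mul_left]
  calc (2 : ℝ) ^ (N + 1) * jap (k - l) * _ ≤ 2 ^ (N + 1) * jap (k - l) * (2 / jap k ^ N) := by
        gcongr; exact h.2
    _ = _ := by ring

/-- `den n` is affine in `k`, so this is a finite geometric expansion with exact remainder. The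
induction inserts the first order identity for `1 / den n l` into the remainder. -/
lemma inv_den_sub (n : ℕ) (k l : ℝ) {N : ℕ} (hN : 1 ≤ N) :
    1 / den n l - 1 / den n k =
      (∑ j ∈ Finset.Ico 1 N, ((k - l : ℝ) : ℂ) ^ j * (sgnI n ^ j * (1 / den n k) ^ (j + 1))) +
        ((k - l : ℝ) : ℂ) ^ N * (sgnI n ^ N * (1 / den n k) ^ N * (1 / den n l)) := by
  have hk := den_ne_zero n k
  have hl := den_ne_zero n l
  have hh : den n k = den n l + sgnI n * ((k - l : ℝ) : ℂ) := by
    unfold den; push_cast; ring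
  induction N, hN using Nat.le_induction with
  | base =>
    rw [Finset.Ico_self, Finset.sum_empty, zero_add]
    have h2 : sgnI n * ((k - l : ℝ) : ℂ) = den n k - den n l := by rw [hh]; ring
    rw [show ∀ a b c d : ℂ, a ^ 1 * (b ^ 1 * c ^ 1 * d) = b * a * (c * d) by intros; ring, h2]
    field_simp
  | succ N hN ih =>
    rw [ih, Finset.sum_Ico_succ_top hN, add_assoc]
    congr 1
    have h2 : 1 / den n l = 1 / den n k + sgnI n * ((k - l : ℝ) : ℂ) * (1 / den n k) * (1 / den n l) := by
      field_simp
      rw [hh]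
    conv_lhs => rw [h2]
    ring

/-- Taylor expansion of `ρ₀`. -/
theorem rho0_sub (k l : ℝ) {N : ℕ} (hN : 1 ≤ N) :
    rho0 k - rho0 l = (∑ j ∈ Finset.Ico 1 N, ((k - l : ℝ) : ℂ) ^ j * rhoCoeff j k) +
      ((k - l : ℝ) : ℂ) ^ N * rhoRem N k l := by
  have h1 := ((hasSum_rho0 k).sub (hasSum_rho0 l)).congr_terms
    (g := fun n => 1 / den n l - 1 / den n k) (fun n => by ring)
  have h2 : HasSum (fun n => 1 / den n l - 1 / den n k)
      ((∑ j ∈ Finset.Ico 1 N, ((k - l : ℝ) : ℂ) ^ j * rhoCoeff j k) +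
      ((k - l : ℝ) : ℂ) ^ N * rhoRem N k l) := by
    refine HasSum.congr_terms ?_ fun n => inv_den_sub n k l hN
    refine HasSum.add (hasSum_sum fun j hj => ?_) ?_
    · exact (summable_rhoCoeff (Finset.mem_Ico.1 hj).1 k).hasSum.mul_left _
    · exact (summable_rhoRem hN k l).hasSum.mul_left _
  exact h1.unique h2

lemma lipschitzWith_rho0 : LipschitzWith 8 rho0 := by
  refine LipschitzWith.of_dist_le_mul fun k l => ?_
  have h1 := ((hasSum_rho0 k).sub (hasSum_rho0 l)).congr_terms
    (g := fun n => 1 / den n l - 1 / den n k) (fun n => by ring)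
  have h2 := summable_tail (le_refl (1 : ℝ)) (le_refl 1)
  have hb : ∀ n : ℕ, ‖1 / den n l - 1 / den n k‖ ≤ 4 * |k - l| * (1 / ((n : ℝ) + 1) ^ (1 + 1)) := by
    intro n
    have hk := den_ne_zero n k
    have hl := den_ne_zero n l
    have e : 1 / den n l - 1 / den n k =
        sgnI n * ((k - l : ℝ) : ℂ) * ((1 / den n l) * (1 / den n k)) := by
      rw [show sgnI n * ((k - l : ℝ) : ℂ) = den n k - den n l by unfold den; push_cast; ring]
      field_simp
    have hn : (0 : ℝ) ≤ n := Nat.cast_nonneg n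
    have b : ∀ m : ℝ, ‖1 / den n m‖ ≤ 2 / (n + 1) := fun m =>
      (norm_inv_den_le n m).trans (by gcongr; exact one_le_jap m)
    rw [e, norm_mul, norm_mul, norm_mul, norm_sgnI, one_mul, Complex.norm_real, Real.norm_eq_abs]
    calc |k - l| * (‖1 / den n l‖ * ‖1 / den n k‖) ≤ |k - l| * (2 / (n + 1) * (2 / (n + 1))) := by
          gcongr
          · exact b l
          · exact b k
      _ = _ := by field_simp; ring
  rw [dist_eq_norm, Real.dist_eq, ← h1.tsum_eq]
  refine (tsum_of_norm_bounded (h2.1.mul_left (4 * |k - l|)).hasSum hb).trans ?_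
  rw [tsum_mul_left]
  have h3 := h2.2
  norm_num at h3 ⊢
  nlinarith [abs_nonneg (k - l)]

lemma continuous_rho0 : Continuous rho0 := lipschitzWith_rho0.continuous

lemma harmonic_eq_sum (M : ℕ) : ((harmonic M : ℚ) : ℝ) = ∑ n ∈ Finset.range M, 1 / ((n : ℝ) + 1) := by
  unfold harmonic
  push_cast
  simp

/-- The terms are dominated by twice `1/(n+1) - 1/(n+1+|k|)`. After rounding `|k|` up to an integer
`M`, the partial sums telescope by a shift of length `M` and leave at most the harmonic number of
`M`. -/
lemma norm_rho0_le (k : ℝ) : ‖rho0 k‖ ≤ 2 * ell k := by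
  have hb : ∀ n : ℕ, ‖1 / (n + 1 : ℂ) - 1 / den n k‖ ≤
      2 * (1 / ((n : ℝ) + 1) - 1 / (n + 1 + |k|)) := by
    intro n
    have hn : (0 : ℝ) < n + 1 := by positivity
    have hk0 := abs_nonneg k
    have hd := den_ne_zero n k
    have hne : (n + 1 : ℂ) ≠ 0 := by exact_mod_cast hn.ne'
    have e : 1 / (n + 1 : ℂ) - 1 / den n k = sgnI n * k * ((1 / (n + 1 : ℂ)) * (1 / den n k)) := by
      rw [show sgnI n * (k : ℂ) = den n k - (n + 1) by unfold den; ring]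
      field_simp
    have e2 : ‖(1 / (n + 1 : ℂ))‖ = 1 / (n + 1) := by
      rw [norm_div, norm_one]
      congr 1
      rw [show (n + 1 : ℂ) = ((n + 1 : ℝ) : ℂ) by push_cast; rfl, Complex.norm_real,
        Real.norm_of_nonneg hn.le]
    rw [e, norm_mul, norm_mul, norm_mul, norm_sgnI, one_mul, Complex.norm_real, Real.norm_eq_abs, e2]
    calc |k| * (1 / (n + 1) * ‖1 / den n k‖) ≤ |k| * (1 / (n + 1) * (2 / (n + jap k))) := by
          gcongr
          exact norm_inv_den_le n k
      _ = _ := by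
          unfold jap
          have : (n : ℝ) + (1 + |k|) ≠ 0 := by positivity
          have : (n : ℝ) + 1 + |k| ≠ 0 := by positivity
          field_simp
          ring
  have hpart : ∀ s : Finset ℕ, ‖∑ n ∈ s, (1 / (n + 1 : ℂ) - 1 / den n k)‖ ≤ 2 * ell k := by
    intro s
    obtain ⟨L, hL⟩ := s.exists_nat_subset_range
    -- Rounding up only increases each bracket, and `M < |k| + 1 = jap k` keeps the logarithm of `M`
    -- below that of `jap k`.
    set M := ⌈|k|⌉₊
    have hM : |k| ≤ M := Nat.le_ceil _
    have hM2 : (M : ℝ) < |k| + 1 := Nat.ceil_lt_add_one (abs_nonneg k)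
    have hnn : ∀ n : ℕ, 0 ≤ 1 / ((n : ℝ) + 1) - 1 / (n + 1 + |k|) := by
      intro n
      rw [sub_nonneg]
      have := abs_nonneg k
      exact one_div_le_one_div_of_le (by positivity) (by linarith)
    calc ‖∑ n ∈ s, (1 / (n + 1 : ℂ) - 1 / den n k)‖
        ≤ ∑ n ∈ s, 2 * (1 / ((n : ℝ) + 1) - 1 / (n + 1 + |k|)) :=
          norm_sum_le_of_le _ fun n _ => hb n
      _ ≤ ∑ n ∈ Finset.range L, 2 * (1 / ((n : ℝ) + 1) - 1 / (n + 1 + |k|)) :=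
          Finset.sum_le_sum_of_subset_of_nonneg hL fun n _ _ => mul_nonneg two_pos.le (hnn n)
      _ ≤ ∑ n ∈ Finset.range L, 2 * (1 / ((n : ℝ) + 1) - 1 / ((M + n : ℕ) + 1)) := by
          refine Finset.sum_le_sum fun n _ => ?_
          gcongr 2 * (_ - 1 / ?_)
          push_cast
          linarith
      _ = 2 * (∑ n ∈ Finset.range L, 1 / ((n : ℝ) + 1) -
            ∑ n ∈ Finset.range L, 1 / (((M + n : ℕ) : ℝ) + 1)) := by
          rw [← Finset.mul_sum, Finset.sum_sub_distrib]
      _ ≤ 2 * ∑ n ∈ Finset.range M, 1 / ((n : ℝ) + 1) := by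
          have h1 := Finset.sum_range_add (fun n : ℕ => 1 / ((n : ℝ) + 1)) M L
          have h2 : ∑ n ∈ Finset.range L, 1 / ((n : ℝ) + 1) ≤
              ∑ n ∈ Finset.range (M + L), 1 / ((n : ℝ) + 1) :=
            Finset.sum_le_sum_of_subset_of_nonneg (Finset.range_mono (by omega))
              fun n _ _ => by positivity
          linarith
      _ ≤ 2 * ell k := by
          rw [← harmonic_eq_sum]
          gcongr
          refine (harmonic_le_one_add_log M).trans ?_
          unfold ell
          rcases Nat.eq_zero_or_pos M with h0 | h0
          · rw [h0]; simp [log_jap_nonneg]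
          · have h1 : Real.log M ≤ Real.log (jap k) := by
              apply Real.log_le_log (by exact_mod_cast h0)
              unfold jap
              linarith
            linarith
  exact le_of_tendsto (hasSum_rho0 k).norm (Eventually.of_forall hpart)

/-- Coercivity. All real parts are nonnegative, and for `n + 1 ≤ |k|` the `n`-th one is at least
half of `1/(n+1)`. Summing over these indices gives half a harmonic number, about `½ log |k|`. -/
lemma ell_div_two_sub_one_le_re_rho0 (k : ℝ) : ell k / 2 - 1 ≤ (rho0 k).re := by
  have hs := Complex.hasSum_re (hasSum_rho0 k)
  have hterm : ∀ n : ℕ, (1 / (n + 1 : ℂ) - 1 / den n k).re =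
      k ^ 2 / ((n + 1) * ((n + 1) ^ 2 + k ^ 2)) := by
    intro n
    have hn : (0 : ℝ) < n + 1 := by positivity
    have e1 : (1 / (n + 1 : ℂ)).re = 1 / (n + 1) := by
      rw [show (1 / (n + 1 : ℂ)) = ((1 / (n + 1) : ℝ) : ℂ) by push_cast; rfl, Complex.ofReal_re]
    have e2 : (1 / den n k).re = (n + 1) / ((n + 1) ^ 2 + k ^ 2) := by
      rw [one_div, Complex.inv_re, den_re, Complex.normSq_apply, den_re, ← sq, ← sq, ← sq_abs (den n k).im,
        den_im_abs, sq_abs]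
    rw [Complex.sub_re, e1, e2]
    have : (n + 1 : ℝ) ^ 2 + k ^ 2 ≠ 0 := by positivity
    field_simp
    ring
  have hnn : ∀ n : ℕ, 0 ≤ (1 / (n + 1 : ℂ) - 1 / den n k).re := fun n => by
    rw [hterm]; positivity
  set M := ⌊|k|⌋₊
  have hM : (M : ℝ) ≤ |k| := Nat.floor_le (abs_nonneg k)
  have hM2 : |k| < M + 1 := Nat.lt_floor_add_one _
  have h1 : ∑ n ∈ Finset.range M, 1 / 2 * (1 / ((n : ℝ) + 1)) ≤ (rho0 k).re := by
    refine le_trans (Finset.sum_le_sum fun n hn => ?_) (sum_le_hasSum (Finset.range M)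
      (fun n _ => hnn n) hs)
    rw [hterm]
    have hn1 : (n + 1 : ℝ) ≤ |k| := by
      refine le_trans ?_ hM
      exact_mod_cast Finset.mem_range.1 hn
    have hn0 : (0 : ℝ) < n + 1 := by positivity
    have hk2 : (n + 1 : ℝ) ^ 2 ≤ k ^ 2 := by
      rw [← sq_abs k]; gcongr
    rw [← mul_div_mul_comm, one_mul, div_le_div_iff₀ (by positivity) (by positivity)]
    nlinarith
  rw [← Finset.mul_sum, ← harmonic_eq_sum] at h1
  have h2 := log_add_one_le_harmonic M
  have h3 : Real.log (jap k) ≤ Real.log 2 + Real.log ((M + 1 : ℕ) : ℝ) := by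
    rw [← Real.log_mul (by norm_num) (by positivity)]
    refine Real.log_le_log (jap_pos k) ?_
    unfold jap
    push_cast
    linarith [(Nat.cast_nonneg M : (0 : ℝ) ≤ M)]
  have h4 : Real.log 2 ≤ 1 := by linarith [Real.log_two_lt_d9]
  unfold ell
  linarith

/-! ### The Fourier transform -/

/-- The normalizing constant `(2π)^{-1/2}`. -/
def cpi : ℝ := (Real.sqrt (2 * Real.pi))⁻¹

lemma cpi_pos : 0 < cpi := inv_pos.2 (Real.sqrt_pos.2 (by positivity))

lemma cpi_sq : cpi ^ 2 = (2 * Real.pi)⁻¹ := by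
  rw [cpi, inv_pow, Real.sq_sqrt (by positivity)]

lemma hat_eq (h : ℝ → ℂ) (k : ℝ) :
    hat h k = cpi * ∫ ξ : ℝ, h ξ * Complex.exp (Complex.I * (-1 : ℝ) * k * ξ) := by
  unfold hat cpi
  congr 2 with ξ
  rw [mul_comm]
  congr 2
  push_cast
  ring

lemma hat_eq_fourier (h : ℝ → ℂ) (k : ℝ) :
    hat h k = cpi * FourierTransform.fourier h ((2 * Real.pi)⁻¹ * k) := by
  rw [Real.fourier_real_eq_integral_exp_smul]
  unfold hat cpi
  congr 2 with ξ
  rw [smul_eq_mul]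
  congr 2
  have : (Real.pi : ℂ) ≠ 0 := by exact_mod_cast Real.pi_ne_zero
  push_cast
  field_simp

lemma norm_exp_I_mul (s x y : ℝ) : ‖Complex.exp (Complex.I * s * x * y)‖ = 1 := by
  rw [show Complex.I * s * x * y = ((s * x * y : ℝ) : ℂ) * Complex.I by push_cast; ring,
    Complex.norm_exp_ofReal_mul_I]

lemma norm_hat_le (h : ℝ → ℂ) (k : ℝ) : ‖hat h k‖ ≤ cpi * ∫ ξ, ‖h ξ‖ := by
  rw [hat_eq, norm_mul, Complex.norm_real, Real.norm_of_nonneg cpi_pos.le]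
  refine mul_le_mul_of_nonneg_left ((norm_integral_le_integral_norm _).trans (le_of_eq ?_))
    cpi_pos.le
  simp_rw [norm_mul, norm_exp_I_mul, mul_one]

lemma integrable_mul_exp {h : ℝ → ℂ} (hh : Integrable h) (s x : ℝ) :
    Integrable (fun y : ℝ => h y * Complex.exp (Complex.I * s * x * y)) :=
  hh.mul_bdd (c := 1) (Continuous.aestronglyMeasurable (by fun_prop))
    (Eventually.of_forall fun y => (norm_exp_I_mul s x y).le)

lemma continuous_integral_mul_exp {h : ℝ → ℂ} (hh : Integrable h) (s : ℝ) :
    Continuous fun x : ℝ => ∫ y : ℝ, h y * Complex.exp (Complex.I * s * x * y) := by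
  refine continuous_of_dominated (fun x => (integrable_mul_exp hh s x).1) (bound := fun y => ‖h y‖)
    (fun x => Eventually.of_forall fun y => ?_) hh.norm (Eventually.of_forall fun y => by fun_prop)
  rw [norm_mul, norm_exp_I_mul, mul_one]

lemma continuous_hat {h : ℝ → ℂ} (hh : Integrable h) : Continuous (hat h) := by
  simp_rw [funext (hat_eq h)]
  exact continuous_const.mul (continuous_integral_mul_exp hh (-1))

/-- Fubini's theorem for an exponential kernel. -/
lemma integral_exp_swap {f g : ℝ → ℂ} (hf : Integrable f) (hg : Integrable g) (s : ℝ) :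
    ∫ x : ℝ, f x * ∫ y : ℝ, g y * Complex.exp (Complex.I * s * x * y) =
      ∫ y : ℝ, g y * ∫ x : ℝ, f x * Complex.exp (Complex.I * s * x * y) := by
  have hi : Integrable (fun p : ℝ × ℝ => f p.1 * g p.2 * Complex.exp (Complex.I * s * p.1 * p.2))
      (volume.prod volume) :=
    (hf.mul_prod hg).mul_bdd (c := 1) (Continuous.aestronglyMeasurable (by fun_prop))
      (Eventually.of_forall fun p => (norm_exp_I_mul s p.1 p.2).le)
  have := integral_integral_swap
    (f := fun x y : ℝ => f x * g y * Complex.exp (Complex.I * s * x * y)) hi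
  simp_rw [← integral_const_mul]
  refine Eq.trans ?_ (this.trans ?_)
  · congr 1; ext x; congr 1; ext y; ring
  · congr 1; ext y; congr 1; ext x; ring

/-- Smooth functions with compact support. -/
structure IsTest (φ : ℝ → ℂ) : Prop where
  smooth : ContDiff ℝ ∞ φ
  compact : HasCompactSupport φ

namespace IsTest

variable {φ ψ : ℝ → ℂ}

lemma continuous (h : IsTest φ) : Continuous φ := h.smooth.continuous

lemma integrable (h : IsTest φ) : Integrable φ := h.continuous.integrable_of_hasCompactSupport h.compact

lemma deriv (h : IsTest φ) : IsTest (deriv φ) :=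
  ⟨(contDiff_infty_iff_deriv.1 h.smooth).2, h.compact.deriv⟩

lemma mul_smooth (h : IsTest φ) (h' : ContDiff ℝ ∞ ψ) : IsTest (fun x => φ x * ψ x) :=
  ⟨h.smooth.mul h', h.compact.mul_right⟩

lemma mul (h : IsTest φ) (h' : IsTest ψ) : IsTest (fun x => φ x * ψ x) := h.mul_smooth h'.smooth

lemma add (h : IsTest φ) (h' : IsTest ψ) : IsTest (fun x => φ x + ψ x) :=
  ⟨h.smooth.add h'.smooth, h.compact.add h'.compact⟩

lemma differentiable (h : IsTest φ) : Differentiable ℝ φ := h.smooth.differentiable (by simp)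

end IsTest

/-- The convolution kernel of the multiplication by `φ` in Fourier space. -/
def sharp (φ : ℝ → ℂ) (k : ℝ) : ℂ := cpi * hat φ k

lemma hat_deriv {φ : ℝ → ℂ} (hφ : IsTest φ) (k : ℝ) :
    hat (deriv φ) k = Complex.I * k * hat φ k := by
  rw [hat_eq_fourier, hat_eq_fourier,
    Real.fourier_deriv hφ.integrable hφ.differentiable hφ.deriv.integrable]
  have : (Real.pi : ℂ) ≠ 0 := by exact_mod_cast Real.pi_ne_zero
  simp only [smul_eq_mul]
  push_cast
  field_simp

lemma sharp_deriv {φ : ℝ → ℂ} (hφ : IsTest φ) (k : ℝ) :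
    sharp (deriv φ) k = Complex.I * k * sharp φ k := by
  rw [sharp, sharp, hat_deriv hφ]; ring

lemma continuous_sharp {φ : ℝ → ℂ} (hφ : IsTest φ) : Continuous (sharp φ) :=
  continuous_const.mul (continuous_hat hφ.integrable)

/-- Each power of `k` is one integration by parts, so the induction passes from `φ` to its
derivative. -/
lemma norm_pow_mul_sharp_le (p : ℕ) {φ : ℝ → ℂ} (hφ : IsTest φ) :
    ∃ C, ∀ k, |k| ^ p * ‖sharp φ k‖ ≤ C := by
  induction p generalizing φ with
  | zero =>
    refine ⟨cpi * (cpi * ∫ ξ, ‖φ ξ‖), fun k => ?_⟩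
    rw [pow_zero, one_mul, sharp, norm_mul, Complex.norm_real, Real.norm_of_nonneg cpi_pos.le]
    exact mul_le_mul_of_nonneg_left (norm_hat_le φ k) cpi_pos.le
  | succ p ih =>
    obtain ⟨C, hC⟩ := ih hφ.deriv
    refine ⟨C, fun k => ?_⟩
    have := hC k
    rw [sharp_deriv hφ, norm_mul, norm_mul, Complex.norm_I, one_mul, Complex.norm_real,
      Real.norm_eq_abs] at this
    rwa [pow_succ, mul_assoc]

lemma jap_pow_mul_sharp_le (p : ℕ) {φ : ℝ → ℂ} (hφ : IsTest φ) :
    ∃ C, 0 ≤ C ∧ ∀ k, jap k ^ p * ‖sharp φ k‖ ≤ C := by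
  obtain ⟨C, hC⟩ := norm_pow_mul_sharp_le p hφ
  obtain ⟨D, hD⟩ := norm_pow_mul_sharp_le 0 hφ
  have hb : ∀ k, jap k ^ p * ‖sharp φ k‖ ≤ 2 ^ (p - 1) * (D + C) := by
    intro k
    have h1 := add_pow_le (zero_le_one) (abs_nonneg k) p
    have h2 := hC k
    have h3 := hD k
    rw [one_pow] at h1
    rw [pow_zero] at h3
    calc jap k ^ p * ‖sharp φ k‖ ≤ 2 ^ (p - 1) * (1 + |k| ^ p) * ‖sharp φ k‖ :=
          mul_le_mul_of_nonneg_right h1 (norm_nonneg _)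
      _ = 2 ^ (p - 1) * (1 * ‖sharp φ k‖ + |k| ^ p * ‖sharp φ k‖) := by ring
      _ ≤ _ := by gcongr
  exact ⟨_, le_trans (mul_nonneg (pow_nonneg (jap_pos 0).le p) (norm_nonneg _)) (hb 0), hb⟩

lemma integrable_inv_jap_sq : Integrable fun k : ℝ => 1 / jap k ^ 2 := by
  refine (integrable_inv_one_add_sq).mono' (Continuous.aestronglyMeasurable ?_)
    (Eventually.of_forall fun k => ?_)
  · exact continuous_const.div (continuous_jap.pow 2) fun k => (pow_pos (jap_pos k) 2).ne'
  · rw [Real.norm_of_nonneg (by have := jap_pos k; positivity), ← one_div]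
    refine one_div_le_one_div_of_le (by positivity) ?_
    unfold jap
    nlinarith [abs_nonneg k, sq_abs k]

lemma integrable_jap_pow_mul_sharp (p : ℕ) {φ : ℝ → ℂ} (hφ : IsTest φ) :
    Integrable fun k => jap k ^ p * ‖sharp φ k‖ := by
  obtain ⟨C, -, hC⟩ := jap_pow_mul_sharp_le (p + 2) hφ
  refine (integrable_inv_jap_sq.const_mul C).mono' (Continuous.aestronglyMeasurable ?_)
    (Eventually.of_forall fun k => ?_)
  · exact (continuous_jap.pow p).mul (continuous_sharp hφ).norm
  · have hJ := jap_pos k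
    rw [Real.norm_of_nonneg (by positivity), mul_one_div, le_div_iff₀ (by positivity)]
    refine le_trans (le_of_eq ?_) (hC k)
    ring

lemma integrable_sharp {φ : ℝ → ℂ} (hφ : IsTest φ) : Integrable (sharp φ) := by
  have := integrable_jap_pow_mul_sharp 0 hφ
  simp only [pow_zero, one_mul] at this
  exact (integrable_norm_iff (continuous_sharp hφ).aestronglyMeasurable).1 this

/-- The inversion formula for test functions. -/
lemma integral_sharp_mul_exp {φ : ℝ → ℂ} (hφ : IsTest φ) (ξ : ℝ) :
    ∫ k : ℝ, sharp φ k * Complex.exp (Complex.I * (1 : ℝ) * k * ξ) = φ ξ := by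
  have hpi : (Real.pi : ℂ) ≠ 0 := by exact_mod_cast Real.pi_ne_zero
  have h2pi : (2 * Real.pi) ≠ 0 := by positivity
  have hs : ∀ k, sharp φ k = (2 * Real.pi)⁻¹ * FourierTransform.fourier φ ((2 * Real.pi)⁻¹ * k) := by
    intro k
    rw [sharp, hat_eq_fourier, ← mul_assoc, ← sq, ← Complex.ofReal_pow, cpi_sq]
  have hF : Integrable (FourierTransform.fourier φ) := by
    have h1 := (integrable_sharp hφ).const_mul (2 * Real.pi : ℂ)
    have h2 : Integrable (fun k => FourierTransform.fourier φ ((2 * Real.pi)⁻¹ * k)) := by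
      refine h1.congr (Eventually.of_forall fun k => ?_)
      simp only [hs]
      rw [← mul_assoc]
      push_cast
      rw [mul_inv_cancel₀ (mul_ne_zero two_ne_zero hpi), one_mul]
    exact (integrable_comp_mul_left_iff _ (inv_ne_zero h2pi)).1 h2
  have h3 := congrFun (hφ.continuous.fourierInv_fourier_eq hφ.integrable hF) ξ
  rw [Real.fourierInv_eq'] at h3
  rw [← h3]
  have h4 := Measure.integral_comp_mul_left
    (fun v : ℝ => Complex.exp (((2 * Real.pi * inner ℝ v ξ : ℝ) : ℂ) * Complex.I) •
      FourierTransform.fourier φ v) (2 * Real.pi)⁻¹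
  rw [inv_inv, abs_of_pos (by positivity)] at h4
  have h5 : ∀ k : ℝ, sharp φ k * Complex.exp (Complex.I * (1 : ℝ) * k * ξ) =
      ((2 * Real.pi)⁻¹ : ℝ) • (Complex.exp (((2 * Real.pi * inner ℝ ((2 * Real.pi)⁻¹ * k) ξ : ℝ) : ℂ)
        * Complex.I) • FourierTransform.fourier φ ((2 * Real.pi)⁻¹ * k)) := by
    intro k
    rw [hs, Complex.real_smul, smul_eq_mul, mul_comm (Complex.exp _), ← mul_assoc]
    congr 2
    rw [show inner ℝ ((2 * Real.pi)⁻¹ * k) ξ = (2 * Real.pi)⁻¹ * k * ξ by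
      rw [RCLike.inner_apply, conj_trivial, mul_comm]]
    push_cast
    field_simp
  simp_rw [h5]
  rw [integral_smul, h4, smul_smul, inv_mul_cancel₀ h2pi, one_smul]

/-- Multiplication by a test function becomes a convolution. -/
theorem hat_mul {φ h : ℝ → ℂ} (hφ : IsTest φ) (hh : Integrable h) (k : ℝ) :
    hat (fun ξ => φ ξ * h ξ) k = ∫ l, sharp φ (k - l) * hat h l := by
  have hs : Integrable (fun l => sharp φ (k - l)) := (integrable_sharp hφ).comp_sub_left k
  simp_rw [hat_eq h]
  have e1 : ∀ l : ℝ, sharp φ (k - l) * (cpi * ∫ ξ : ℝ, h ξ * Complex.exp (Complex.I * (-1 : ℝ) * l * ξ))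
      = cpi * (sharp φ (k - l) * ∫ ξ : ℝ, h ξ * Complex.exp (Complex.I * (-1 : ℝ) * l * ξ)) := by
    intro l; ring
  simp_rw [e1]
  rw [integral_const_mul, integral_exp_swap hs hh (-1), hat_eq]
  congr 2 with ξ
  -- After Fubini and the substitution `m = k - l`, the inner integral is the inversion formula for
  -- `φ`, modulated by `e^{-ikξ}`.
  have e2 : ∫ l : ℝ, sharp φ (k - l) * Complex.exp (Complex.I * (-1 : ℝ) * l * ξ) =
      φ ξ * Complex.exp (Complex.I * (-1 : ℝ) * k * ξ) := by
    rw [← integral_sub_left_eq_self _ _ k]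
    simp_rw [sub_sub_cancel]
    rw [← integral_sharp_mul_exp hφ ξ, ← integral_mul_const]
    congr 1 with m
    rw [mul_assoc (sharp φ m), ← Complex.exp_add]
    congr 2
    push_cast
    ring
  rw [e2]
  ring

/-- The synthesis of a function from its Fourier coefficients. -/
def syn (f : ℝ → ℂ) (ξ : ℝ) : ℂ := ∫ l : ℝ, f l * Complex.exp (Complex.I * (1 : ℝ) * ξ * l)

lemma continuous_syn {f : ℝ → ℂ} (hf : Integrable f) : Continuous (syn f) :=
  continuous_integral_mul_exp hf 1

lemma norm_syn_le (f : ℝ → ℂ) (ξ : ℝ) : ‖syn f ξ‖ ≤ ∫ l, ‖f l‖ := by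
  refine (norm_integral_le_integral_norm _).trans (le_of_eq ?_)
  simp_rw [norm_mul, norm_exp_I_mul, mul_one]

lemma integrable_mul_syn {b f : ℝ → ℂ} (hb : Integrable b) (hf : Integrable f) :
    Integrable (fun ξ => b ξ * syn f ξ) :=
  hb.mul_bdd (c := ∫ l, ‖f l‖) (continuous_syn hf).aestronglyMeasurable
    (Eventually.of_forall fun ξ => norm_syn_le f ξ)

lemma integral_mul_syn_exp {b f : ℝ → ℂ} (hb : Integrable b) (hf : Integrable f) (k : ℝ) :
    (cpi : ℂ) ^ 2 * ∫ ξ : ℝ, b ξ * syn f ξ * Complex.exp (Complex.I * (-1 : ℝ) * ξ * k) =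
      ∫ l, sharp b (k - l) * f l := by
  have hb' : Integrable (fun ξ : ℝ => b ξ * Complex.exp (Complex.I * (-1 : ℝ) * k * ξ)) :=
    integrable_mul_exp hb (-1) k
  have e1 : ∫ ξ : ℝ, b ξ * syn f ξ * Complex.exp (Complex.I * (-1 : ℝ) * ξ * k) =
      ∫ ξ : ℝ, b ξ * Complex.exp (Complex.I * (-1 : ℝ) * k * ξ) *
        ∫ l : ℝ, f l * Complex.exp (Complex.I * (1 : ℝ) * ξ * l) := by
    congr 1 with ξ
    rw [syn, mul_right_comm]
    congr 3
    ring
  rw [e1, integral_exp_swap hb' hf 1, ← integral_const_mul]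
  congr 1 with l
  rw [sharp, hat_eq, ← mul_assoc (cpi : ℂ) (cpi : ℂ), ← sq, mul_comm (f l), ← mul_assoc]
  congr 2
  refine integral_congr_ae (Eventually.of_forall fun ξ => ?_)
  simp only
  rw [mul_assoc, ← Complex.exp_add]
  congr 2
  push_cast
  ring

/-- The quadratic form of the multiplication by `b`, in Fourier space. -/
theorem integral_mul_syn_conj_syn {b f g : ℝ → ℂ} (hb : Integrable b) (hf : Integrable f)
    (hg : Integrable g) :
    (cpi : ℂ) ^ 2 * ∫ ξ, b ξ * syn f ξ * (starRingEnd ℂ) (syn g ξ) =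
      ∫ k, (∫ l, sharp b (k - l) * f l) * (starRingEnd ℂ) (g k) := by
  have e1 : ∀ ξ, (starRingEnd ℂ) (syn g ξ) =
      ∫ k : ℝ, (starRingEnd ℂ) (g k) * Complex.exp (Complex.I * (-1 : ℝ) * ξ * k) := by
    intro ξ
    rw [syn, ← integral_conj]
    congr 1 with k
    rw [map_mul, ← Complex.exp_conj]
    congr 2
    simp
  have hg' : Integrable (fun k => (starRingEnd ℂ) (g k)) := by
    refine hg.norm.mono (Complex.continuous_conj.comp_aestronglyMeasurable hg.1) ?_
    exact Eventually.of_forall fun k => by simp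
  simp_rw [e1]
  rw [integral_exp_swap (integrable_mul_syn hb hf) hg' (-1), ← integral_const_mul]
  congr 1 with k
  rw [← integral_mul_syn_exp hb hf k]
  ring

lemma sharp_neg_of_real {φ : ℝ → ℂ} (hφ : ∀ ξ, (starRingEnd ℂ) (φ ξ) = φ ξ) (k : ℝ) :
    sharp φ (-k) = (starRingEnd ℂ) (sharp φ k) := by
  rw [sharp, sharp, hat_eq, hat_eq, map_mul, map_mul, Complex.conj_ofReal, ← integral_conj]
  congr 3 with ξ
  rw [map_mul, hφ, ← Complex.exp_conj]
  congr 2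
  simp

/-! ### Plancherel's inequality -/

lemma enorm_sq_eq_lintegral (f : ℝ → ℂ) : eLpNorm f 2 volume ^ 2 = ∫⁻ x, ‖f x‖ₑ ^ 2 := by
  have := eLpNorm_nnreal_pow_eq_lintegral (f := f) (μ := volume) (p := 2) (by norm_num)
  simpa using this

/-- The Fourier integral and the isometric extension of the transform to `L²` agree because they
coincide as distributions: against a test function, the first is handled by the symmetry of the
Fourier pairing and the second by its tempered distribution. -/
lemma fourier_ae_eq {h : ℝ → ℂ} (hh : Integrable h) (h2 : MemLp h 2) :
    FourierTransform.fourier h =ᵐ[volume] (FourierTransform.fourier (h2.toLp h) : Lp ℂ 2 volume) := by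
  have hc : Continuous (FourierTransform.fourier h) :=
    VectorFourier.fourierIntegral_continuous Real.continuous_fourierChar (by fun_prop) hh
  refine ae_eq_of_integral_contDiff_smul_eq hc.locallyIntegrable
    ((Lp.memLp _).locallyIntegrable (by norm_num)) fun g hg hgc => ?_
  have hgc' : HasCompactSupport (fun x => (g x : ℂ)) := hgc.comp_left (g := fun x : ℝ => (x : ℂ)) rfl
  have hg' : ContDiff ℝ ∞ (fun x => (g x : ℂ)) := Complex.ofRealCLM.contDiff.comp hg
  set G : SchwartzMap ℝ ℂ := hgc'.toSchwartzMap hg' with hG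
  have hGx : ∀ x, G x = (g x : ℂ) := fun x => rfl
  have e1 := Lp.toTemperedDistribution_apply
    (FourierTransform.fourier (h2.toLp h) : Lp ℂ 2 volume) G
  rw [← Lp.fourier_toTemperedDistribution_eq, TemperedDistribution.fourier_apply,
    Lp.toTemperedDistribution_apply] at e1
  have e2 : ∫ x, (FourierTransform.fourier G) x • (h2.toLp h) x =
      ∫ x, (FourierTransform.fourier G) x • h x := by
    refine integral_congr_ae ?_
    filter_upwards [h2.coeFn_toLp] with x hx
    rw [hx]
  have e3 : ∫ x, (FourierTransform.fourier G) x • h x = ∫ x, G x • FourierTransform.fourier h x :=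
    (VectorFourier.integral_fourierIntegral_smul_eq_flip (L := innerₗ ℝ)
      Real.continuous_fourierChar (by fun_prop) G.integrable hh).trans (by
        rw [flip_innerₗ]; rfl)
  rw [e2, e3] at e1
  simpa only [hGx, Complex.real_smul, smul_eq_mul] using e1

/-- Plancherel's inequality. -/
theorem eLpNorm_hat_le {h : ℝ → ℂ} (hh : Integrable h) (h2 : MemLp h 2) :
    eLpNorm (hat h) 2 volume ≤ eLpNorm h 2 volume := by
  have hpi : (0 : ℝ) < 2 * Real.pi := by positivity
  have e1 : eLpNorm (FourierTransform.fourier h) 2 volume = eLpNorm h 2 volume := by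
    rw [eLpNorm_congr_ae (fourier_ae_eq hh h2)]
    have := Lp.norm_fourier_eq (h2.toLp h)
    rw [Lp.norm_def, Lp.norm_def, ENNReal.toReal_eq_toReal_iff' (Lp.eLpNorm_ne_top _)
      (Lp.eLpNorm_ne_top _)] at this
    rw [this, eLpNorm_congr_ae h2.coeFn_toLp]
  have hc : Continuous (FourierTransform.fourier h) :=
    VectorFourier.fourierIntegral_continuous Real.continuous_fourierChar (by fun_prop) hh
  have e2 : ∫⁻ k, ‖hat h k‖ₑ ^ 2 = ∫⁻ k, ‖FourierTransform.fourier h k‖ₑ ^ 2 := by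
    have hm := Real.map_volume_mul_left (inv_ne_zero hpi.ne')
    rw [inv_inv, abs_of_pos hpi] at hm
    have e3 : ∀ k, ‖hat h k‖ₑ ^ 2 =
        ENNReal.ofReal ((2 * Real.pi)⁻¹) * ‖FourierTransform.fourier h ((2 * Real.pi)⁻¹ * k)‖ₑ ^ 2 := by
      intro k
      rw [hat_eq_fourier, enorm_mul, mul_pow, ← cpi_sq, ENNReal.ofReal_pow cpi_pos.le]
      congr 2
      rw [← ofReal_norm, Complex.norm_real, Real.norm_of_nonneg cpi_pos.le]
    simp_rw [e3]
    rw [lintegral_const_mul' _ _ ENNReal.ofReal_ne_top,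
      ← lintegral_map (f := fun k => ‖FourierTransform.fourier h k‖ₑ ^ 2)
        (hc.enorm.measurable.pow_const 2) (measurable_const_mul _), hm, lintegral_smul_measure,
      smul_eq_mul, ← mul_assoc, ← ENNReal.ofReal_mul (inv_nonneg.2 hpi.le), inv_mul_cancel₀ hpi.ne',
      ENNReal.ofReal_one, one_mul]
  rw [← ENNReal.pow_le_pow_left_iff (n := 2) two_ne_zero, enorm_sq_eq_lintegral, e2,
    ← enorm_sq_eq_lintegral, e1]

/-! ### Convolution estimates in weighted `L²` spaces -/

/-- The `L²` norm. -/
abbrev l2 (f : ℝ → ℂ) : ℝ≥0∞ := eLpNorm f 2 volume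

/-- Cauchy–Schwarz after writing `κ g = κ^{1/2} · (κ^{1/2} g)`. -/
lemma lintegral_mul_sq_le {κ g : ℝ → ℝ≥0∞} (hκ : Measurable κ) (hg : Measurable g) :
    (∫⁻ l, κ l * g l) ^ 2 ≤ (∫⁻ l, κ l) * ∫⁻ l, κ l * g l ^ 2 := by
  have hs : ∀ x : ℝ≥0∞, (x ^ (1 / 2 : ℝ)) ^ 2 = x := fun x => by
    rw [← ENNReal.rpow_natCast, ← ENNReal.rpow_mul]; norm_num
  have h := ENNReal.lintegral_mul_le_Lp_mul_Lq volume (Real.HolderConjugate.two_two)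
    (f := fun l => κ l ^ (1 / 2 : ℝ)) (g := fun l => κ l ^ (1 / 2 : ℝ) * g l)
    (hκ.pow_const _).aemeasurable ((hκ.pow_const _).mul hg).aemeasurable
  simp only [Pi.mul_apply, ENNReal.rpow_two, mul_pow, hs, ← mul_assoc, ← sq] at h
  calc (∫⁻ l, κ l * g l) ^ 2 ≤ ((∫⁻ l, κ l) ^ (1 / 2 : ℝ) *
        (∫⁻ l, κ l * g l ^ 2) ^ (1 / 2 : ℝ)) ^ 2 := by gcongr
    _ = _ := by rw [mul_pow, hs, hs]

/-- Young's inequality for the convolution of `L¹` and `L²` functions. -/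
theorem lintegral_conv_sq_le {κ g : ℝ → ℝ≥0∞} (hκ : Measurable κ) (hg : Measurable g) :
    ∫⁻ k, (∫⁻ l, κ (k - l) * g l) ^ 2 ≤ (∫⁻ l, κ l) ^ 2 * ∫⁻ l, g l ^ 2 := by
  have h1 : ∀ k, (∫⁻ l, κ (k - l) * g l) ^ 2 ≤ (∫⁻ l, κ l) * ∫⁻ l, κ (k - l) * g l ^ 2 := by
    intro k
    refine (lintegral_mul_sq_le (κ := fun l => κ (k - l))
      (hκ.comp (measurable_const.sub measurable_id)) hg).trans ?_
    rw [lintegral_sub_left_eq_self (fun l => κ l) k]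
  refine (lintegral_mono h1).trans ?_
  have hm : Measurable (fun p : ℝ × ℝ => κ (p.1 - p.2) * g p.2 ^ 2) :=
    (hκ.comp (measurable_fst.sub measurable_snd)).mul ((hg.comp measurable_snd).pow_const 2)
  rw [lintegral_const_mul _ (Measurable.lintegral_prod_right' hm),
    lintegral_lintegral_swap hm.aemeasurable, sq, mul_assoc]
  gcongr
  have h2 : ∀ l, ∫⁻ k, κ (k - l) * g l ^ 2 = (∫⁻ k, κ k) * g l ^ 2 := by
    intro l
    rw [lintegral_mul_const _ (show Measurable fun k => κ (k - l) from
      hκ.comp (measurable_id.sub measurable_const))]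
    congr 1
    exact lintegral_sub_right_eq_self (fun k => κ k) l
  simp_rw [h2]
  rw [lintegral_const_mul _ (hg.pow_const 2)]

/-- Weighted `L²` bound for a perturbed convolution operator. -/
theorem exists_l2_conv_le {φ : ℝ → ℂ} (hφ : IsTest φ) (p : ℕ) :
    ∃ K : ℝ≥0, ∀ (r : ℝ → ℝ → ℂ) (m : ℝ → ℝ) (h : ℝ → ℂ), Measurable m → Measurable h →
      (∀ k l, ‖r k l‖ ≤ jap (k - l) ^ p * m l) →
      l2 (fun k => ∫ l, sharp φ (k - l) * r k l * h l) ≤ K * l2 (fun l => m l * h l) := by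
  have hi := (integrable_jap_pow_mul_sharp p hφ)
  have hfin : ∫⁻ k, ‖jap k ^ p * ‖sharp φ k‖‖ₑ ≠ ⊤ := hi.2.ne
  refine ⟨(∫⁻ k, ‖jap k ^ p * ‖sharp φ k‖‖ₑ).toNNReal, fun r m h hm hh hr => ?_⟩
  rw [ENNReal.coe_toNNReal hfin, ← ENNReal.pow_le_pow_left_iff (n := 2) two_ne_zero, mul_pow,
    enorm_sq_eq_lintegral, enorm_sq_eq_lintegral]
  refine le_trans (lintegral_mono fun k => ?_) (lintegral_conv_sq_le
    (κ := fun k => ‖jap k ^ p * ‖sharp φ k‖‖ₑ) (g := fun l => ‖(m l : ℂ) * h l‖ₑ) ?_ ?_)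
  · refine pow_le_pow_left₀ (zero_le) ?_ 2
    refine (enorm_integral_le_lintegral_enorm _).trans (lintegral_mono fun l => ?_)
    rw [← enorm_norm (sharp φ (k - l) * r k l * h l), ← enorm_norm ((m l : ℂ) * h l), ← enorm_mul]
    rw [Real.enorm_eq_ofReal (norm_nonneg _), Real.enorm_eq_ofReal (by
      have := jap_pos (k - l); positivity)]
    refine ENNReal.ofReal_le_ofReal ?_
    rw [norm_mul, norm_mul, norm_mul, Complex.norm_real]
    have h1 := (hr k l).trans (mul_le_mul_of_nonneg_left (le_abs_self (m l))
      (pow_nonneg (jap_pos (k - l)).le p))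
    calc ‖sharp φ (k - l)‖ * ‖r k l‖ * ‖h l‖
        ≤ ‖sharp φ (k - l)‖ * (jap (k - l) ^ p * |m l|) * ‖h l‖ := by gcongr
      _ = _ := by rw [Real.norm_eq_abs]; ring
  · exact ((continuous_jap.pow p).mul (continuous_sharp hφ).norm).measurable.enorm
  · exact ((Complex.measurable_ofReal.comp hm).mul hh).enorm

/-- Convolution with the kernel of the multiplication by `φ`. -/
def conv (φ h : ℝ → ℂ) (k : ℝ) : ℂ := ∫ l, sharp φ (k - l) * h l

lemma measurable_conv {φ h : ℝ → ℂ} (hφ : IsTest φ) (hh : Measurable h) : Measurable (conv φ h) := by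
  have : StronglyMeasurable (fun p : ℝ × ℝ => sharp φ (p.1 - p.2) * h p.2) :=
    (((continuous_sharp hφ).measurable.comp (measurable_fst.sub measurable_snd)).mul
      (hh.comp measurable_snd)).stronglyMeasurable
  exact this.integral_prod_right'.measurable

/-- Measurable functions of polynomial growth. -/
structure PolyGrowth (h : ℝ → ℂ) : Prop where
  meas : Measurable h
  bound : ∃ (p : ℕ) (C : ℝ), ∀ l, ‖h l‖ ≤ C * jap l ^ p

lemma PolyGrowth.mul {h g : ℝ → ℂ} (hh : PolyGrowth h) (hg : PolyGrowth g) :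
    PolyGrowth (fun k => h k * g k) := by
  obtain ⟨p, C, hC⟩ := hh.bound
  obtain ⟨q, D, hD⟩ := hg.bound
  refine ⟨hh.meas.mul hg.meas, p + q, C * D, fun l => ?_⟩
  rw [norm_mul, pow_add]
  calc ‖h l‖ * ‖g l‖ ≤ (C * jap l ^ p) * (D * jap l ^ q) :=
        mul_le_mul (hC l) (hD l) (norm_nonneg _) ((norm_nonneg _).trans (hC l))
    _ = _ := by ring

lemma polyGrowth_hat {h : ℝ → ℂ} (hh : Integrable h) : PolyGrowth (hat h) :=
  ⟨(continuous_hat hh).measurable, 0, _, fun l => by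
    rw [pow_zero, mul_one]; exact norm_hat_le h l⟩

lemma polyGrowth_rho0 : PolyGrowth rho0 :=
  ⟨continuous_rho0.measurable, 1, 2, fun l => by
    rw [pow_one]; exact (norm_rho0_le l).trans (by linarith [ell_le_jap l])⟩

lemma polyGrowth_of_bound {m : ℝ → ℝ} (hm : Continuous m) {B : ℝ} (h0 : ∀ k, 0 ≤ m k)
    (hB : ∀ k, m k ≤ B) : PolyGrowth (fun k => (m k : ℂ)) :=
  ⟨(Complex.continuous_ofReal.comp hm).measurable, 0, B, fun l => by
    rw [pow_zero, mul_one, Complex.norm_real, Real.norm_of_nonneg (h0 l)]; exact hB l⟩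

lemma integrable_sharp_mul {φ h : ℝ → ℂ} (hφ : IsTest φ) (hh : PolyGrowth h) (k : ℝ) :
    Integrable (fun l => sharp φ (k - l) * h l) := by
  obtain ⟨p, C, hC⟩ := hh.bound
  have h1 : Integrable (fun l => C * jap k ^ p * (jap (k - l) ^ p * ‖sharp φ (k - l)‖)) :=
    ((integrable_jap_pow_mul_sharp p hφ).comp_sub_left k).const_mul _
  refine h1.mono' ?_ (Eventually.of_forall fun l => ?_)
  · exact (((continuous_sharp hφ).comp (continuous_const.sub continuous_id)).measurable.mul
      hh.meas).aestronglyMeasurable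
  · rw [norm_mul]
    have hC0 : 0 ≤ C := by
      have h3 := (norm_nonneg _).trans (hC l)
      by_contra hneg
      have : 0 < jap l ^ p := pow_pos (jap_pos l) p
      nlinarith
    have h2 : jap l ^ p ≤ (jap (k - l) * jap k) ^ p := by
      refine pow_le_pow_left₀ (jap_pos l).le ?_ p
      rw [jap_sub_comm]
      exact jap_le_mul l k
    calc ‖sharp φ (k - l)‖ * ‖h l‖ ≤ ‖sharp φ (k - l)‖ * (C * (jap (k - l) * jap k) ^ p) := by
          gcongr
          exact (hC l).trans (by gcongr)
      _ = _ := by rw [mul_pow]; ring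

lemma exists_l2_weight_conv_le {φ : ℝ → ℂ} (hφ : IsTest φ) (p : ℕ) :
    ∃ K : ℝ≥0, ∀ (m : ℝ → ℝ) (h : ℝ → ℂ), Slow p m → Measurable m → Measurable h →
      l2 (fun k => m k * conv φ h k) ≤ K * l2 (fun k => m k * h k) := by
  obtain ⟨K, hK⟩ := exists_l2_conv_le hφ p
  refine ⟨K, fun m h hm hm' hh => ?_⟩
  convert hK (fun k _ => (m k : ℂ)) m h hm' hh (fun k l => ?_) using 3 with k
  · rw [conv, ← integral_const_mul]
    congr 1 with l
    ring
  · rw [Complex.norm_real, Real.norm_of_nonneg (hm.pos k).le]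
    exact hm.le_mul k l

lemma exists_l2_conv_le' {φ : ℝ → ℂ} (hφ : IsTest φ) :
    ∃ K : ℝ≥0, ∀ h : ℝ → ℂ, Measurable h → l2 (conv φ h) ≤ K * l2 h := by
  obtain ⟨K, hK⟩ := exists_l2_weight_conv_le hφ 0
  refine ⟨K, fun h hh => ?_⟩
  simpa using hK (fun _ => 1) h ⟨fun _ => one_pos, fun k l => by simp⟩ measurable_const hh

/-- The commutator of a slowly varying multiplier with the multiplication by `φ`. -/
def commutator (φ : ℝ → ℂ) (m : ℝ → ℝ) (h : ℝ → ℂ) (k : ℝ) : ℂ :=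
  m k * conv φ h k - conv φ (fun l => m l * h l) k

lemma commutator_eq {φ h : ℝ → ℂ} {m : ℝ → ℝ} (hφ : IsTest φ) (hm : PolyGrowth (fun k => (m k : ℂ)))
    (hh : PolyGrowth h) (k : ℝ) :
    commutator φ m h k = ∫ l, sharp φ (k - l) * ((m k : ℂ) - m l) * h l := by
  unfold commutator conv
  rw [← integral_const_mul, ← integral_sub ((integrable_sharp_mul hφ hh k).const_mul _)
    (integrable_sharp_mul hφ (hm.mul hh) k)]
  congr 1 with l
  ring

lemma measurable_commutator {φ h : ℝ → ℂ} {m : ℝ → ℝ} (hφ : IsTest φ) (hm : Measurable m)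
    (hh : Measurable h) : Measurable (commutator φ m h) :=
  ((Complex.measurable_ofReal.comp hm).mul (measurable_conv hφ hh)).sub
    (measurable_conv hφ ((Complex.measurable_ofReal.comp hm).mul hh))

/-- The commutator has kernel `sharp φ (k - l) (m k - m l)`, and slowness turns the difference into
`m l / jap l` times a power of `jap (k - l)`: one full order is gained, with a constant depending
only on `p` and `φ`. -/
lemma exists_l2_commutator_le {φ : ℝ → ℂ} (hφ : IsTest φ) (p : ℕ) :
    ∃ K : ℝ≥0, ∀ (m : ℝ → ℝ) (h : ℝ → ℂ), Slow p m → PolyGrowth (fun k => (m k : ℂ)) →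
      Measurable m → PolyGrowth h →
      l2 (commutator φ m h) ≤ K * l2 (fun k => (m k / jap k : ℝ) * h k) := by
  obtain ⟨K, hK⟩ := exists_l2_conv_le hφ (p + 2)
  refine ⟨K * p, fun m h hm hm1 hm2 hh => ?_⟩
  have := hK (fun k l => (m k : ℂ) - m l) (fun l => p * (m l / jap l)) h
    ((hm2.div continuous_jap.measurable).const_mul _) hh.meas (fun k l => by
      rw [← Complex.ofReal_sub, Complex.norm_real, Real.norm_eq_abs]
      exact hm.abs_sub_le k l)
  rw [funext (commutator_eq hφ hm1 hh)]
  refine this.trans (le_of_eq ?_)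
  rw [ENNReal.coe_mul, mul_assoc]
  congr 1
  have e : (fun l => (((p * (m l / jap l) : ℝ)) : ℂ) * h l) =
      (p : ℂ) • fun l => ((m l / jap l : ℝ) : ℂ) * h l := by
    ext l
    simp only [Pi.smul_apply, smul_eq_mul]
    push_cast
    ring
  unfold l2
  rw [e, eLpNorm_const_smul]
  congr 1
  simp [enorm_eq_nnnorm]

/-- The Cauchy–Schwarz inequality. -/
lemma enorm_integral_mul_conj_le {f g : ℝ → ℂ} (hf : Measurable f) (hg : Measurable g) :
    ‖∫ k, f k * (starRingEnd ℂ) (g k)‖ₑ ≤ l2 f * l2 g := by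
  refine (enorm_integral_le_lintegral_enorm _).trans ?_
  have h := ENNReal.lintegral_mul_le_Lp_mul_Lq volume (Real.HolderConjugate.two_two)
    hf.enorm.aemeasurable hg.enorm.aemeasurable
  have e : ∀ f : ℝ → ℂ, l2 f = (∫⁻ k, ‖f k‖ₑ ^ (2 : ℝ)) ^ (1 / 2 : ℝ) := fun f => by
    simp only [ENNReal.rpow_two]
    rw [← enorm_sq_eq_lintegral, ← ENNReal.rpow_natCast, ← ENNReal.rpow_mul]
    norm_num
  rw [e, e]
  refine le_trans (le_of_eq ?_) h
  congr 1 with k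
  rw [enorm_mul, Pi.mul_apply]
  congr 1
  rw [enorm_eq_nnnorm, enorm_eq_nnnorm, RCLike.nnnorm_conj]

lemma norm_integral_mul_conj_le {f g : ℝ → ℂ} (hf : MemLp f 2) (hg : MemLp g 2)
    (hf' : Measurable f) (hg' : Measurable g) :
    ‖∫ k, f k * (starRingEnd ℂ) (g k)‖ ≤ (l2 f).toReal * (l2 g).toReal := by
  have := ENNReal.toReal_mono (ENNReal.mul_ne_top hf.2.ne hg.2.ne)
    (enorm_integral_mul_conj_le hf' hg')
  rwa [ENNReal.toReal_mul, toReal_enorm] at this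

lemma integrable_mul_conj {f g : ℝ → ℂ} (hf : MemLp f 2) (hg : MemLp g 2) :
    Integrable (fun k => f k * (starRingEnd ℂ) (g k)) := by
  have hg' : MemLp (fun k => (starRingEnd ℂ) (g k)) 2 := hg.star
  exact hf.integrable_mul hg'

lemma integral_mul_conj_self {f : ℝ → ℂ} (hf : MemLp f 2) :
    ∫ k, f k * (starRingEnd ℂ) (f k) = (((l2 f).toReal ^ 2 : ℝ) : ℂ) := by
  have h1 : ∀ k, f k * (starRingEnd ℂ) (f k) = ((‖f k‖ ^ 2 : ℝ) : ℂ) := fun k => by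
    rw [Complex.mul_conj, Complex.normSq_eq_norm_sq]
  simp_rw [h1]
  rw [integral_complex_ofReal]
  congr 1
  rw [← ENNReal.toReal_pow, enorm_sq_eq_lintegral,
    integral_eq_lintegral_of_nonneg_ae (f := fun k => ‖f k‖ ^ 2)
      (Eventually.of_forall fun k => by positivity) (hf.1.norm.pow 2)]
  congr 2 with k
  rw [ENNReal.ofReal_pow (norm_nonneg _), ofReal_norm]

/-- Convolution with the kernel of a real function is symmetric. -/
lemma integral_mul_conj_conv {φ f g : ℝ → ℂ} (hφ : IsTest φ)
    (hreal : ∀ ξ, (starRingEnd ℂ) (φ ξ) = φ ξ) (hf : MemLp f 2) (hg : MemLp g 2)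
    (hf' : Measurable f) (hg' : Measurable g) :
    ∫ k, g k * (starRingEnd ℂ) (conv φ f k) = ∫ k, conv φ g k * (starRingEnd ℂ) (f k) := by
  obtain ⟨K, hK⟩ := exists_l2_conv_le hφ 0
  have hcs := continuous_sharp hφ
  -- Neither function is assumed integrable, so absolute convergence of the double integral comes
  -- from Young's inequality for the convolution followed by Hölder.
  have hint : Integrable (fun p : ℝ × ℝ => g p.1 * (starRingEnd ℂ) (sharp φ (p.1 - p.2) * f p.2))
      (volume.prod volume) := by
    have hmeas : Measurable (fun p : ℝ × ℝ =>
        g p.1 * (starRingEnd ℂ) (sharp φ (p.1 - p.2) * f p.2)) :=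
      (hg'.comp measurable_fst).mul (Complex.continuous_conj.measurable.comp
        ((hcs.measurable.comp (measurable_fst.sub measurable_snd)).mul (hf'.comp measurable_snd)))
    refine ⟨hmeas.aestronglyMeasurable, ?_⟩
    rw [hasFiniteIntegral_def, lintegral_prod _ hmeas.enorm.aemeasurable]
    have e : ∀ k l, ‖g k * (starRingEnd ℂ) (sharp φ (k - l) * f l)‖ₑ =
        ‖g k‖ₑ * (‖sharp φ (k - l)‖ₑ * ‖f l‖ₑ) := by
      intro k l
      rw [enorm_mul, ← enorm_mul (sharp φ (k - l))]
      congr 1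
      rw [enorm_eq_nnnorm, enorm_eq_nnnorm, RCLike.nnnorm_conj]
    have hm2 : Measurable fun k => ∫⁻ l, ‖sharp φ (k - l)‖ₑ * ‖f l‖ₑ :=
      Measurable.lintegral_prod_right' (f := fun p : ℝ × ℝ => ‖sharp φ (p.1 - p.2)‖ₑ * ‖f p.2‖ₑ)
        ((hcs.measurable.comp (measurable_fst.sub measurable_snd)).enorm.mul
          (hf'.comp measurable_snd).enorm)
    simp_rw [e]
    have e2 : ∀ k, ∫⁻ l, ‖g k‖ₑ * (‖sharp φ (k - l)‖ₑ * ‖f l‖ₑ) =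
        ‖g k‖ₑ * ∫⁻ l, ‖sharp φ (k - l)‖ₑ * ‖f l‖ₑ := fun k =>
      lintegral_const_mul _ ((hcs.measurable.comp (measurable_const.sub measurable_id)).enorm.mul
        hf'.enorm)
    simp_rw [e2]
    refine (ENNReal.lintegral_mul_le_Lp_mul_Lq volume (Real.HolderConjugate.two_two)
      hg'.enorm.aemeasurable hm2.aemeasurable).trans_lt ?_
    simp only [ENNReal.rpow_two]
    refine ENNReal.mul_lt_top (ENNReal.rpow_lt_top_of_nonneg (by norm_num) ?_)
      (ENNReal.rpow_lt_top_of_nonneg (by norm_num) ?_)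
    · rw [← enorm_sq_eq_lintegral]
      exact ENNReal.pow_ne_top hg.2.ne
    · refine ((lintegral_conv_sq_le hcs.measurable.enorm hf'.enorm).trans_lt ?_).ne
      refine ENNReal.mul_lt_top (ENNReal.pow_lt_top (integrable_sharp hφ).2) ?_
      rw [← enorm_sq_eq_lintegral]
      exact ENNReal.pow_lt_top hf.2
  have hsw := integral_integral_swap
    (f := fun k l => g k * (starRingEnd ℂ) (sharp φ (k - l) * f l)) hint
  have e1 : ∀ k, g k * (starRingEnd ℂ) (conv φ f k) =
      ∫ l, g k * (starRingEnd ℂ) (sharp φ (k - l) * f l) := by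
    intro k
    rw [integral_const_mul, conv, integral_conj]
  have e2 : ∀ l, conv φ g l * (starRingEnd ℂ) (f l) =
      ∫ k, g k * (starRingEnd ℂ) (sharp φ (k - l) * f l) := by
    intro l
    rw [conv, ← integral_mul_const]
    congr 1 with k
    rw [map_mul, ← sharp_neg_of_real hreal, neg_sub]
    ring
  simp_rw [e1, e2]
  exact hsw

/-! ### An interpolation inequality for localized functions -/

lemma memLp_mul_of_bound {m : ℝ → ℝ} {f : ℝ → ℂ} (hm : Measurable m) {B : ℝ} (hB : ∀ k, |m k| ≤ B)
    (hf : MemLp f 2) : MemLp (fun k => (m k : ℂ) * f k) 2 := by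
  refine MemLp.of_le_mul (g := f) (c := B) hf
    ((Complex.measurable_ofReal.comp hm).aestronglyMeasurable.mul hf.1)
    (Eventually.of_forall fun k => ?_)
  rw [norm_mul, Complex.norm_real]
  exact mul_le_mul_of_nonneg_right (hB k) (norm_nonneg _)

lemma memLp_conv {φ f : ℝ → ℂ} (hφ : IsTest φ) (hf : MemLp f 2) (hf' : Measurable f) :
    MemLp (conv φ f) 2 := by
  obtain ⟨K, hK⟩ := exists_l2_conv_le' hφ
  exact ⟨(measurable_conv hφ hf').aestronglyMeasurable,
    (hK f hf').trans_lt (ENNReal.mul_lt_top ENNReal.coe_lt_top hf.2)⟩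

lemma enorm_natCast_complex (n : ℕ) : ‖((n : ℝ≥0) : ℂ)‖ₑ = ((n : ℝ≥0) : ℝ≥0∞) := by
  simp [enorm_eq_nnnorm]

/-- In physical space let `f₁ = ψ f` and `f₂ = ψ f₁`. Write `‖ν^{i+1} f₁‖²` as the pairing of
`ν^{2i+2} f₁` with `ψ f`, and move the real factor `ψ` to the left. Commuting it with `ν^{2i+2}`
leaves the pairing of `ν^{i+2} f₂` with `ν^i f`, plus a commutator. The latter gains one order,
which by `ν ≤ jap` pays for one factor of `ν`. -/
lemma exists_interpolation_step {ψ : ℝ → ℂ} (hψ : IsTest ψ)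
    (hreal : ∀ ξ, (starRingEnd ℂ) (ψ ξ) = ψ ξ) (i : ℕ) :
    ∃ C : ℝ≥0, ∀ ν : ℝ → ℝ, Slow 5 ν → Continuous ν → (∀ k, ν k ≤ jap k) →
      (∃ B, ∀ k, ν k ≤ B) → ∀ f : ℝ → ℂ, MemLp f 2 → Measurable f → PolyGrowth (conv ψ f) →
      l2 (fun k => (ν k ^ (i + 1) : ℝ) * conv ψ f k) ^ 2 ≤
        l2 (fun k => (ν k ^ (i + 2) : ℝ) * conv ψ (conv ψ f) k) * l2 (fun k => (ν k ^ i : ℝ) * f k) +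
        C * l2 (fun k => (ν k ^ (i + 1) : ℝ) * conv ψ f k) * l2 (fun k => (ν k ^ i : ℝ) * f k) := by
  obtain ⟨K, hK⟩ := exists_l2_conv_le hψ ((2 * i + 2) * 5 + 2 + i * 5)
  refine ⟨K * ((2 * i + 2) * 5 : ℕ), fun ν hν hc hJ ⟨B, hB⟩ f hf hfm hpg => ?_⟩
  set f1 := conv ψ f with hf1
  set f2 := conv ψ f1 with hf2
  set M : ℝ → ℝ := fun k => ν k ^ (2 * i + 2) with hM
  have hpos := hν.pos
  have hbd : ∀ (j : ℕ) k, |ν k ^ j| ≤ B ^ j := fun j k => by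
    rw [abs_of_pos (pow_pos (hpos k) j)]
    exact pow_le_pow_left₀ (hpos k).le (hB k) j
  have hf1L : MemLp f1 2 := memLp_conv hψ hf hfm
  have hf1m : Measurable f1 := measurable_conv hψ hfm
  have hf2L : MemLp f2 2 := memLp_conv hψ hf1L hf1m
  have hf2m : Measurable f2 := measurable_conv hψ hf1m
  have hMm : Measurable M := (hc.pow _).measurable
  have hslowM : Slow ((2 * i + 2) * 5) M := hν.pow _
  have hMpg : PolyGrowth (fun k => (M k : ℂ)) :=
    polyGrowth_of_bound (hc.pow _) (fun k => (pow_pos (hpos k) _).le)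
      (fun k => (le_abs_self _).trans (hbd _ k))
  set g : ℝ → ℂ := fun k => M k * f1 k with hg
  have hgL : MemLp g 2 := memLp_mul_of_bound hMm (hbd _) hf1L
  have hgm : Measurable g := (Complex.measurable_ofReal.comp hMm).mul hf1m
  have hMf2 : MemLp (fun k => (M k : ℂ) * f2 k) 2 := memLp_mul_of_bound hMm (hbd _) hf2L
  have hcomL : MemLp (commutator ψ M f1) 2 := hMf2.sub (memLp_conv hψ hgL hgm)
  have hcomm : Measurable (commutator ψ M f1) := measurable_commutator hψ hMm hf1m
  have hFL : MemLp (fun k => ((ν k ^ (i + 1) : ℝ) : ℂ) * f1 k) 2 :=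
    memLp_mul_of_bound (hc.pow _).measurable (hbd _) hf1L
  have e1 : l2 (fun k => (ν k ^ (i + 1) : ℝ) * f1 k) ^ 2 =
      ‖∫ k, g k * (starRingEnd ℂ) (f1 k)‖ₑ := by
    have h1 := integral_mul_conj_self hFL
    have h2 : ∫ k, g k * (starRingEnd ℂ) (f1 k) =
        ∫ k, (((ν k ^ (i + 1) : ℝ) : ℂ) * f1 k) *
          (starRingEnd ℂ) (((ν k ^ (i + 1) : ℝ) : ℂ) * f1 k) := by
      congr 1 with k
      rw [map_mul, Complex.conj_ofReal, hg]
      simp only [hM]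
      push_cast
      ring
    rw [h2, h1, ← ofReal_norm, Complex.norm_real, Real.norm_of_nonneg (sq_nonneg _),
      ENNReal.ofReal_pow ENNReal.toReal_nonneg, ENNReal.ofReal_toReal hFL.2.ne]
  -- Symmetry of convolution with a real symbol, followed by the definition of the commutator; the
  -- weight is then redistributed as `ν^{2i+2} = ν^{i+2} ν^i`, and as `1 = ν^{-i} ν^i` in the
  -- commutator.
  have e2 : ∫ k, g k * (starRingEnd ℂ) (f1 k) =
      (∫ k, (((ν k ^ (i + 2) : ℝ) : ℂ) * f2 k) * (starRingEnd ℂ) (((ν k ^ i : ℝ) : ℂ) * f k)) -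
      ∫ k, ((((ν k ^ i)⁻¹ : ℝ) : ℂ) * commutator ψ M f1 k) *
        (starRingEnd ℂ) (((ν k ^ i : ℝ) : ℂ) * f k) := by
    rw [hf1, integral_mul_conj_conv hψ hreal hf hgL hfm hgm]
    have h3 : ∀ k, conv ψ g k * (starRingEnd ℂ) (f k) =
        ((M k : ℂ) * f2 k) * (starRingEnd ℂ) (f k) -
          commutator ψ M f1 k * (starRingEnd ℂ) (f k) := fun k => by
      rw [commutator]; ring
    simp_rw [h3]
    rw [integral_sub (integrable_mul_conj hMf2 hf) (integrable_mul_conj hcomL hf)]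
    congr 1
    · congr 1 with k
      rw [map_mul, Complex.conj_ofReal]
      simp only [hM]
      push_cast
      ring
    · congr 1 with k
      have : (ν k : ℂ) ≠ 0 := by exact_mod_cast (hpos k).ne'
      rw [map_mul, Complex.conj_ofReal]
      push_cast
      field_simp
      exact mul_comm _ _
  have e3 : l2 (fun k => (((ν k ^ i)⁻¹ : ℝ) : ℂ) * commutator ψ M f1 k) ≤
      (K * ((2 * i + 2) * 5 : ℕ) : ℝ≥0) * l2 (fun k => (ν k ^ (i + 1) : ℝ) * f1 k) := by
    have h4 := hK (fun k l => (((ν k ^ i)⁻¹ : ℝ) : ℂ) * ((M k : ℂ) - M l))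
      (fun l => ((2 * i + 2) * 5 : ℕ) * ν l ^ (i + 1)) f1
      ((hc.pow _).measurable.const_mul _) hf1m ?_
    · have e4 : (fun k => (((ν k ^ i)⁻¹ : ℝ) : ℂ) * commutator ψ M f1 k) = fun k =>
          ∫ l, sharp ψ (k - l) * ((((ν k ^ i)⁻¹ : ℝ) : ℂ) * ((M k : ℂ) - M l)) * f1 l := by
        ext k
        rw [commutator_eq hψ hMpg hpg, ← integral_const_mul]
        congr 1 with l
        ring
      rw [e4]
      refine h4.trans (le_of_eq ?_)
      rw [ENNReal.coe_mul, mul_assoc]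
      congr 1
      have e5 : (fun l => (((((2 * i + 2) * 5 : ℕ) * ν l ^ (i + 1) : ℝ)) : ℂ) * f1 l) =
          ((((2 * i + 2) * 5 : ℕ) : ℝ≥0) : ℂ) • fun l => ((ν l ^ (i + 1) : ℝ) : ℂ) * f1 l := by
        ext l
        simp only [Pi.smul_apply, smul_eq_mul]
        push_cast
        ring
      unfold l2
      rw [e5, eLpNorm_const_smul]
      rw [enorm_natCast_complex]
    · intro k l
      rw [norm_mul, Complex.norm_real, ← Complex.ofReal_sub, Complex.norm_real, Real.norm_eq_abs,
        Real.norm_eq_abs, abs_of_pos (inv_pos.2 (pow_pos (hpos k) i))]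
      have h5 := hslowM.abs_sub_le k l
      have h6 := ((hν.pow i).inv).le_mul k l
      have hJl := jap_pos l
      have hJ0 := jap_pos (k - l)
      -- The gain `1 / jap l` removes one of the `i + 2` powers of `ν` left after division by `ν^i`.
      have h7 : (ν l ^ i)⁻¹ * (M l / jap l) ≤ ν l ^ (i + 1) := by
        have hl := hpos l
        have : (ν l ^ i)⁻¹ * (M l / jap l) = ν l ^ (i + 1) * (ν l / jap l) := by
          simp only [hM]
          field_simp
          ring
        rw [this]
        exact mul_le_of_le_one_right (by positivity) ((div_le_one hJl).2 (hJ l))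
      calc (ν k ^ i)⁻¹ * |M k - M l|
          ≤ (jap (k - l) ^ (i * 5) * (ν l ^ i)⁻¹) *
            (jap (k - l) ^ ((2 * i + 2) * 5 + 2) * (((2 * i + 2) * 5 : ℕ) * (M l / jap l))) :=
            mul_le_mul h6 h5 (abs_nonneg _) (by have := hpos l; positivity)
        _ = jap (k - l) ^ ((2 * i + 2) * 5 + 2 + i * 5) * (((2 * i + 2) * 5 : ℕ) *
            ((ν l ^ i)⁻¹ * (M l / jap l))) := by ring
        _ ≤ _ := by gcongr
  rw [e1, e2]
  refine (enorm_sub_le).trans ?_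
  have hfi : Measurable (fun k => ((ν k ^ i : ℝ) : ℂ) * f k) :=
    (Complex.measurable_ofReal.comp (hc.pow _).measurable).mul hfm
  gcongr
  · exact enorm_integral_mul_conj_le
      ((Complex.measurable_ofReal.comp (hc.pow _).measurable).mul hf2m) hfi
  · refine (enorm_integral_mul_conj_le ((Complex.measurable_ofReal.comp
      (hc.pow _).measurable.inv).mul hcomm) hfi).trans ?_
    exact mul_le_mul' e3 le_rfl

/-- Approximate logarithmic convexity of a finite sequence. -/
def LogConvexUpTo (C : ℝ) (n : ℕ) (A : ℕ → ℝ) : Prop :=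
  (∀ j, 0 ≤ A j) ∧ ∀ i, i + 2 ≤ n → A (i + 1) ^ 2 ≤ A (i + 2) * A i + C * A (i + 1) * A i

/-- Convexity gives `A (j+1) ≤ ε/2 A (j+2) + K₁ A j` with `K₁ = C + 2/ε`. The induction hypothesis
with `1/(2 K₁)` in place of `ε` then replaces `K₁ A j` by half of `A (j+1)`, which is absorbed on
the left, and a multiple of `A 0`. -/
lemma LogConvexUpTo.exists_le_succ {C : ℝ} (hC : 0 ≤ C) (n j : ℕ) :
    ∀ ε : ℝ, 0 < ε → ∃ K, 0 ≤ K ∧ ∀ A, LogConvexUpTo C n A → j + 1 ≤ n →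
      A j ≤ ε * A (j + 1) + K * A 0 := by
  induction j with
  | zero => exact fun ε hε => ⟨1, zero_le_one, fun A hA _ => by nlinarith [hA.1 0, hA.1 1]⟩
  | succ j ih =>
    intro ε hε
    set K1 := C + 2 / ε with hK1
    have hK1pos : 0 < K1 := by positivity
    obtain ⟨K2, hK2, h2⟩ := ih (1 / (2 * K1)) (by positivity)
    refine ⟨2 * K1 * K2, by positivity, fun A hA hj => ?_⟩
    have hA0 := hA.1 0
    have hAj := hA.1 j
    have hA1 := hA.1 (j + 1)
    have hA2 := hA.1 (j + 2)
    -- If this failed, both `A (j+2)` and `A j` would be small relative to `A (j+1)`, and the right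
    -- side of the convexity inequality would fall below `A (j+1)²`.
    have h3 : A (j + 1) ≤ ε / 2 * A (j + 2) + K1 * A j := by
      by_contra hcon
      push Not at hcon
      have h4 := hA.2 j (by omega)
      have h5 : 0 < A (j + 1) := lt_of_le_of_lt (by positivity) hcon
      have h6 : A (j + 1) * (ε / 2 * A (j + 2) + K1 * A j) < A (j + 1) ^ 2 := by
        rw [sq]; exact mul_lt_mul_of_pos_left hcon h5
      have h7 : A (j + 2) * A j ≤ 2 / ε * A (j + 1) * A j := by
        have : A (j + 2) ≤ 2 / ε * A (j + 1) := by
          rw [div_mul_eq_mul_div, le_div_iff₀ hε]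
          nlinarith [mul_nonneg hK1pos.le hAj]
        exact mul_le_mul_of_nonneg_right this hAj
      have h8 : A (j + 1) * (ε / 2 * A (j + 2) + K1 * A j) ≥
          C * A (j + 1) * A j + 2 / ε * A (j + 1) * A j := by
        rw [hK1]
        have : 0 ≤ A (j + 1) * (ε / 2 * A (j + 2)) := by positivity
        nlinarith
      linarith
    have h9 := h2 A hA (by omega)
    have h10 : K1 * A j ≤ A (j + 1) / 2 + K1 * K2 * A 0 := by
      calc K1 * A j ≤ K1 * (1 / (2 * K1) * A (j + 1) + K2 * A 0) := by gcongr
        _ = _ := by field_simp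
    show A (j + 1) ≤ ε * A (j + 2) + 2 * K1 * K2 * A 0
    linarith

/-- The one-step bounds are chained downwards from `n`: the first step carries `ε`, all later ones
use the factor `1`. Summing the constants makes a single `K` serve every `j`. -/
lemma LogConvexUpTo.exists_le {C : ℝ} (hC : 0 ≤ C) (n : ℕ) {ε : ℝ} (hε : 0 < ε) :
    ∃ K, 0 ≤ K ∧ ∀ A, LogConvexUpTo C n A → ∀ j < n, A j ≤ ε * A n + K * A 0 := by
  have key : ∀ d : ℕ, ∀ ε : ℝ, 0 < ε → ∃ K, 0 ≤ K ∧ ∀ A, LogConvexUpTo C n A → d + 1 ≤ n →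
      A (n - (d + 1)) ≤ ε * A n + K * A 0 := by
    intro d
    induction d with
    | zero =>
      intro ε hε
      obtain ⟨K, hK, h⟩ := exists_le_succ hC n (n - 1) ε hε
      refine ⟨K, hK, fun A hA hd => ?_⟩
      have := h A hA (by omega)
      rwa [show n - 1 + 1 = n by omega] at this
    | succ d ih =>
      intro ε hε
      obtain ⟨K1, hK1, h1⟩ := ih ε hε
      obtain ⟨K2, hK2, h2⟩ := exists_le_succ hC n (n - (d + 2)) 1 one_pos
      refine ⟨K1 + K2, by positivity, fun A hA hd => ?_⟩
      have h3 := h1 A hA (by omega)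
      have h4 := h2 A hA (by omega)
      rw [show n - (d + 2) + 1 = n - (d + 1) by omega] at h4
      show A (n - (d + 2)) ≤ _
      linarith
  choose K hK hKA using fun d => key d ε hε
  refine ⟨∑ d ∈ Finset.range n, K d, Finset.sum_nonneg fun d _ => hK d, fun A hA j hj => ?_⟩
  have h1 := hKA (n - 1 - j) A hA (by omega)
  rw [show n - (n - 1 - j + 1) = j by omega] at h1
  have h2 : K (n - 1 - j) ≤ ∑ d ∈ Finset.range n, K d :=
    Finset.single_le_sum (fun d _ => hK d) (Finset.mem_range.2 (by omega))
  have := mul_le_mul_of_nonneg_right h2 (hA.1 0)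
  linarith

/-! ### The commutator of `ρ₀` with a localization -/

/-- Pairs of weights admissible for the energy estimate: `ν ^ n` is a truncated power, and `m`
is comparable to `ν ^ n` up to the logarithmic factor. -/
structure Admissible (n : ℕ) (ν m : ℝ → ℝ) : Prop where
  slow_base : Slow 5 ν
  cont_base : Continuous ν
  base_le : ∀ k, ν k ≤ jap k
  base_bdd : ∃ B, ∀ k, ν k ≤ B
  slow : Slow (n * 5 + 1) m
  cont : Continuous m
  le : ∀ k, m k ≤ ν k ^ n * sell k
  ge : ∀ k, ν k ^ n ≤ m k * sell k
  decay : ∃ B, ∀ k, m k * jap k ^ 2 ≤ B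

/-- Localization by a power of `ψ`. -/
def loc (ψ w : ℝ → ℂ) (j : ℕ) : ℝ → ℂ := fun ξ => ψ ξ ^ j * w ξ

lemma loc_zero (ψ w : ℝ → ℂ) : loc ψ w 0 = w := by
  ext ξ; rw [loc, pow_zero, one_mul]

lemma IsTest.pow {ψ : ℝ → ℂ} (hψ : IsTest ψ) {n : ℕ} (hn : 1 ≤ n) : IsTest (fun ξ => ψ ξ ^ n) := by
  obtain ⟨i, rfl⟩ : ∃ i, n = i + 1 := ⟨n - 1, by omega⟩
  simp_rw [pow_succ']
  exact hψ.mul_smooth (hψ.smooth.pow i)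

lemma IsTest.integrable_mul {φ h : ℝ → ℂ} (hφ : IsTest φ) (hh : Integrable h) :
    Integrable (fun ξ => φ ξ * h ξ) := by
  obtain ⟨C, hC⟩ := hφ.continuous.bounded_above_of_compact_support hφ.compact
  exact hh.bdd_mul hφ.continuous.aestronglyMeasurable (Eventually.of_forall hC)

lemma hat_mul' {φ h : ℝ → ℂ} (hφ : IsTest φ) (hh : Integrable h) :
    hat (fun ξ => φ ξ * h ξ) = conv φ (hat h) := funext fun k => hat_mul hφ hh k

lemma integrable_loc {ψ w : ℝ → ℂ} (hψ : IsTest ψ) (hw : Integrable w) (j : ℕ) :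
    Integrable (loc ψ w j) := by
  rcases Nat.eq_zero_or_pos j with rfl | hj
  · rwa [loc_zero]
  · exact (hψ.pow hj).integrable_mul hw

lemma hat_loc_succ {ψ w : ℝ → ℂ} (hψ : IsTest ψ) (hw : Integrable w) (j : ℕ) :
    hat (loc ψ w (j + 1)) = conv ψ (hat (loc ψ w j)) := by
  rw [← hat_mul' hψ (integrable_loc hψ hw j)]
  congr 1
  ext ξ
  rw [loc, loc, pow_succ']
  ring

lemma memLp_hat_loc {ψ w : ℝ → ℂ} (hψ : IsTest ψ) (hw : Integrable w) (hw2 : MemLp (hat w) 2)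
    (j : ℕ) : MemLp (hat (loc ψ w j)) 2 := by
  induction j with
  | zero => rwa [loc_zero]
  | succ j ih =>
    rw [hat_loc_succ hψ hw]
    exact memLp_conv hψ ih (continuous_hat (integrable_loc hψ hw j)).measurable

/-- Interpolation between the full localization and `w` itself. `K` depends on `ψ`, `n` and `ε` but
not on the weights, because the constants of `exists_interpolation_step` are uniform in `ν`. -/
lemma exists_l2_loc_le {ψ : ℝ → ℂ} (hψ : IsTest ψ) (hreal : ∀ ξ, (starRingEnd ℂ) (ψ ξ) = ψ ξ)
    (n : ℕ) {ε : ℝ} (hε : 0 < ε) :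
    ∃ K : ℝ, 0 ≤ K ∧ ∀ ν m, Admissible n ν m → ∀ w, Integrable w → MemLp (hat w) 2 → ∀ j < n,
      (l2 (fun k => (ν k ^ j : ℝ) * hat (loc ψ w j) k)).toReal ≤
        ε * (l2 (fun k => (ν k ^ n : ℝ) * hat (loc ψ w n) k)).toReal + K * (l2 (hat w)).toReal := by
  choose C hC using fun i => exists_interpolation_step hψ hreal i
  obtain ⟨K, hK, h⟩ := LogConvexUpTo.exists_le (C := ∑ i ∈ Finset.range n, (C i : ℝ))
    (Finset.sum_nonneg fun i _ => (C i).2) n hε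
  refine ⟨K, hK, fun ν m hA w hw hw2 j hj => ?_⟩
  set A : ℕ → ℝ := fun j => (l2 (fun k => (ν k ^ j : ℝ) * hat (loc ψ w j) k)).toReal with hAdef
  obtain ⟨B, hB⟩ := hA.base_bdd
  have hpos := hA.slow_base.pos
  have hfin : ∀ j, l2 (fun k => (ν k ^ j : ℝ) * hat (loc ψ w j) k) ≠ ⊤ := fun j =>
    (memLp_mul_of_bound (m := fun k => ν k ^ j) (B := B ^ j) (hA.cont_base.pow j).measurable (fun k => by
      rw [abs_of_pos (pow_pos (hpos k) j)]
      exact pow_le_pow_left₀ (hpos k).le (hB k) j) (memLp_hat_loc hψ hw hw2 j)).2.ne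
  have hlog : LogConvexUpTo (∑ i ∈ Finset.range n, (C i : ℝ)) n A := by
    refine ⟨fun j => ENNReal.toReal_nonneg, fun i hi => ?_⟩
    have h1 := hC i ν hA.slow_base hA.cont_base hA.base_le hA.base_bdd (hat (loc ψ w i))
      (memLp_hat_loc hψ hw hw2 i) (continuous_hat (integrable_loc hψ hw i)).measurable (by
        rw [← hat_loc_succ hψ hw]
        exact polyGrowth_hat (integrable_loc hψ hw (i + 1)))
    rw [← hat_loc_succ hψ hw, ← hat_loc_succ hψ hw] at h1
    have h2 := ENNReal.toReal_mono (ENNReal.add_ne_top.2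
      ⟨ENNReal.mul_ne_top (hfin (i + 2)) (hfin i),
        ENNReal.mul_ne_top (ENNReal.mul_ne_top ENNReal.coe_ne_top (hfin (i + 1))) (hfin i)⟩) h1
    rw [ENNReal.toReal_add (ENNReal.mul_ne_top (hfin (i + 2)) (hfin i))
      (ENNReal.mul_ne_top (ENNReal.mul_ne_top ENNReal.coe_ne_top (hfin (i + 1))) (hfin i)),
      ENNReal.toReal_pow, ENNReal.toReal_mul, ENNReal.toReal_mul, ENNReal.toReal_mul,
      ENNReal.coe_toReal] at h2
    have h3 : (C i : ℝ) ≤ ∑ i ∈ Finset.range n, (C i : ℝ) :=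
      Finset.single_le_sum (f := fun i => (C i : ℝ)) (fun i _ => (C i).2)
        (Finset.mem_range.2 (by omega))
    refine h2.trans ?_
    simp only [hAdef]
    gcongr
  have := h A hlog j hj
  simpa [hAdef, loc_zero] using this

lemma IsTest.deriv_mul_pow {θ ψ : ℝ → ℂ} (hθ : IsTest θ) (hψ : IsTest ψ) (m : ℕ) :
    _root_.deriv (fun ξ => θ ξ * ψ ξ ^ (m + 1)) =
      fun ξ => (_root_.deriv θ ξ * ψ ξ + (m + 1) * (θ ξ * _root_.deriv ψ ξ)) * ψ ξ ^ m := by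
  ext ξ
  have h1 := (hθ.differentiable ξ).hasDerivAt
  have h2 := ((hψ.differentiable ξ).hasDerivAt).pow (m + 1)
  have h3 := (h1.mul h2).deriv
  have e : (θ * ψ ^ (m + 1)) = fun ξ => θ ξ * ψ ξ ^ (m + 1) := rfl
  rw [e] at h3
  rw [h3]
  simp only [Pi.pow_apply, Nat.add_sub_cancel]
  push_cast
  ring

/-- The `j`-th derivative of `ψ^n` still contains the factor `ψ^{n-j}`. This is where a smooth
`n`-th root of the cutoff is needed: derivatives of the cutoff remain localized by powers of `ψ`. -/
lemma exists_sharp_pow {ψ : ℝ → ℂ} (hψ : IsTest ψ) {n j : ℕ} (hj : 1 ≤ j) (hjn : j ≤ n) :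
    ∃ θ, IsTest θ ∧ ∀ k : ℝ, (Complex.I * k) ^ j * sharp (fun ξ => ψ ξ ^ n) k =
      sharp (fun ξ => θ ξ * ψ ξ ^ (n - j)) k := by
  induction j, hj using Nat.le_induction with
  | base =>
    refine ⟨fun ξ => deriv ψ ξ * n, hψ.deriv.mul_smooth contDiff_const, fun k => ?_⟩
    rw [pow_one, ← sharp_deriv (hψ.pow hjn)]
    congr 1
    ext ξ
    have := ((hψ.differentiable ξ).hasDerivAt.pow n).deriv
    rw [show (fun ξ => ψ ξ ^ n) = ψ ^ n from rfl, this]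
    ring
  | succ j hj ih =>
    obtain ⟨θ, hθ, h⟩ := ih (by omega)
    obtain ⟨i, hi⟩ : ∃ i, n - j = i + 1 := ⟨n - j - 1, by omega⟩
    refine ⟨fun ξ => deriv θ ξ * ψ ξ + (i + 1) * (θ ξ * deriv ψ ξ), ?_, fun k => ?_⟩
    · refine (hθ.deriv.mul hψ).add ?_
      have := (hθ.mul hψ.deriv).mul_smooth (contDiff_const (c := ((i : ℂ) + 1)))
      simpa [mul_comm] using this
    · have hi2 : n - (j + 1) = i := by omega
      rw [pow_succ', mul_assoc, h k, hi, ← sharp_deriv (hθ.mul_smooth (hψ.smooth.pow (i + 1))),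
        hθ.deriv_mul_pow hψ, hi2]

/-- The commutator of the multiplier `ρ₀` with the multiplication by `χ`. -/
def rhoComm (χ W : ℝ → ℂ) (k : ℝ) : ℂ := rho0 k * conv χ W k - conv χ (fun l => rho0 l * W l) k

lemma measurable_rhoComm {χ W : ℝ → ℂ} (hχ : IsTest χ) (hW : Measurable W) :
    Measurable (rhoComm χ W) :=
  (continuous_rho0.measurable.mul (measurable_conv hχ hW)).sub
    (measurable_conv hχ (continuous_rho0.measurable.mul hW))

lemma continuous_den (n : ℕ) : Continuous (den n) := by
  unfold den; fun_prop

lemma continuous_rhoCoeff {j : ℕ} (hj : 1 ≤ j) : Continuous (rhoCoeff j) := by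
  refine continuous_tsum (u := fun n : ℕ => 2 ^ (j + 1) * (1 / ((n : ℝ) + 1) ^ (j + 1)))
    (fun n => ?_) ?_ fun n k => ?_
  · exact continuous_const.mul ((continuous_const.div (continuous_den n) (den_ne_zero n)).pow _)
  · exact (summable_tail le_rfl hj).1.mul_left _
  · refine (norm_rhoCoeff_term_le j n k).trans ?_
    gcongr
    exact one_le_jap k

/-- The kernel of the commutator is `sharp χ (k - l) (ρ₀ k - ρ₀ l)`. In the Taylor expansion at `k`,
the power `(k - l)^j` turns `sharp χ` into the transform of a `j`-th derivative; its factor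
`ψ^{n-j}` is passed to `w`, leaving the multiplication by `θ j`. -/
lemma rhoComm_eq {ψ w : ℝ → ℂ} (hψ : IsTest ψ) (hw : Integrable w) {n : ℕ} (hn : 1 ≤ n)
    {θ : ℕ → ℝ → ℂ} (hθ : ∀ j ∈ Finset.Ico 1 n, IsTest (θ j) ∧
      ∀ k : ℝ, (Complex.I * k) ^ j * sharp (fun ξ => ψ ξ ^ n) k =
        sharp (fun ξ => θ j ξ * ψ ξ ^ (n - j)) k) (k : ℝ) :
    rhoComm (fun ξ => ψ ξ ^ n) (hat w) k =
      (∑ j ∈ Finset.Ico 1 n, rhoCoeff j k * (-Complex.I) ^ j *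
        conv (θ j) (hat (loc ψ w (n - j))) k) +
      ∫ l, sharp (fun ξ => ψ ξ ^ n) (k - l) * (((k - l : ℝ) : ℂ) ^ n * rhoRem n k l) * hat w l := by
  set χ : ℝ → ℂ := fun ξ => ψ ξ ^ n with hχdef
  have hχ : IsTest χ := hψ.pow hn
  have hW := polyGrowth_hat hw
  have hterm : ∀ j ∈ Finset.Ico 1 n, Integrable (fun l => rhoCoeff j k * (-Complex.I) ^ j *
      (sharp (fun ξ => θ j ξ * ψ ξ ^ (n - j)) (k - l) * hat w l)) ∧
      ∫ l, rhoCoeff j k * (-Complex.I) ^ j *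
      (sharp (fun ξ => θ j ξ * ψ ξ ^ (n - j)) (k - l) * hat w l) =
      rhoCoeff j k * (-Complex.I) ^ j * conv (θ j) (hat (loc ψ w (n - j))) k := by
    intro j hj
    obtain ⟨h1, -⟩ := hθ j hj
    have h3 : IsTest (fun ξ => θ j ξ * ψ ξ ^ (n - j)) := h1.mul_smooth (hψ.smooth.pow _)
    refine ⟨(integrable_sharp_mul h3 hW k).const_mul _, ?_⟩
    rw [integral_const_mul]
    congr 1
    rw [← hat_mul h3 hw, ← hat_mul' h1 (integrable_loc hψ hw _)]
    congr 1
    ext ξ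
    rw [loc]
    ring
  have htot : Integrable (fun l => sharp χ (k - l) * ((rho0 k - rho0 l) * hat w l)) := by
    have h1 := (integrable_sharp_mul hχ hW k).const_mul (rho0 k)
    have h2 := integrable_sharp_mul hχ (polyGrowth_rho0.mul hW) k
    refine (h1.sub h2).congr (Eventually.of_forall fun l => ?_)
    simp only [Pi.sub_apply]
    ring
  have hL : rhoComm χ (hat w) k = ∫ l, sharp χ (k - l) * ((rho0 k - rho0 l) * hat w l) := by
    unfold rhoComm conv
    rw [← integral_const_mul, ← integral_sub ((integrable_sharp_mul hχ hW k).const_mul _)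
      (integrable_sharp_mul hχ (polyGrowth_rho0.mul hW) k)]
    congr 1 with l
    ring
  have hsumint := integrable_finsetSum (Finset.Ico 1 n) fun j hj => (hterm j hj).1
  rw [hL, ← Finset.sum_congr rfl fun j hj => (hterm j hj).2,
    ← integral_finsetSum _ fun j hj => (hterm j hj).1, ← sub_eq_iff_eq_add', ← integral_sub htot hsumint]
  congr 1 with l
  rw [rho0_sub k l hn, add_mul, mul_add, Finset.sum_mul, Finset.mul_sum, add_sub_right_comm,
    ← Finset.sum_sub_distrib, Finset.sum_eq_zero, zero_add]
  · ring
  · intro j hj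
    rw [← (hθ j hj).2 (k - l), mul_pow]
    have : (-Complex.I) ^ j * Complex.I ^ j = 1 := by
      rw [← mul_pow]; simp
    linear_combination (-(rhoCoeff j k * ((k - l : ℝ) : ℂ) ^ j * sharp χ (k - l) * hat w l)) * this

/-- The commutator of `ρ₀` with `ψ ^ n` is controlled by the lower localizations. -/
theorem exists_l2_rhoComm_le {ψ : ℝ → ℂ} (hψ : IsTest ψ) {n : ℕ} (hn : 1 ≤ n) :
    ∃ K : ℝ≥0, ∀ ν m, Admissible n ν m → ∀ w, Integrable w →
      l2 (fun k => (m k / sell k : ℝ) * rhoComm (fun ξ => ψ ξ ^ n) (hat w) k) ≤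
        K * ∑ j ∈ Finset.range n, l2 (fun k => (ν k ^ j : ℝ) * hat (loc ψ w j) k) := by
  have hχ : IsTest (fun ξ => ψ ξ ^ n) := hψ.pow hn
  have hθ' : ∀ j, ∃ θ : ℝ → ℂ, j ∈ Finset.Ico 1 n → IsTest θ ∧
      ∀ k : ℝ, (Complex.I * k) ^ j * sharp (fun ξ => ψ ξ ^ n) k =
        sharp (fun ξ => θ ξ * ψ ξ ^ (n - j)) k := by
    intro j
    by_cases hj : j ∈ Finset.Ico 1 n
    · rw [Finset.mem_Ico] at hj
      obtain ⟨θ, h⟩ := exists_sharp_pow hψ hj.1 hj.2.le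
      exact ⟨θ, fun _ => h⟩
    · exact ⟨0, fun h => absurd h hj⟩
  choose θ hθ using hθ'
  have hK' : ∀ j, ∃ K : ℝ≥0, j ∈ Finset.Ico 1 n → ∀ (m : ℝ → ℝ) (h : ℝ → ℂ),
      Slow ((n - j) * 5) m → Measurable m → Measurable h →
      l2 (fun k => m k * conv (θ j) h k) ≤ K * l2 (fun k => m k * h k) := by
    intro j
    by_cases hj : j ∈ Finset.Ico 1 n
    · obtain ⟨K, hK⟩ := exists_l2_weight_conv_le (hθ j hj).1 ((n - j) * 5)
      exact ⟨K, fun _ => hK⟩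
    · exact ⟨0, fun h => absurd h hj⟩
  choose Kj hKj using hK'
  -- The exponent `n + 1` counts `n` powers from `(k - l)^n` and one from the bound on the Taylor
  -- remainder.
  obtain ⟨Kr, hKr⟩ := exists_l2_conv_le hχ (n + 1)
  refine ⟨(∑ j ∈ Finset.Ico 1 n, 2 ^ (j + 2) * Kj j) + Kr * 2 ^ (n + 2), fun ν m hA w hw => ?_⟩
  set S := ∑ j ∈ Finset.range n, l2 (fun k => (ν k ^ j : ℝ) * hat (loc ψ w j) k) with hS
  have hSj : ∀ j < n, l2 (fun k => (ν k ^ j : ℝ) * hat (loc ψ w j) k) ≤ S := fun j hj =>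
    Finset.single_le_sum (f := fun j => l2 (fun k => (ν k ^ j : ℝ) * hat (loc ψ w j) k))
      (fun _ _ => zero_le) (Finset.mem_range.2 hj)
  have hpos := hA.slow_base.pos
  have hmeasW : Measurable (hat w) := (continuous_hat hw).measurable
  have hquot : Measurable (fun k => m k / sell k) :=
    (hA.cont.div continuous_sell fun k => (sell_pos k).ne').measurable
  have hle : ∀ k, m k / sell k ≤ ν k ^ n := fun k => (div_le_iff₀ (sell_pos k)).2 (hA.le k)
  have hnn : ∀ k, 0 ≤ m k / sell k := fun k => (div_pos (hA.slow.pos k) (sell_pos k)).le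
  set g : ℕ → ℝ → ℂ := fun j k => (m k / sell k : ℝ) * (rhoCoeff j k * (-Complex.I) ^ j *
    conv (θ j) (hat (loc ψ w (n - j))) k) with hg
  set R : ℝ → ℂ := fun k => ((m k / sell k : ℝ) : ℂ) * (∫ l, sharp (fun ξ => ψ ξ ^ n) (k - l) *
      (((k - l : ℝ) : ℂ) ^ n * rhoRem n k l) * hat w l) with hR
  have hdecomp : ∀ k, ((m k / sell k : ℝ) : ℂ) * rhoComm (fun ξ => ψ ξ ^ n) (hat w) k =
      (∑ j ∈ Finset.Ico 1 n, g j k) + R k := by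
    intro k
    rw [rhoComm_eq hψ hw hn hθ k, mul_add, Finset.mul_sum]
  have hgmeas : ∀ j ∈ Finset.Ico 1 n, Measurable (g j) := by
    intro j hj
    refine (Complex.measurable_ofReal.comp hquot).mul (((continuous_rhoCoeff
      (Finset.mem_Ico.1 hj).1).measurable.mul_const _).mul ?_)
    exact measurable_conv (hθ j hj).1 (continuous_hat (integrable_loc hψ hw _)).measurable
  -- Measurability follows by difference from the expansion, so none is needed for the Taylor
  -- remainder itself.
  have hRmeas : Measurable R := by
    have : R = fun k => ((m k / sell k : ℝ) : ℂ) * rhoComm (fun ξ => ψ ξ ^ n) (hat w) k -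
        ∑ j ∈ Finset.Ico 1 n, g j k := by
      ext k; rw [hdecomp k]; ring
    rw [this]
    exact ((Complex.measurable_ofReal.comp hquot).mul (measurable_rhoComm hχ hmeasW)).sub
      (Finset.measurable_fun_sum _ hgmeas)
  have hgb : ∀ j ∈ Finset.Ico 1 n, l2 (g j) ≤ (2 ^ (j + 2) * Kj j : ℝ≥0) * S := by
    intro j hj
    obtain ⟨hj1, hjn⟩ := Finset.mem_Ico.1 hj
    have h1 : l2 (g j) ≤ ((2 ^ (j + 2) : ℝ≥0) : ℝ≥0∞) *
        l2 (fun k => (ν k ^ (n - j) : ℝ) * conv (θ j) (hat (loc ψ w (n - j))) k) := by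
      have := eLpNorm_le_nnreal_smul_eLpNorm_of_ae_le_mul (μ := volume) (p := 2) (f := g j)
        (g := fun k => ((ν k ^ (n - j) : ℝ) : ℂ) * conv (θ j) (hat (loc ψ w (n - j))) k)
        (c := 2 ^ (j + 2)) (Eventually.of_forall fun k => ?_)
      · simpa [ENNReal.smul_def] using this
      · rw [← NNReal.coe_le_coe]
        simp only [hg]
        push_cast
        rw [norm_mul, norm_mul, norm_mul, norm_mul, norm_pow, norm_neg, Complex.norm_I, one_pow,
          mul_one, norm_div, norm_pow, Complex.norm_real, Complex.norm_real, Complex.norm_real,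
          Real.norm_of_nonneg (hA.slow.pos k).le, Real.norm_of_nonneg (sell_pos k).le,
          Real.norm_of_nonneg (hpos k).le]
        -- The decay of the Taylor coefficient cancels `j` of the `n` powers of `ν`, by `ν ≤ jap`;
        -- the remaining weight `ν^{n-j}` matches the localization `ψ^{n-j}`.
        have h2 : ν k ^ n * (2 ^ (j + 2) / jap k ^ j) ≤ 2 ^ (j + 2) * ν k ^ (n - j) := by
          rw [mul_div_assoc', div_le_iff₀ (pow_pos (jap_pos k) j)]
          have h3 : ν k ^ n = ν k ^ (n - j) * ν k ^ j := by rw [← pow_add]; congr 1; omega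
          rw [h3]
          have h4 := pow_le_pow_left₀ (hpos k).le (hA.base_le k) j
          have h5 := pow_pos (hpos k) (n - j)
          have h6 : (0 : ℝ) < 2 ^ (j + 2) := by positivity
          calc ν k ^ (n - j) * ν k ^ j * 2 ^ (j + 2)
              ≤ ν k ^ (n - j) * jap k ^ j * 2 ^ (j + 2) := by gcongr
            _ = _ := by ring
        calc m k / sell k * (‖rhoCoeff j k‖ * ‖conv (θ j) (hat (loc ψ w (n - j))) k‖)
            ≤ ν k ^ n * ((2 ^ (j + 2) / jap k ^ j) *
                ‖conv (θ j) (hat (loc ψ w (n - j))) k‖) := by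
              have := pow_pos (hpos k) n
              gcongr
              · exact hle k
              · exact norm_rhoCoeff_le hj1 k
          _ = (ν k ^ n * (2 ^ (j + 2) / jap k ^ j)) *
                ‖conv (θ j) (hat (loc ψ w (n - j))) k‖ := by ring
          _ ≤ (2 ^ (j + 2) * ν k ^ (n - j)) * ‖conv (θ j) (hat (loc ψ w (n - j))) k‖ := by gcongr
          _ = _ := by ring
    have h2 := hKj j hj (fun k => ν k ^ (n - j)) (hat (loc ψ w (n - j)))
      (hA.slow_base.pow _) (hA.cont_base.pow _).measurable
      (continuous_hat (integrable_loc hψ hw _)).measurable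
    calc l2 (g j) ≤ ((2 ^ (j + 2) : ℝ≥0) : ℝ≥0∞) * (Kj j *
          l2 (fun k => ((ν k ^ (n - j) : ℝ) : ℂ) * hat (loc ψ w (n - j)) k)) :=
            h1.trans (by gcongr)
      _ ≤ ((2 ^ (j + 2) : ℝ≥0) : ℝ≥0∞) * (Kj j * S) := by
            gcongr
            exact hSj _ (by omega)
      _ = _ := by rw [ENNReal.coe_mul, mul_assoc]
  have hRb : l2 R ≤ (Kr * 2 ^ (n + 2) : ℝ≥0) * S := by
    have h1 := hKr (fun k l => ((m k / sell k : ℝ) : ℂ) * (((k - l : ℝ) : ℂ) ^ n * rhoRem n k l))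
      (fun _ => ((2 ^ (n + 2) : ℕ) : ℝ)) (hat w) measurable_const hmeasW fun k l => by
        rw [norm_mul, norm_mul, norm_pow, Complex.norm_real, Complex.norm_real,
          Real.norm_of_nonneg (hnn k), Real.norm_eq_abs]
        have h2 := jap_pos (k - l)
        have h3 := jap_pos k
        calc m k / sell k * (|k - l| ^ n * ‖rhoRem n k l‖)
            ≤ jap k ^ n * (jap (k - l) ^ n * (2 ^ (n + 2) * jap (k - l) / jap k ^ n)) := by
              gcongr
              · exact (hle k).trans (pow_le_pow_left₀ (hpos k).le (hA.base_le k) n)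
              · exact abs_le_jap _
              · exact norm_rhoRem_le hn k l
          _ = jap (k - l) ^ (n + 1) * ((2 ^ (n + 2) : ℕ) : ℝ) := by
              push_cast
              field_simp
              ring
    have e1 : R = fun k => ∫ l, sharp (fun ξ => ψ ξ ^ n) (k - l) *
        (((m k / sell k : ℝ) : ℂ) * (((k - l : ℝ) : ℂ) ^ n * rhoRem n k l)) * hat w l := by
      ext k
      simp only [hR]
      rw [← integral_const_mul]
      congr 1 with l
      ring
    rw [e1]
    refine h1.trans ?_
    have e2 : (fun l => (((2 ^ (n + 2) : ℕ) : ℝ) : ℂ) * hat w l) =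
        (((2 ^ (n + 2) : ℕ) : ℝ≥0) : ℂ) • hat w := by
      ext l
      simp
    -- The remainder has lost all positive order, so the term `j = 0` of the sum, the unweighted
    -- norm of `hat w`, bounds it.
    have h0 := hSj 0 (by omega)
    simp only [pow_zero, Complex.ofReal_one, one_mul, loc_zero] at h0
    unfold l2 at h0 ⊢
    rw [e2, eLpNorm_const_smul, enorm_natCast_complex, ENNReal.coe_mul, mul_assoc]
    push_cast
    gcongr
  have hfun : (fun k => ((m k / sell k : ℝ) : ℂ) * rhoComm (fun ξ => ψ ξ ^ n) (hat w) k) =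
      (∑ j ∈ Finset.Ico 1 n, g j) + R := by
    ext k
    rw [hdecomp k, Pi.add_apply, Finset.sum_apply]
  rw [hfun, ENNReal.coe_add, add_mul, ENNReal.ofNNReal_finsetSum, Finset.sum_mul]
  refine (eLpNorm_add_le (Finset.aestronglyMeasurable_sum _ fun j hj =>
    (hgmeas j hj).aestronglyMeasurable) hRmeas.aestronglyMeasurable (by norm_num)).trans ?_
  gcongr
  refine (eLpNorm_sum_le (fun j hj => (hgmeas j hj).aestronglyMeasurable) (by norm_num)).trans ?_
  exact Finset.sum_le_sum hgb

/-! ### The energy inequality -/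

/-- The `L²` norm, as a real number. -/
def nrm (f : ℝ → ℂ) : ℝ := (l2 f).toReal

lemma nrm_nonneg (f : ℝ → ℂ) : 0 ≤ nrm f := ENNReal.toReal_nonneg

lemma nrm_le_of_l2_le {f g : ℝ → ℂ} {K : ℝ≥0} (hg : MemLp g 2) (h : l2 f ≤ K * l2 g) :
    nrm f ≤ K * nrm g := by
  have := ENNReal.toReal_mono (ENNReal.mul_ne_top ENNReal.coe_ne_top hg.2.ne) h
  rwa [ENNReal.toReal_mul, ENNReal.coe_toReal] at this

lemma nrm_le_mul {f g : ℝ → ℂ} (hg : MemLp g 2) {c : ℝ} (hc : 0 ≤ c)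
    (h : ∀ k, ‖f k‖ ≤ c * ‖g k‖) : nrm f ≤ c * nrm g := by
  lift c to ℝ≥0 using hc
  exact nrm_le_of_l2_le hg (eLpNorm_le_nnreal_smul_eLpNorm_of_ae_le_mul
    (Eventually.of_forall fun k => by rw [← NNReal.coe_le_coe]; simpa using h k) 2)

lemma nrm_add_le {f g : ℝ → ℂ} (hf : MemLp f 2) (hg : MemLp g 2) :
    nrm (fun k => f k + g k) ≤ nrm f + nrm g := by
  have := ENNReal.toReal_mono (ENNReal.add_ne_top.2 ⟨hf.2.ne, hg.2.ne⟩)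
    (eLpNorm_add_le hf.1 hg.1 (by norm_num : (1 : ℝ≥0∞) ≤ 2))
  rwa [ENNReal.toReal_add hf.2.ne hg.2.ne] at this

lemma nrm_sq {f : ℝ → ℂ} (hf : MemLp f 2) : nrm f ^ 2 = ∫ k, ‖f k‖ ^ 2 := by
  have h1 := integral_mul_conj_self hf
  have h2 : ∀ k, f k * (starRingEnd ℂ) (f k) = ((‖f k‖ ^ 2 : ℝ) : ℂ) := fun k => by
    rw [Complex.mul_conj, Complex.normSq_eq_norm_sq]
  simp_rw [h2] at h1
  rw [integral_complex_ofReal] at h1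
  exact (Complex.ofReal_injective h1).symm

lemma memLp_of_decay {f : ℝ → ℂ} (hf : Measurable f) {C : ℝ} (h : ∀ k, ‖f k‖ ≤ C / jap k ^ 2) :
    MemLp f 2 := by
  rw [memLp_two_iff_integrable_sq_norm hf.aestronglyMeasurable]
  refine (integrable_inv_jap_sq.const_mul (C ^ 2)).mono' (hf.norm.pow_const 2).aestronglyMeasurable
    (Eventually.of_forall fun k => ?_)
  rw [Real.norm_of_nonneg (by positivity), mul_one_div]
  have h1 := one_le_jap k
  calc ‖f k‖ ^ 2 ≤ (C / jap k ^ 2) ^ 2 := pow_le_pow_left₀ (norm_nonneg _) (h k) 2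
    _ = C ^ 2 / (jap k ^ 2) ^ 2 := div_pow _ _ _
    _ ≤ C ^ 2 / jap k ^ 2 := by
      gcongr
      exact le_self_pow₀ h1 two_ne_zero

lemma sell_le_jap (k : ℝ) : sell k ≤ jap k := (sell_le_ell k).trans (ell_le_jap k)

/-! ### Integrability supplied by the decay of the truncated weights. -/

namespace Admissible

variable {n : ℕ} {ν m : ℝ → ℝ}

lemma bounded (hA : Admissible n ν m) : ∃ B, 0 ≤ B ∧ ∀ k, m k ≤ B / jap k ^ 2 ∧ m k ≤ B ∧
    m k * sell k ≤ B := by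
  obtain ⟨B, hB⟩ := hA.decay
  have h0 : 0 ≤ B := le_trans (mul_nonneg (hA.slow.pos 0).le (pow_nonneg (jap_pos 0).le 2)) (hB 0)
  refine ⟨B, h0, fun k => ?_⟩
  have h1 := one_le_jap k
  have h2 := hB k
  have h3 := hA.slow.pos k
  have h4 := sell_le_jap k
  refine ⟨by rwa [le_div_iff₀ (by positivity)], ?_, ?_⟩
  · refine le_trans ?_ h2
    exact le_mul_of_one_le_right h3.le (one_le_pow₀ h1)
  · refine le_trans ?_ h2
    gcongr
    nlinarith

lemma memLp_mul (hA : Admissible n ν m) {f : ℝ → ℂ} (hf : MemLp f 2) :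
    MemLp (fun k => (m k : ℂ) * f k) 2 := by
  obtain ⟨B, -, hB⟩ := hA.bounded
  exact memLp_mul_of_bound hA.cont.measurable
    (fun k => by rw [abs_of_pos (hA.slow.pos k)]; exact (hB k).2.1) hf

lemma memLp_mul_sell (hA : Admissible n ν m) {f : ℝ → ℂ} (hf : MemLp f 2) :
    MemLp (fun k => ((m k * sell k : ℝ) : ℂ) * f k) 2 := by
  obtain ⟨B, -, hB⟩ := hA.bounded
  exact memLp_mul_of_bound (hA.cont.mul continuous_sell).measurable
    (fun k => by rw [abs_of_pos (mul_pos (hA.slow.pos k) (sell_pos k))]; exact (hB k).2.2) hf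

lemma polyGrowth (hA : Admissible n ν m) : PolyGrowth (fun k => (m k : ℂ)) := by
  obtain ⟨B, -, hB⟩ := hA.bounded
  exact polyGrowth_of_bound hA.cont (fun k => (hA.slow.pos k).le) fun k => (hB k).2.1

/-- A function that is merely integrable has a bounded transform, and the `jap⁻²` decay of the
weight does the rest. This is what the truncation is for: `∂ₜ u` and the source come with no
weighted norm known to be finite. -/
lemma memLp_mul_hat (hA : Admissible n ν m) {m' : ℝ → ℝ} (hm' : Measurable m')
    (hle : ∀ k, |m' k| ≤ m k) {h : ℝ → ℂ} (hh : Integrable h) :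
    MemLp (fun k => (m' k : ℂ) * hat h k) 2 := by
  obtain ⟨B, hB0, hB⟩ := hA.bounded
  refine memLp_of_decay (C := B * (cpi * ∫ ξ, ‖h ξ‖))
    ((Complex.measurable_ofReal.comp hm').mul (continuous_hat hh).measurable) fun k => ?_
  rw [norm_mul, Complex.norm_real, Real.norm_eq_abs, mul_div_right_comm]
  have := jap_pos k
  exact mul_le_mul ((hle k).trans (hB k).1) (norm_hat_le h k) (norm_nonneg _) (by positivity)

lemma measurable_div_sell (hA : Admissible n ν m) : Measurable fun k => m k / sell k :=
  (hA.cont.div continuous_sell fun k => (sell_pos k).ne').measurable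

lemma measurable_div_jap (hA : Admissible n ν m) : Measurable fun k => m k / jap k :=
  (hA.cont.div continuous_jap fun k => (jap_pos k).ne').measurable

lemma div_le_self' (hA : Admissible n ν m) {a : ℝ} (ha : 1 ≤ a) (k : ℝ) : |m k / a| ≤ m k := by
  have := (hA.slow.pos k).le
  rw [abs_of_nonneg (by positivity)]
  exact div_le_self this ha

end Admissible

/-- Where `√ℓ ≥ 1/ε` the first term suffices pointwise. Elsewhere `jap k ≤ exp (1/ε²)`, and `m ≤ ν^n
√ℓ ≤ jap^n √ℓ` is bounded independently of the truncation. -/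
lemma exists_nrm_low_frequency_le (n : ℕ) {ε : ℝ} (hε : 0 < ε) :
    ∃ K, 0 ≤ K ∧ ∀ ν m, Admissible n ν m → ∀ f, MemLp f 2 →
      nrm (fun k => (m k : ℂ) * f k) ≤
        ε * nrm (fun k => ((m k * sell k : ℝ) : ℂ) * f k) + K * nrm f := by
  refine ⟨Real.exp (1 / ε ^ 2) ^ n * (1 / ε), by positivity, fun ν m hA f hf => ?_⟩
  set K := Real.exp (1 / ε ^ 2) ^ n * (1 / ε) with hK
  have hK0 : 0 ≤ K := by positivity
  have hfX := hA.memLp_mul_sell hf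
  have hpt : ∀ k, m k ≤ ε * (m k * sell k) + K := by
    intro k
    have hm := hA.slow.pos k
    have hs := sell_pos k
    rcases le_total (1 / ε) (sell k) with h | h
    · have h1 : 1 ≤ ε * sell k := by rwa [div_le_iff₀' hε] at h
      nlinarith
    · have h1 : jap k ≤ Real.exp (1 / ε ^ 2) := by
        rw [← Real.log_le_iff_le_exp (jap_pos k)]
        have h2 : ell k ≤ 1 / ε ^ 2 := by
          rw [← sell_sq, ← one_div_pow]
          exact pow_le_pow_left₀ hs.le h 2
        unfold ell at h2
        linarith
      have h3 : m k ≤ K := by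
        refine (hA.le k).trans ?_
        rw [hK]
        have h4 := hA.slow_base.pos k
        gcongr
        exact (hA.base_le k).trans h1
      have : 0 ≤ ε * (m k * sell k) := by positivity
      linarith
  have h1 : MemLp (fun k => (ε : ℂ) * (((m k * sell k : ℝ) : ℂ) * f k)) 2 := hfX.const_mul _
  have h2 : MemLp (fun k => (K : ℂ) * f k) 2 := hf.const_mul _
  have h3 : nrm (fun k => (m k : ℂ) * f k) ≤
      1 * nrm (fun k => (ε : ℂ) * (((m k * sell k : ℝ) : ℂ) * f k) + (K : ℂ) * f k) := by
    refine nrm_le_mul (h1.add h2) zero_le_one fun k => ?_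
    change _ ≤ 1 * ‖(ε : ℂ) * (((m k * sell k : ℝ) : ℂ) * f k) + (K : ℂ) * f k‖
    have e : (ε : ℂ) * (((m k * sell k : ℝ) : ℂ) * f k) + (K : ℂ) * f k =
        ((ε * (m k * sell k) + K : ℝ) : ℂ) * f k := by push_cast; ring
    have hp := hpt k
    have hm := (hA.slow.pos k).le
    rw [e, norm_mul, norm_mul, Complex.norm_real, Complex.norm_real, one_mul,
      Real.norm_of_nonneg hm, Real.norm_of_nonneg (hm.trans hp)]
    exact mul_le_mul_of_nonneg_right hp (norm_nonneg _)
  have h4 := nrm_add_le h1 h2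
  have h5 : nrm (fun k => (ε : ℂ) * (((m k * sell k : ℝ) : ℂ) * f k)) ≤
      ε * nrm (fun k => ((m k * sell k : ℝ) : ℂ) * f k) :=
    nrm_le_mul hfX hε.le fun k => by rw [norm_mul, Complex.norm_real, Real.norm_of_nonneg hε.le]
  have h6 : nrm (fun k => (K : ℂ) * f k) ≤ K * nrm f :=
    nrm_le_mul hf hK0 fun k => by rw [norm_mul, Complex.norm_real, Real.norm_of_nonneg hK0]
  linarith

/-- Young's inequality. The dissipation contributes `-x²`; the errors use `x²/256`, `x²/4`, `3x²/16`
and `x²/8`, whose sum is less than `x²`. The threshold `1/(32 L)` for `u` is chosen so that the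
product with the bound `L (x + t)` costs only `x²/32`. -/
lemma absorb {L K' : ℝ} (hL : 1 ≤ L) {x t c₁ c₂ c₅ u P : ℝ} (hx : 0 ≤ x) (ht : 0 ≤ t)
    (hu0 : 0 ≤ u) (h1 : c₁ ≤ x / 16 + L * t) (h2 : c₂ ≤ L * t)
    (h5 : c₅ ≤ L * (x + t)) (hu : u ≤ 1 / (32 * L) * x + K' * t)
    (hP : P ≤ x ^ 2 / 8) :
    2 * (-(x ^ 2 / 2 - u ^ 2) + c₁ * x + c₂ * x + c₅ * u) + P ≤
      (4 * K' ^ 2 + 32 * L ^ 2 + 8 * (L * K' + 1) ^ 2 + 2 * L * K') * t ^ 2 := by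
  have hL0 : 0 < L := by linarith
  have hε : 1 / (32 * L) ≤ 1 / 32 := by
    apply one_div_le_one_div_of_le <;> linarith
  have hε0 : 0 < 1 / (32 * L) := by positivity
  have hLε : L * (1 / (32 * L)) = 1 / 32 := by field_simp
  set ε := 1 / (32 * L) with hεdef
  have b1 : 2 * u ^ 2 ≤ x ^ 2 / 256 + 4 * K' ^ 2 * t ^ 2 := by
    have h3 : u ^ 2 ≤ (ε * x + K' * t) ^ 2 := pow_le_pow_left₀ hu0 hu 2
    have h4 : (ε * x + K' * t) ^ 2 ≤ 2 * (ε * x) ^ 2 + 2 * (K' * t) ^ 2 := by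
      nlinarith [sq_nonneg (ε * x - K' * t)]
    have h6 : (ε * x) ^ 2 ≤ (1 / 32 * x) ^ 2 := pow_le_pow_left₀ (by positivity) (by gcongr) 2
    nlinarith
  have b2 : 2 * (c₁ * x + c₂ * x) ≤ x ^ 2 / 4 + 32 * L ^ 2 * t ^ 2 := by
    have h3 : c₁ * x ≤ (x / 16 + L * t) * x := mul_le_mul_of_nonneg_right h1 hx
    have h4 : c₂ * x ≤ L * t * x := mul_le_mul_of_nonneg_right h2 hx
    nlinarith [sq_nonneg (x - 16 * (L * t))]
  have b3 : 2 * (c₅ * u) ≤ 3 * x ^ 2 / 16 + 8 * (L * K' + 1) ^ 2 * t ^ 2 + 2 * L * K' * t ^ 2 := by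
    have h3 : c₅ * u ≤ L * (x + t) * (ε * x + K' * t) := by
      refine (mul_le_mul_of_nonneg_right h5 hu0).trans ?_
      exact mul_le_mul_of_nonneg_left hu (by positivity)
    have h4 : L * (x + t) * (ε * x + K' * t) =
        1 / 32 * x ^ 2 + (L * K' + 1 / 32) * (x * t) + L * K' * t ^ 2 := by
      rw [← hLε]; ring
    have h6 : (L * K' + 1 / 32) * (x * t) ≤ (L * K' + 1) * (x * t) := by
      have : 0 ≤ x * t := by positivity
      nlinarith
    have h7 : 2 * ((L * K' + 1) * (x * t)) ≤ x ^ 2 / 8 + 8 * (L * K' + 1) ^ 2 * t ^ 2 := by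
      nlinarith [sq_nonneg (x - 8 * ((L * K' + 1) * t))]
    nlinarith
  nlinarith [sq_nonneg x]

/-- The factors `sell` cancel, leaving `μ² |u|² Re ρ₀`, to which the coercivity of `ρ₀` applies.
They are split this way so that the error terms on the left need only the weaker weight `μ / sell`.
-/
lemma dissipation_pointwise {μ k : ℝ} (hμ : 0 < μ) (u : ℂ) :
    ‖((μ * sell k : ℝ) : ℂ) * u‖ ^ 2 / 2 - ‖(μ : ℂ) * u‖ ^ 2 ≤
      (((μ / sell k : ℝ) : ℂ) * (rho0 k * u) *
        (starRingEnd ℂ) (((μ * sell k : ℝ) : ℂ) * u)).re := by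
  have hs0 := sell_pos k
  have hs : (sell k : ℂ) ≠ 0 := by exact_mod_cast hs0.ne'
  have h2 : ((μ / sell k : ℝ) : ℂ) * (rho0 k * u) *
      (starRingEnd ℂ) (((μ * sell k : ℝ) : ℂ) * u) = ((μ ^ 2 * ‖u‖ ^ 2 : ℝ) : ℂ) * rho0 k := by
    have h3 : u * (starRingEnd ℂ) u = ((‖u‖ ^ 2 : ℝ) : ℂ) := by
      rw [Complex.mul_conj, Complex.normSq_eq_norm_sq]
    rw [map_mul, Complex.conj_ofReal]
    push_cast at h3 ⊢
    rw [← h3]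
    field_simp
  have h4 : ‖((μ * sell k : ℝ) : ℂ) * u‖ ^ 2 = μ ^ 2 * ‖u‖ ^ 2 * ell k := by
    rw [norm_mul, Complex.norm_real, Real.norm_of_nonneg (by positivity), ← sell_sq]
    ring
  have h5 : ‖(μ : ℂ) * u‖ ^ 2 = μ ^ 2 * ‖u‖ ^ 2 := by
    rw [norm_mul, Complex.norm_real, Real.norm_of_nonneg hμ.le]
    ring
  rw [h2, Complex.re_ofReal_mul, h4, h5]
  have h6 := mul_le_mul_of_nonneg_left (ell_div_two_sub_one_le_re_rho0 k)
    (by positivity : 0 ≤ μ ^ 2 * ‖u‖ ^ 2)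
  linarith

lemma pairing_pointwise {μ k : ℝ} (u r p q c : ℂ) :
    (μ * (-(r * u) + p + q) - c) * (starRingEnd ℂ) (μ * u) =
      -(((μ / sell k : ℝ) : ℂ) * (r * u) * (starRingEnd ℂ) (((μ * sell k : ℝ) : ℂ) * u)) +
        ((μ / sell k : ℝ) : ℂ) * p * (starRingEnd ℂ) (((μ * sell k : ℝ) : ℂ) * u) +
        ((μ / sell k : ℝ) : ℂ) * q * (starRingEnd ℂ) (((μ * sell k : ℝ) : ℂ) * u) -
        c * (starRingEnd ℂ) (μ * u) := by
  have hs : (sell k : ℂ) ≠ 0 := by exact_mod_cast (sell_pos k).ne'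
  have h : ((μ / sell k : ℝ) : ℂ) * ((μ * sell k : ℝ) : ℂ) = (μ : ℂ) * μ := by
    push_cast
    field_simp
  simp only [map_mul, Complex.conj_ofReal]
  linear_combination ((r * u) - p - q) * (starRingEnd ℂ) u * h

lemma energy_bookkeeping {d₁ d₂ d₃ d₅ x u c₁ c₂ c₅ A B Q y z : ℝ} (h₃ : x ^ 2 / 2 - u ^ 2 ≤ d₃)
    (h₁ : d₁ ≤ c₁ * x) (h₂ : d₂ ≤ c₂ * x) (h₅ : -(c₅ * u) ≤ d₅)
    (h : 2 * (-(x ^ 2 / 2 - u ^ 2) + c₁ * x + c₂ * x + c₅ * u) + (A + B) ≤ Q * (y + z) ^ 2)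
    (hQ : 0 ≤ Q) : 2 * (-d₃ + d₁ + d₂ - d₅) + A + B ≤ 2 * Q * (y ^ 2 + z ^ 2) := by
  have h1 : Q * (y + z) ^ 2 ≤ Q * (2 * (y ^ 2 + z ^ 2)) :=
    mul_le_mul_of_nonneg_left (by linarith [sq_nonneg (y - z)]) hQ
  linarith

set_option maxHeartbeats 1000000 in
/-- The differential inequality for the energy, at a fixed time and in Fourier space. -/
theorem exists_energy_inequality {ψ a b : ℝ → ℂ} (hψ : IsTest ψ)
    (hreal : ∀ ξ, (starRingEnd ℂ) (ψ ξ) = ψ ξ) (ha : IsTest a) (hb : IsTest b) {n : ℕ} (hn : 1 ≤ n) :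
    ∃ c K : ℝ, 0 < c ∧ 0 ≤ K ∧ ∀ ν m, Admissible n ν m → ∀ w h q : ℝ → ℂ, Integrable w →
      Integrable h → Integrable q → MemLp (hat w) 2 →
      (∀ k, conv b (hat h) k =
        -conv (fun ξ => ψ ξ ^ n) (fun l => rho0 l * hat w l) k + conv b (hat q) k) →
      hat h = conv a (conv b (hat h)) →
      2 * (∫ k, conv b (fun l => m l * hat h l) k *
          (starRingEnd ℂ) (m k * hat (loc ψ w n) k)).re +
        c * nrm (fun k => (m k * sell k : ℝ) * hat (loc ψ w n) k) ^ 2 +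
        c * (∫ k, conv b (fun l => m l * hat (loc ψ w n) l) k *
          (starRingEnd ℂ) (m k * hat (loc ψ w n) k)).re ≤
      K * (nrm (hat w) ^ 2 + nrm (fun k => (m k / sell k : ℝ) * hat q k) ^ 2) := by
  have hχ : IsTest (fun ξ => ψ ξ ^ n) := hψ.pow hn
  obtain ⟨Kc, hKc⟩ := exists_l2_rhoComm_le hψ hn
  -- At most `n` localizations enter, multiplied by `Kc`; this `ε` makes their total contribution at
  -- most `x / 16`.
  obtain ⟨K0, hK0, hloc⟩ := exists_l2_loc_le hψ hreal n (ε := 1 / (16 * (Kc * n + 1))) (by positivity)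
  obtain ⟨K2, hK2⟩ := exists_l2_weight_conv_le hb (n * 5 + 1 + 1)
  obtain ⟨K5, hK5⟩ := exists_l2_commutator_le hb (n * 5 + 1)
  -- The equation controls only `b ∂ₜ u`; multiplication by `a`, the inverse of `b` on the support,
  -- recovers `∂ₜ u` in the commutator bound.
  obtain ⟨Ka, hKa⟩ := exists_l2_weight_conv_le ha (n * 5 + 1 + 1)
  obtain ⟨Kx, hKx⟩ := exists_l2_conv_le' hχ
  obtain ⟨Kb, hKb⟩ := exists_l2_conv_le' hb
  set K1 : ℝ := Kc * n * K0 with hK1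
  -- One constant dominating the bounds for the localization commutator, the source and the
  -- commutator of `m` with `b`.
  set L : ℝ := 1 + K1 + K2 + K5 * Ka * (3 + K1 + K2) with hLdef
  have hK1nn : 0 ≤ K1 := by positivity
  have hL : 1 ≤ L := by
    have : (0 : ℝ) ≤ K5 * Ka * (3 + K1 + K2) := by positivity
    have := K2.2
    simp only [hLdef]
    linarith
  obtain ⟨K6, hK6, hlow⟩ := exists_nrm_low_frequency_le n (ε := 1 / (32 * L)) (by positivity)
  set K' : ℝ := K6 * Kx with hK'
  -- With the energy at most `Kb x²`, this `c` makes the retained terms `c x²` and `c E` together at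
  -- most `x²/8`.
  refine ⟨1 / (8 * (1 + Kb)), 2 * (4 * K' ^ 2 + 32 * L ^ 2 + 8 * (L * K' + 1) ^ 2 + 2 * L * K'),
    by positivity, by positivity, ?_⟩
  intro ν m hA w h q hw hh hq hw2 hF hG
  have hUeq : hat (loc ψ w n) = conv (fun ξ => ψ ξ ^ n) (hat w) := hat_mul' hχ hw
  set W := hat w with hWdef
  set U := hat (loc ψ w n) with hUdef
  set V := hat h with hVdef
  set c := 1 / (8 * (1 + (Kb : ℝ))) with hc
  have hWm : Measurable W := (continuous_hat hw).measurable
  have hUm : Measurable U := (continuous_hat (integrable_loc hψ hw n)).measurable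
  have hVm : Measurable V := (continuous_hat hh).measurable
  have hqm : Measurable (hat q) := (continuous_hat hq).measurable
  have hUL : MemLp U 2 := memLp_hat_loc hψ hw hw2 n
  have hmm : Measurable m := hA.cont.measurable
  have hmc : Measurable (fun k => (m k : ℂ)) := Complex.measurable_ofReal.comp hmm
  set fU : ℝ → ℂ := fun k => (m k : ℂ) * U k with hfU
  set fX : ℝ → ℂ := fun k => ((m k * sell k : ℝ) : ℂ) * U k with hfX
  set H : ℝ → ℂ := conv b V with hH
  set c1 : ℝ → ℂ := fun k => ((m k / sell k : ℝ) : ℂ) * rhoComm (fun ξ => ψ ξ ^ n) W k with hc1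
  set c2 : ℝ → ℂ := fun k => ((m k / sell k : ℝ) : ℂ) * conv b (hat q) k with hc2
  set c3 : ℝ → ℂ := fun k => ((m k / sell k : ℝ) : ℂ) * (rho0 k * U k) with hc3
  set c4 : ℝ → ℂ := fun k => ((m k / sell k : ℝ) : ℂ) * H k with hc4
  set c5 : ℝ → ℂ := commutator b m V with hc5
  have hHeq : ∀ k, H k = -(rho0 k * U k) + rhoComm (fun ξ => ψ ξ ^ n) W k + conv b (hat q) k := by
    intro k
    rw [hF k, hUeq, rhoComm]
    ring
  have hc4eq : ∀ k, c4 k = -c3 k + c1 k + c2 k := fun k => by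
    simp only [hc4, hc3, hc1, hc2, hHeq k]; ring
  have hdivm : Measurable (fun k => ((m k / sell k : ℝ) : ℂ)) :=
    Complex.measurable_ofReal.comp hA.measurable_div_sell
  have hHm : Measurable H := measurable_conv hb hVm
  -- membership in `L²`
  have hfUL : MemLp fU 2 := hA.memLp_mul hUL
  have hfXL : MemLp fX 2 := hA.memLp_mul_sell hUL
  have hfUm : Measurable fU := hmc.mul hUm
  have hfXm : Measurable fX :=
    (Complex.measurable_ofReal.comp (hmm.mul continuous_sell.measurable)).mul hUm
  have hzL : MemLp (fun k => ((m k / sell k : ℝ) : ℂ) * hat q k) 2 :=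
    hA.memLp_mul_hat hA.measurable_div_sell (fun k => hA.div_le_self' (one_le_sell k) k) hq
  have hslowdiv : Slow (n * 5 + 1 + 1) (fun k => m k / sell k) := by
    simp_rw [div_eq_mul_inv]
    exact hA.slow.mul slow_sell.inv
  have hslowdivJ : Slow (n * 5 + 1 + 1) (fun k => m k / jap k) := by
    simp_rw [div_eq_mul_inv]
    exact hA.slow.mul slow_jap.inv
  have hAj : ∀ j, MemLp (fun k => ((ν k ^ j : ℝ) : ℂ) * hat (loc ψ w j) k) 2 := fun j => by
    obtain ⟨B, hB⟩ := hA.base_bdd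
    exact memLp_mul_of_bound (m := fun k => ν k ^ j) (B := B ^ j) (hA.cont_base.pow j).measurable
      (fun k => by
        have := hA.slow_base.pos k
        rw [abs_of_pos (pow_pos this j)]
        exact pow_le_pow_left₀ this.le (hB k) j) (memLp_hat_loc hψ hw hw2 j)
  have hsumfin : ∑ j ∈ Finset.range n, l2 (fun k => ((ν k ^ j : ℝ) : ℂ) * hat (loc ψ w j) k) ≠ ⊤ :=
    (ENNReal.sum_ne_top).2 fun j _ => (hAj j).2.ne
  have hc1m : Measurable c1 := hdivm.mul (measurable_rhoComm hχ hWm)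
  have hc1b := hKc ν m hA w hw
  have hc1L : MemLp c1 2 := ⟨hc1m.aestronglyMeasurable, hc1b.trans_lt
    (ENNReal.mul_lt_top ENNReal.coe_lt_top hsumfin.lt_top)⟩
  have hc2m : Measurable c2 := hdivm.mul (measurable_conv hb hqm)
  have hc2b := hK2 (fun k => m k / sell k) (hat q) hslowdiv hA.measurable_div_sell hqm
  have hc2L : MemLp c2 2 := ⟨hc2m.aestronglyMeasurable, hc2b.trans_lt
    (ENNReal.mul_lt_top ENNReal.coe_lt_top hzL.2)⟩
  have hc3m : Measurable c3 := hdivm.mul (continuous_rho0.measurable.mul hUm)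
  have hc3b : ∀ k, ‖c3 k‖ ≤ 2 * ‖fX k‖ := by
    intro k
    have hm0 := (hA.slow.pos k).le
    have hs0 := sell_pos k
    simp only [hc3, hfX]
    rw [norm_mul, norm_mul, norm_mul, Complex.norm_real, Complex.norm_real,
      Real.norm_of_nonneg (by positivity), Real.norm_of_nonneg (by positivity)]
    calc m k / sell k * (‖rho0 k‖ * ‖U k‖) ≤ m k / sell k * ((2 * sell k ^ 2) * ‖U k‖) := by
          gcongr
          rw [sell_sq]
          exact norm_rho0_le k
      _ = 2 * (m k * sell k * ‖U k‖) := by field_simp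
  have hc3L : MemLp c3 2 :=
    hfXL.of_le_mul hc3m.aestronglyMeasurable (Eventually.of_forall hc3b)
  have hc4L : MemLp c4 2 := by
    have := (hc3L.neg.add hc1L).add hc2L
    exact this.congr_norm (hdivm.mul hHm).aestronglyMeasurable
      (Eventually.of_forall fun k => by rw [hc4eq k]; rfl)
  have hVJ : MemLp (fun k => ((m k / jap k : ℝ) : ℂ) * V k) 2 :=
    hA.memLp_mul_hat hA.measurable_div_jap (fun k => hA.div_le_self' (one_le_jap k) k) hh
  have hc5b := hK5 m V hA.slow hA.polyGrowth hmm (polyGrowth_hat hh)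
  have hc5m : Measurable c5 := measurable_commutator hb hmm hVm
  have hc5L : MemLp c5 2 := ⟨hc5m.aestronglyMeasurable, hc5b.trans_lt
    (ENNReal.mul_lt_top ENNReal.coe_lt_top hVJ.2)⟩
  -- real norms
  set x := nrm fX with hx
  set y := nrm W with hy
  set z := nrm (fun k => ((m k / sell k : ℝ) : ℂ) * hat q k) with hz
  have hx0 : 0 ≤ x := nrm_nonneg _
  have hy0 : 0 ≤ y := nrm_nonneg _
  have hz0 : 0 ≤ z := nrm_nonneg _
  have hAn : nrm (fun k => ((ν k ^ n : ℝ) : ℂ) * U k) ≤ 1 * x := by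
    refine nrm_le_mul hfXL zero_le_one fun k => ?_
    have := hA.slow_base.pos k
    have h2 := mul_pos (hA.slow.pos k) (sell_pos k)
    simp only [hfX]
    rw [norm_mul, norm_mul, Complex.norm_real, Complex.norm_real, one_mul,
      Real.norm_of_nonneg (by positivity), Real.norm_of_nonneg h2.le]
    exact mul_le_mul_of_nonneg_right (hA.ge k) (norm_nonneg _)
  have e1 : nrm c1 ≤ x / 16 + K1 * y := by
    have h1 := ENNReal.toReal_mono (ENNReal.mul_ne_top ENNReal.coe_ne_top hsumfin) hc1b
    rw [ENNReal.toReal_mul, ENNReal.coe_toReal, ENNReal.toReal_sum fun j _ => (hAj j).2.ne] at h1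
    have h2 : ∑ j ∈ Finset.range n,
        (l2 (fun k => ((ν k ^ j : ℝ) : ℂ) * hat (loc ψ w j) k)).toReal ≤
        ∑ j ∈ Finset.range n, (1 / (16 * (Kc * n + 1)) * x + K0 * y) := by
      refine Finset.sum_le_sum fun j hj => ?_
      refine (hloc ν m hA w hw hw2 j (Finset.mem_range.1 hj)).trans ?_
      rw [one_mul] at hAn
      exact add_le_add_left (mul_le_mul_of_nonneg_left hAn (by positivity)) _
    rw [Finset.sum_const, Finset.card_range, nsmul_eq_mul] at h2
    calc nrm c1 ≤ Kc * (n * (1 / (16 * (Kc * n + 1)) * x + K0 * y)) :=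
          h1.trans (by gcongr)
      _ = (Kc * n) / (Kc * n + 1) * (x / 16) + K1 * y := by
          rw [hK1]
          field_simp
      _ ≤ 1 * (x / 16) + K1 * y := by
          gcongr
          rw [div_le_one (by positivity)]
          linarith
      _ = _ := by rw [one_mul]
  have e2 : nrm c2 ≤ K2 * z := nrm_le_of_l2_le hzL hc2b
  have e3 : nrm c3 ≤ 2 * x := nrm_le_mul hfXL two_pos.le hc3b
  have e4 : nrm c4 ≤ 3 * x + K1 * y + K2 * z := by
    have h1 : nrm c4 ≤ nrm (fun k => -c3 k + c1 k) + nrm c2 := by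
      rw [funext hc4eq]
      exact nrm_add_le (hc3L.neg.add hc1L) hc2L
    have h2 : nrm (fun k => -c3 k + c1 k) ≤ nrm (fun k => -c3 k) + nrm c1 :=
      nrm_add_le hc3L.neg hc1L
    have h3 : nrm (fun k => -c3 k) ≤ 1 * nrm c3 :=
      nrm_le_mul hc3L zero_le_one fun k => by rw [norm_neg, one_mul]
    linarith
  have e5 : nrm c5 ≤ K5 * Ka * (3 * x + K1 * y + K2 * z) := by
    have h1 : nrm c5 ≤ K5 * nrm (fun k => ((m k / jap k : ℝ) : ℂ) * V k) := nrm_le_of_l2_le hVJ hc5b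
    have hHJb : ∀ k, ‖((m k / jap k : ℝ) : ℂ) * H k‖ ≤ 1 * ‖c4 k‖ := by
      intro k
      have hm0 := (hA.slow.pos k).le
      have hs0 := sell_pos k
      have hj0 := jap_pos k
      simp only [hc4]
      rw [norm_mul, norm_mul, Complex.norm_real, Complex.norm_real, one_mul,
        Real.norm_of_nonneg (by positivity), Real.norm_of_nonneg (by positivity)]
      gcongr
      exact sell_le_jap k
    have hHJ : MemLp (fun k => ((m k / jap k : ℝ) : ℂ) * H k) 2 :=
      hc4L.of_le_mul ((Complex.measurable_ofReal.comp hA.measurable_div_jap).mul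
        hHm).aestronglyMeasurable (Eventually.of_forall hHJb)
    -- Weighted boundedness of multiplication by `a` passes from `∂ₜ u` to `b ∂ₜ u`. As `sell ≤
    -- jap`, the order gained by the commutator more than covers the logarithmic growth of `ρ₀`.
    have h2 : nrm (fun k => ((m k / jap k : ℝ) : ℂ) * V k) ≤
        Ka * nrm (fun k => ((m k / jap k : ℝ) : ℂ) * H k) := by
      rw [hG]
      exact nrm_le_of_l2_le hHJ (hKa (fun k => m k / jap k) H hslowdivJ hA.measurable_div_jap hHm)
    have h3 := nrm_le_mul hc4L zero_le_one hHJb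
    rw [one_mul] at h3
    calc nrm c5 ≤ K5 * (Ka * (3 * x + K1 * y + K2 * z)) := by
          refine h1.trans ?_
          gcongr
          refine h2.trans ?_
          gcongr
          exact h3.trans e4
      _ = _ := by ring
  have e6 : nrm fU ≤ 1 / (32 * L) * x + K' * y := by
    refine (hlow ν m hA U hUL).trans ?_
    rw [hK', mul_assoc]
    refine add_le_add_right (mul_le_mul_of_nonneg_left ?_ hK6) _
    · rw [hUeq]
      exact nrm_le_of_l2_le hw2 (hKx W hWm)
  have e7 : nrm fU ≤ x := by
    rw [← one_mul x]
    refine nrm_le_mul hfXL zero_le_one fun k => ?_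
    have hm0 := (hA.slow.pos k).le
    have hs0 := sell_pos k
    simp only [hfX, hfU]
    rw [norm_mul, norm_mul, Complex.norm_real, Complex.norm_real, one_mul,
      Real.norm_of_nonneg hm0, Real.norm_of_nonneg (by positivity)]
    gcongr
    exact le_mul_of_one_le_right hm0 (one_le_sell k)
  -- the pairing
  have hconvm : MemLp (conv b (fun l => m l * V l)) 2 := by
    refine memLp_conv hb ?_ (hmc.mul hVm)
    exact hA.memLp_mul_hat hmm (fun k => (abs_of_pos (hA.slow.pos k)).le) hh
  have hpair : ∫ k, conv b (fun l => m l * V l) k * (starRingEnd ℂ) (m k * U k) =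
      -(∫ k, c3 k * (starRingEnd ℂ) (fX k)) + (∫ k, c1 k * (starRingEnd ℂ) (fX k)) +
        (∫ k, c2 k * (starRingEnd ℂ) (fX k)) - ∫ k, c5 k * (starRingEnd ℂ) (fU k) := by
    rw [← integral_neg, ← integral_add, ← integral_add, ← integral_sub]
    · congr 1 with k
      -- The weight is taken outside the multiplication by `b`, since the equation is known for `b
      -- ∂ₜ u` and not for `b m(D) ∂ₜ u`.
      have hcv : conv b (fun l => (m l : ℂ) * V l) k = m k * H k - c5 k := by
        rw [hc5, commutator]; ring
      rw [hcv, hHeq k]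
      exact pairing_pointwise _ _ _ _ _
    · exact ((integrable_mul_conj hc3L hfXL).neg.add (integrable_mul_conj hc1L hfXL)).add
        (integrable_mul_conj hc2L hfXL)
    · exact integrable_mul_conj hc5L hfUL
    · exact (integrable_mul_conj hc3L hfXL).neg.add (integrable_mul_conj hc1L hfXL)
    · exact integrable_mul_conj hc2L hfXL
    · exact (integrable_mul_conj hc3L hfXL).neg
    · exact integrable_mul_conj hc1L hfXL
  have hdiss : x ^ 2 / 2 - nrm fU ^ 2 ≤ (∫ k, c3 k * (starRingEnd ℂ) (fX k)).re := by
    have hint := integrable_mul_conj hc3L hfXL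
    have h1 : (∫ k, c3 k * (starRingEnd ℂ) (fX k)).re = ∫ k, (c3 k * (starRingEnd ℂ) (fX k)).re :=
      (integral_re (𝕜 := ℂ) hint).symm
    have hi1 : Integrable fun k => ‖fX k‖ ^ 2 := hfXL.integrable_norm_pow two_ne_zero
    have hi2 : Integrable fun k => ‖fU k‖ ^ 2 := hfUL.integrable_norm_pow two_ne_zero
    rw [h1, hx, nrm_sq hfXL, nrm_sq hfUL, ← integral_div, ← integral_sub (hi1.div_const 2) hi2]
    refine integral_mono ((hi1.div_const 2).sub hi2) hint.re fun k => ?_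
    exact dissipation_pointwise (hA.slow.pos k) (U k)
  have hcs : ∀ {f g : ℝ → ℂ}, MemLp f 2 → MemLp g 2 → Measurable f → Measurable g →
      |(∫ k, f k * (starRingEnd ℂ) (g k)).re| ≤ nrm f * nrm g := fun hf hg hf' hg' =>
    (Complex.abs_re_le_norm _).trans (norm_integral_mul_conj_le hf hg hf' hg')
  have hP1 := (abs_le.1 (hcs hc1L hfXL hc1m hfXm)).2
  have hP2 := (abs_le.1 (hcs hc2L hfXL hc2m hfXm)).2
  have hP5 := (abs_le.1 (hcs hc5L hfUL hc5m hfUm)).1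
  have hE : (∫ k, conv b fU k * (starRingEnd ℂ) (fU k)).re ≤ Kb * x ^ 2 := by
    refine (le_abs_self _).trans ((hcs (memLp_conv hb hfUL hfUm) hfUL (measurable_conv hb hfUm)
      hfUm).trans ?_)
    have h1 : nrm (conv b fU) ≤ Kb * nrm fU := nrm_le_of_l2_le hfUL (hKb fU hfUm)
    have h0 := nrm_nonneg fU
    calc nrm (conv b fU) * nrm fU ≤ (Kb * x) * x := by
          gcongr
          exact h1.trans (by gcongr)
      _ = _ := by ring
  have hc0 : 0 < c := by positivity
  have hPfin : c * x ^ 2 + c * (∫ k, conv b fU k * (starRingEnd ℂ) (fU k)).re ≤ x ^ 2 / 8 := by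
    calc _ ≤ c * x ^ 2 + c * (Kb * x ^ 2) := by gcongr
      _ = x ^ 2 / 8 := by rw [hc]; field_simp
  have ht0 : 0 ≤ y + z := by linarith
  have hK2' := K2.coe_nonneg
  have hKK : (0 : ℝ) ≤ K5 * Ka := by positivity
  have hKK3 : (0 : ℝ) ≤ K5 * Ka * (3 + K1 + K2) := by positivity
  have hL1 : K1 ≤ L := by simp only [hLdef]; linarith
  have hL2 : (K2 : ℝ) ≤ L := by simp only [hLdef]; linarith
  have hL5 : K5 * Ka * (3 + K1 + K2) ≤ L := by simp only [hLdef]; linarith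
  have hK'0 : 0 ≤ K' := by positivity
  have habs := absorb hL hx0 ht0 (nrm_nonneg fU)
    (c₁ := nrm c1) (c₂ := nrm c2) (c₅ := nrm c5)
    (e1.trans (by
      have : K1 * y ≤ L * (y + z) := mul_le_mul hL1 (by linarith) hy0 (by linarith)
      linarith))
    (e2.trans (mul_le_mul hL2 (by linarith) hz0 (by linarith)))
    (e5.trans (by
      refine le_trans ?_ (mul_le_mul_of_nonneg_right hL5 (add_nonneg hx0 ht0))
      rw [mul_assoc (_ * _ : ℝ) (3 + K1 + _)]
      refine mul_le_mul_of_nonneg_left ?_ hKK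
      have p1 := mul_nonneg hK1nn hx0
      have p2 := mul_nonneg hK1nn hz0
      have p3 := mul_nonneg hK2' hx0
      have p4 := mul_nonneg hK2' hy0
      linarith))
    (e6.trans (by
      exact add_le_add_right (mul_le_mul_of_nonneg_left (by linarith) hK'0) _)) hPfin
  rw [hpair]
  simp only [Complex.add_re, Complex.sub_re, Complex.neg_re]
  exact energy_bookkeeping hdiss hP1 hP2 hP5 habs (by positivity)

/-! ### The energy identity in time -/

/-- The primitive of an integrable function is absolutely continuous with derivative `f` almost
everywhere, so the product rule for absolutely continuous functions integrates its square. -/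
lemma sq_setIntegral {f : ℝ → ℝ} (hf : Integrable f) {t : ℝ} (ht : 0 ≤ t) :
    (∫ s in Ioc 0 t, f s) ^ 2 = ∫ s in Ioc 0 t, 2 * (f s * ∫ r in Ioc 0 s, f r) := by
  have hac := (hf.intervalIntegrable (a := 0) (b := t)).absolutelyContinuousOnInterval_intervalIntegral
    (c := 0) left_mem_uIcc
  have h := hac.integral_deriv_mul_eq_sub hac
  simp only [intervalIntegral.integral_same, mul_zero, sub_zero] at h
  rw [← intervalIntegral.integral_of_le ht, sq, ← h, ← intervalIntegral.integral_of_le ht]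
  refine intervalIntegral.integral_congr_ae ?_
  filter_upwards [(hf.intervalIntegrable (a := 0) (b := t)).ae_hasDerivAt_integral] with s hs hst
  have hs' := uIoc_subset_uIcc hst
  rw [uIoc_of_le ht] at hst
  rw [(hs hs' 0 left_mem_uIcc).deriv, ← intervalIntegral.integral_of_le hst.1.le]
  ring

lemma measurable_setIntegral_Ioc {g : ℝ → ℝ} (hg : Integrable g) :
    Measurable fun s => ∫ r in Ioc (0 : ℝ) s, g r := by
  have hc : Continuous fun s => ∫ r in (0 : ℝ)..(max s 0), g r :=
    (intervalIntegral.continuous_primitive (fun a b => hg.intervalIntegrable) 0).comp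
      (continuous_id.max continuous_const)
  have : (fun s => ∫ r in Ioc (0 : ℝ) s, g r) = fun s => ∫ r in (0 : ℝ)..(max s 0), g r := by
    ext s
    rw [intervalIntegral.integral_of_le (le_max_right _ _)]
    rcases le_total s 0 with h | h
    · rw [max_eq_right h, Ioc_eq_empty (not_lt.2 h), Ioc_self]
    · rw [max_eq_left h]
  rw [this]
  exact hc.measurable

lemma norm_setIntegral_Ioc_le {g : ℝ → ℝ} (hg : Integrable g) (s : ℝ) :
    ‖∫ r in Ioc (0 : ℝ) s, g r‖ ≤ ∫ r, ‖g r‖ :=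
  (norm_integral_le_integral_norm _).trans
    (setIntegral_le_integral hg.norm (Eventually.of_forall fun _ => norm_nonneg _))

lemma integrable_mul_setIntegral {f g : ℝ → ℝ} (hf : Integrable f) (hg : Integrable g) :
    Integrable fun s => f s * ∫ r in Ioc 0 s, g r :=
  hf.mul_bdd (c := ∫ r, ‖g r‖) (measurable_setIntegral_Ioc hg).aestronglyMeasurable
    (Eventually.of_forall fun s => norm_setIntegral_Ioc_le hg s)

lemma sq_norm_setIntegral {f : ℝ → ℂ} (hf : Integrable f) {t : ℝ} (ht : 0 ≤ t) :
    ‖∫ s in Ioc 0 t, f s‖ ^ 2 =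
      ∫ s in Ioc 0 t, 2 * (f s * (starRingEnd ℂ) (∫ r in Ioc 0 s, f r)).re := by
  have hre : ∀ s, (∫ r in Ioc 0 s, f r).re = ∫ r in Ioc 0 s, (f r).re := fun s =>
    (integral_re (𝕜 := ℂ) hf.integrableOn).symm
  have him : ∀ s, (∫ r in Ioc 0 s, f r).im = ∫ r in Ioc 0 s, (f r).im := fun s =>
    (integral_im (𝕜 := ℂ) hf.integrableOn).symm
  have h1 := sq_setIntegral hf.re ht
  have h2 := sq_setIntegral hf.im ht
  simp only [RCLike.re_to_complex, RCLike.im_to_complex] at h1 h2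
  rw [← Complex.normSq_eq_norm_sq, Complex.normSq_apply, hre, him, ← sq, ← sq, h1, h2,
    ← integral_add]
  · congr 1 with s
    simp only [Complex.mul_re, Complex.conj_re, Complex.conj_im, hre, him]
    ring
  · exact ((integrable_mul_setIntegral hf.re hf.re).const_mul 2).integrableOn
  · exact ((integrable_mul_setIntegral hf.im hf.im).const_mul 2).integrableOn

/-- The time primitive of a family of functions. -/
def prim (V : ℝ → ℝ → ℂ) (t k : ℝ) : ℂ := ∫ s in Ioc 0 t, V s k

/-- A measurable family of bounded functions, with integrable bounds. -/
structure TimeFamily (V : ℝ → ℝ → ℂ) (G : ℝ → ℝ) : Prop where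
  meas : Measurable (Function.uncurry V)
  int : Integrable G
  le : ∀ s k, ‖V s k‖ ≤ G s

namespace TimeFamily

variable {V : ℝ → ℝ → ℂ} {G : ℝ → ℝ} {m : ℝ → ℝ}

lemma nonneg (hV : TimeFamily V G) (s : ℝ) : 0 ≤ G s := (norm_nonneg _).trans (hV.le s 0)

lemma measurable_right (hV : TimeFamily V G) (s : ℝ) : Measurable (V s) :=
  hV.meas.comp (measurable_const.prodMk measurable_id)

lemma integrable_left (hV : TimeFamily V G) (k : ℝ) : Integrable fun s => V s k :=
  hV.int.mono' (hV.meas.comp (measurable_id.prodMk measurable_const)).aestronglyMeasurable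
    (Eventually.of_forall fun s => hV.le s k)

lemma norm_prim_le (hV : TimeFamily V G) (t k : ℝ) : ‖prim V t k‖ ≤ ∫ s, G s := by
  refine (norm_integral_le_integral_norm _).trans ?_
  refine (setIntegral_le_integral (hV.integrable_left k).norm
    (Eventually.of_forall fun _ => norm_nonneg _)).trans ?_
  exact integral_mono (hV.integrable_left k).norm hV.int fun s => hV.le s k

lemma measurable_prim (hV : TimeFamily V G) : Measurable (Function.uncurry (prim V)) := by
  -- The moving endpoint is put into the integrand, so that joint measurability follows from that of
  -- a parameter integral over a fixed space.
  have h : Measurable fun q : (ℝ × ℝ) × ℝ =>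
      (if 0 < q.2 ∧ q.2 ≤ q.1.1 then V q.2 q.1.2 else 0 : ℂ) := by
    refine Measurable.ite ?_ (hV.meas.comp (measurable_snd.prodMk
      (measurable_snd.comp measurable_fst))) measurable_const
    exact (measurableSet_lt measurable_const measurable_snd).inter
      (measurableSet_le measurable_snd (measurable_fst.comp measurable_fst))
  have h2 := (h.stronglyMeasurable.integral_prod_right' (ν := volume)).measurable
  convert h2 using 1
  ext ⟨t, k⟩
  simp only [Function.uncurry, prim]
  rw [← integral_indicator measurableSet_Ioc]
  congr 1 with s
  simp only [indicator_apply, mem_Ioc]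

lemma integrable_mul (hV : TimeFamily V G) (hm : Integrable m) (s : ℝ) :
    Integrable fun k => (m k : ℂ) * V s k :=
  hm.ofReal.mul_bdd (c := G s) (hV.measurable_right s).aestronglyMeasurable
    (Eventually.of_forall fun k => hV.le s k)

lemma integrable_mul_prim (hV : TimeFamily V G) (hm : Integrable m) (t : ℝ) :
    Integrable fun k => (m k : ℂ) * prim V t k :=
  hm.ofReal.mul_bdd (c := ∫ s, G s)
    (hV.measurable_prim.comp (measurable_const.prodMk measurable_id)).aestronglyMeasurable
    (Eventually.of_forall fun k => hV.norm_prim_le t k)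

/-- Fubini. In physical space, `m(D) u` is thus the time primitive of `m(D) ∂ₜ u` at each `ξ`, where
the scalar product rule applies. -/
lemma syn_prim (hV : TimeFamily V G) (hm : Integrable m) (t ξ : ℝ) :
    syn (fun k => (m k : ℂ) * prim V t k) ξ =
      ∫ s in Ioc 0 t, syn (fun k => (m k : ℂ) * V s k) ξ := by
  unfold syn
  have hint : Integrable (fun p : ℝ × ℝ => (m p.2 : ℂ) * V p.1 p.2 *
      Complex.exp (Complex.I * (1 : ℝ) * ξ * p.2)) ((volume.restrict (Ioc 0 t)).prod volume) := by
    refine Integrable.mono' (hV.int.restrict.mul_prod hm.norm) ?_ (Eventually.of_forall fun p => ?_)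
    · have h1 : AEStronglyMeasurable (fun p : ℝ × ℝ => (m p.2 : ℂ))
          ((volume.restrict (Ioc 0 t)).prod volume) :=
        (hm.ofReal (𝕜 := ℂ)).1.comp_snd
      exact (h1.mul hV.meas.aestronglyMeasurable).mul
        (Continuous.aestronglyMeasurable (by fun_prop))
    · rw [norm_mul, norm_mul, norm_exp_I_mul, mul_one, Complex.norm_real, mul_comm (G _)]
      exact mul_le_mul_of_nonneg_left (hV.le _ _) (norm_nonneg _)
  rw [integral_integral_swap hint]
  refine integral_congr_ae (Eventually.of_forall fun k => ?_)
  change (m k : ℂ) * (∫ s in Ioc 0 t, V s k) * _ = ∫ s in Ioc 0 t, (m k : ℂ) * V s k * _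
  rw [← integral_const_mul, ← integral_mul_const]

lemma measurable_syn {V : ℝ → ℝ → ℂ} (hV : Measurable (Function.uncurry V)) (hm : Measurable m) :
    Measurable fun p : ℝ × ℝ => syn (fun k => (m k : ℂ) * V p.1 k) p.2 := by
  have h : Measurable fun q : (ℝ × ℝ) × ℝ => (m q.2 : ℂ) * V q.1.1 q.2 *
      Complex.exp (Complex.I * (1 : ℝ) * q.1.2 * q.2) := by
    refine ((Complex.measurable_ofReal.comp (hm.comp measurable_snd)).mul
      (hV.comp ((measurable_fst.comp measurable_fst).prodMk measurable_snd))).mul ?_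
    exact Continuous.measurable (by fun_prop)
  exact (h.stronglyMeasurable.integral_prod_right' (ν := volume)).measurable

lemma integral_norm_mul_le (hm : Integrable m) {f : ℝ → ℂ} (hf : AEStronglyMeasurable f) {A : ℝ}
    (h : ∀ k, ‖f k‖ ≤ A) : ∫ k, ‖(m k : ℂ) * f k‖ ≤ (∫ k, ‖m k‖) * A := by
  rw [← integral_mul_const]
  refine integral_mono (hm.ofReal.mul_bdd hf (Eventually.of_forall h)).norm
    (hm.norm.mul_const _) fun k => ?_
  simp only [norm_mul, Complex.norm_real]
  exact mul_le_mul_of_nonneg_left (h k) (norm_nonneg _)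

end TimeFamily

/-- The energy of `f`, as a quadratic form. -/
def energy (b : ℝ → ℂ) (f : ℝ → ℂ) : ℝ := (∫ k, conv b f k * (starRingEnd ℂ) (f k)).re

/-- The time derivative of the energy of `∫ V`. -/
def energyRate (b : ℝ → ℂ) (m : ℝ → ℝ) (V : ℝ → ℝ → ℂ) (s : ℝ) : ℝ :=
  2 * (∫ k, conv b (fun l => (m l : ℂ) * V s l) k *
    (starRingEnd ℂ) ((m k : ℂ) * prim V s k)).re

/-- Parseval: convolution with `sharp b` becomes pointwise multiplication by the real function `b`.
-/
lemma re_integral_conv {b f g : ℝ → ℂ} (hb : IsTest b) (hreal : ∀ ξ, (starRingEnd ℂ) (b ξ) = b ξ)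
    (hf : Integrable f) (hg : Integrable g) :
    (∫ k, conv b f k * (starRingEnd ℂ) (g k)).re =
      cpi ^ 2 * ∫ ξ, (b ξ).re * (syn f ξ * (starRingEnd ℂ) (syn g ξ)).re := by
  have h := integral_mul_syn_conj_syn hb.integrable hf hg
  unfold conv
  rw [← h, ← Complex.ofReal_pow, Complex.re_ofReal_mul]
  congr 1
  have hint : Integrable fun ξ => b ξ * syn f ξ * (starRingEnd ℂ) (syn g ξ) :=
    (integrable_mul_syn hb.integrable hf).mul_bdd (c := ∫ l, ‖g l‖)
      (Complex.continuous_conj.comp (continuous_syn hg)).aestronglyMeasurable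
      (Eventually.of_forall fun ξ => by rw [RCLike.norm_conj]; exact norm_syn_le g ξ)
  rw [← RCLike.re_to_complex, ← integral_re hint]
  congr 1 with ξ
  have hbr : b ξ = ((b ξ).re : ℂ) := (Complex.conj_eq_iff_re.1 (hreal ξ)).symm
  rw [RCLike.re_to_complex, mul_assoc]
  nth_rewrite 1 [hbr]
  rw [Complex.re_ofReal_mul]

/-- In physical space the energy is a positive multiple of `∫ b |syn f|²`, and `b ≥ 0`. -/
lemma energy_nonneg {b f : ℝ → ℂ} (hb : IsTest b) (hreal : ∀ ξ, (starRingEnd ℂ) (b ξ) = b ξ)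
    (hb0 : ∀ ξ, 0 ≤ (b ξ).re) (hf : Integrable f) : 0 ≤ energy b f := by
  rw [energy, re_integral_conv hb hreal hf hf]
  refine mul_nonneg (sq_nonneg _) (integral_nonneg fun ξ => mul_nonneg (hb0 ξ) ?_)
  rw [Complex.mul_conj, Complex.ofReal_re]
  exact Complex.normSq_nonneg _

/-- The energy identity. -/
theorem energy_prim {b : ℝ → ℂ} (hb : IsTest b) (hreal : ∀ ξ, (starRingEnd ℂ) (b ξ) = b ξ)
    {m : ℝ → ℝ} (hm : Integrable m) (hmm : Measurable m) {V : ℝ → ℝ → ℂ} {G : ℝ → ℝ}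
    (hV : TimeFamily V G) :
    Integrable (energyRate b m V) ∧ ∀ t, 0 ≤ t →
      energy b (fun k => (m k : ℂ) * prim V t k) = ∫ s in Ioc 0 t, energyRate b m V s := by
  set M := ∫ k, ‖m k‖ with hM
  have hM0 : 0 ≤ M := integral_nonneg fun _ => norm_nonneg _
  have hG0 : 0 ≤ ∫ s, G s := integral_nonneg hV.nonneg
  set Φ : ℝ → ℝ → ℂ := fun s ξ => syn (fun k => (m k : ℂ) * V s k) ξ with hΦ
  set v : ℝ → ℝ → ℂ := fun s ξ => syn (fun k => (m k : ℂ) * prim V s k) ξ with hv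
  have hΦle : ∀ s ξ, ‖Φ s ξ‖ ≤ M * G s := fun s ξ => (norm_syn_le _ _).trans
    (TimeFamily.integral_norm_mul_le hm (hV.measurable_right s).aestronglyMeasurable (hV.le s))
  have hvle : ∀ s ξ, ‖v s ξ‖ ≤ M * ∫ s, G s := fun s ξ => (norm_syn_le _ _).trans
    (TimeFamily.integral_norm_mul_le hm (hV.measurable_prim.comp
      (measurable_const.prodMk measurable_id)).aestronglyMeasurable (hV.norm_prim_le s))
  have hΦm : Measurable fun p : ℝ × ℝ => Φ p.1 p.2 := TimeFamily.measurable_syn hV.meas hmm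
  have hvm : Measurable fun p : ℝ × ℝ => v p.1 p.2 := TimeFamily.measurable_syn hV.measurable_prim hmm
  have hrate : ∀ s, energyRate b m V s =
      cpi ^ 2 * ∫ ξ, 2 * ((b ξ).re * (Φ s ξ * (starRingEnd ℂ) (v s ξ)).re) := by
    intro s
    rw [energyRate, re_integral_conv hb hreal (hV.integrable_mul hm s) (hV.integrable_mul_prim hm s),
      integral_const_mul]
    ring
  have hint : Integrable (fun p : ℝ × ℝ =>
      2 * ((b p.2).re * (Φ p.1 p.2 * (starRingEnd ℂ) (v p.1 p.2)).re)) (volume.prod volume) := by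
    refine Integrable.mono' ((hV.int.const_mul (2 * (M * (M * ∫ s, G s)))).mul_prod
      hb.integrable.norm) ?_ (Eventually.of_forall fun p => ?_)
    · refine (Measurable.const_mul (Measurable.mul ?_ ?_) 2).aestronglyMeasurable
      · exact Complex.measurable_re.comp (hb.continuous.measurable.comp measurable_snd)
      · exact Complex.measurable_re.comp
          (hΦm.mul (Complex.continuous_conj.measurable.comp hvm))
    · rw [norm_mul, norm_mul, Real.norm_two]
      have h1 : ‖(b p.2).re‖ ≤ ‖b p.2‖ := Complex.abs_re_le_norm _
      have h2 : ‖(Φ p.1 p.2 * (starRingEnd ℂ) (v p.1 p.2)).re‖ ≤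
          (M * G p.1) * (M * ∫ s, G s) := by
        refine (Complex.abs_re_le_norm _).trans ?_
        rw [norm_mul, RCLike.norm_conj]
        exact mul_le_mul (hΦle _ _) (hvle _ _) (norm_nonneg _)
          (mul_nonneg hM0 (hV.nonneg _))
      calc 2 * (‖(b p.2).re‖ * ‖(Φ p.1 p.2 * (starRingEnd ℂ) (v p.1 p.2)).re‖)
          ≤ 2 * (‖b p.2‖ * ((M * G p.1) * (M * ∫ s, G s))) := by gcongr
        _ = _ := by ring
  refine ⟨?_, fun t ht => ?_⟩
  · rw [funext hrate]
    exact hint.integral_prod_left.const_mul _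
  · rw [energy, re_integral_conv hb hreal (hV.integrable_mul_prim hm t) (hV.integrable_mul_prim hm t)]
    simp_rw [hrate]
    rw [integral_const_mul]
    congr 1
    have hint' : Integrable (fun p : ℝ × ℝ =>
        2 * ((b p.2).re * (Φ p.1 p.2 * (starRingEnd ℂ) (v p.1 p.2)).re))
        ((volume.restrict (Ioc 0 t)).prod volume) := by
      rw [← Measure.restrict_univ (μ := (volume : Measure ℝ)), Measure.restrict_restrict_of_subset
        (subset_univ _), Measure.prod_restrict]
      exact hint.restrict
    rw [integral_integral_swap hint']
    congr 1 with ξ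
    have hΦi : Integrable fun s => Φ s ξ := (hV.int.const_mul M).mono'
      (hΦm.comp (measurable_id.prodMk measurable_const)).aestronglyMeasurable
      (Eventually.of_forall fun s => hΦle s ξ)
    -- The identity is scalar for each fixed `ξ`; Fubini has already moved the time integral inside.
    have h1 := sq_norm_setIntegral hΦi ht
    have h2 : ∀ s, ∫ r in Ioc 0 s, Φ r ξ = v s ξ := fun s => (hV.syn_prim hm s ξ).symm
    simp_rw [h2] at h1
    have h3 : ∀ s, 2 * ((b ξ).re * (Φ s ξ * (starRingEnd ℂ) (v s ξ)).re) =
        (b ξ).re * (2 * (Φ s ξ * (starRingEnd ℂ) (v s ξ)).re) := fun s => by ring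
    simp_rw [h3]
    rw [integral_const_mul, ← h1]
    congr 1
    change (v t ξ * (starRingEnd ℂ) (v t ξ)).re = _
    rw [Complex.mul_conj, Complex.normSq_eq_norm_sq, Complex.ofReal_re]

/-! ### Integration of the energy inequality in time -/

lemma integral_le_toReal_lintegral {α : Type*} [MeasurableSpace α] {μ : Measure α} {f : α → ℝ}
    (hf : Integrable f μ) : ∫ x, f x ∂μ ≤ (∫⁻ x, ENNReal.ofReal (f x) ∂μ).toReal := by
  rw [integral_eq_lintegral_pos_part_sub_lintegral_neg_part hf]
  exact sub_le_self _ ENNReal.toReal_nonneg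

/-! ### Window bounds from a differential inequality with damping. -/

section Window

variable {c T : ℝ} {e D : ℝ → ℝ} {S : ℝ → ℝ≥0∞} {R : ℝ≥0∞}

lemma window_lintegral_le {a b : ℝ} (ha : 0 ≤ a) (hbT : b ≤ T) (hba : b ≤ a + 1)
    (hab : a ≤ b) (hS : ∀ a ∈ Icc 0 T, ∫⁻ t in Ioo a (min (a + 1) T), S t ≤ R)
    {f : ℝ → ℝ} (hf : ∀ᵐ t ∂(volume.restrict (Ioo 0 T)), ENNReal.ofReal (f t) ≤ S t) :
    ∫⁻ t in Ioc a b, ENNReal.ofReal (f t) ≤ R := by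
  have hsub : Ioo a (min (a + 1) T) ⊆ Ioo 0 T := fun t ht =>
    ⟨ha.trans_lt ht.1, ht.2.trans_le (min_le_right _ _)⟩
  rw [← restrict_Ioo_eq_restrict_Ioc]
  calc ∫⁻ t in Ioo a b, ENNReal.ofReal (f t)
      ≤ ∫⁻ t in Ioo a (min (a + 1) T), ENNReal.ofReal (f t) :=
        lintegral_mono_set (Ioo_subset_Ioo_right (le_min hba hbT))
    _ ≤ ∫⁻ t in Ioo a (min (a + 1) T), S t :=
        lintegral_mono_ae (ae_restrict_of_ae_restrict_of_subset hsub hf)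
    _ ≤ R := hS a ⟨ha, hab.trans hbT⟩

/-- Integration of the differential inequality over `(a, b)`. Integrability of `D` is not assumed;
it follows from the inequality because the energy is nonnegative. -/
lemma window_energy_le (hc : 0 < c) (he : Integrable e)
    (hE : ∀ t, 0 ≤ t → 0 ≤ ∫ s in Ioc 0 t, e s) (hD : Measurable D) (hD0 : ∀ t, 0 ≤ D t)
    (hR : R ≠ ⊤) (hS : ∀ a ∈ Icc 0 T, ∫⁻ t in Ioo a (min (a + 1) T), S t ≤ R)
    (h : ∀ᵐ t ∂(volume.restrict (Ioo 0 T)),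
      ENNReal.ofReal (e t + c * D t + c * ∫ s in Ioc 0 t, e s) ≤ S t)
    {a b : ℝ} (ha : 0 ≤ a) (hab : a ≤ b) (hbT : b ≤ T) (hba : b ≤ a + 1) :
    IntegrableOn D (Ioc a b) ∧
      (∫ s in Ioc 0 b, e s) - (∫ s in Ioc 0 a, e s) + c * (∫ t in Ioc a b, D t) +
        c * (∫ t in Ioc a b, ∫ s in Ioc 0 t, e s) ≤ R.toReal := by
  set E : ℝ → ℝ := fun t => ∫ s in Ioc 0 t, e s with hEdef
  have hlin := window_lintegral_le ha hbT hba hab hS h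
  have hEm : Measurable E := measurable_setIntegral_Ioc he
  have hEi : IntegrableOn E (Ioc a b) :=
    Measure.integrableOn_of_bounded (M := ∫ r, ‖e r‖) measure_Ioc_lt_top.ne hEm.aestronglyMeasurable
      (Eventually.of_forall fun t => norm_setIntegral_Ioc_le he t)
  have hcD : IntegrableOn (fun t => c * D t) (Ioc a b) := by
    refine ⟨(hD.const_mul c).aestronglyMeasurable, ?_⟩
    rw [hasFiniteIntegral_iff_ofReal (Eventually.of_forall fun t => mul_nonneg hc.le (hD0 t))]
    -- `c D` is at most the left side of the differential inequality plus `|e|`, as `c E ≥ 0`.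
    have h1 : ∫⁻ t in Ioc a b, ENNReal.ofReal (c * D t) ≤
        ∫⁻ t in Ioc a b, (ENNReal.ofReal (e t + c * D t + c * E t) + ENNReal.ofReal ‖e t‖) := by
      refine lintegral_mono_ae ((ae_restrict_iff' measurableSet_Ioc).2
        (Eventually.of_forall fun t ht => ?_))
      refine le_trans (ENNReal.ofReal_le_ofReal ?_) ENNReal.ofReal_add_le
      have h2 := hE t (ha.trans ht.1.le)
      have h3 : -‖e t‖ ≤ e t := neg_abs_le _
      have h4 : 0 ≤ c * E t := mul_nonneg hc.le h2
      linarith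
    refine h1.trans_lt ?_
    rw [lintegral_add_right' _ he.restrict.1.norm.aemeasurable.ennreal_ofReal]
    refine ENNReal.add_lt_top.2 ⟨hlin.trans_lt hR.lt_top, ?_⟩
    exact (hasFiniteIntegral_iff_ofReal (Eventually.of_forall fun _ => norm_nonneg _)).1
      (he.norm.restrict (s := Ioc a b)).2
  have hDi : IntegrableOn D (Ioc a b) := by
    refine (hcD.const_mul c⁻¹).congr (Eventually.of_forall fun t => ?_)
    exact inv_mul_cancel_left₀ hc.ne' (D t)
  refine ⟨hDi, ?_⟩
  have hecD : IntegrableOn (fun t => e t + c * D t) (Ioc a b) := he.integrableOn.add hcD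
  have hsum : IntegrableOn (fun t => e t + c * D t + c * E t) (Ioc a b) :=
    hecD.add (hEi.const_mul c)
  have h1 := integral_le_toReal_lintegral hsum
  have h2 : ∫ t in Ioc a b, (e t + c * D t + c * E t) =
      (∫ t in Ioc a b, e t) + c * (∫ t in Ioc a b, D t) + c * ∫ t in Ioc a b, E t := by
    rw [integral_add hecD (hEi.const_mul c), integral_add he.integrableOn hcD,
      integral_const_mul, integral_const_mul]
  have h3 : E b = E a + ∫ t in Ioc a b, e t := by
    simp only [hEdef]
    rw [← setIntegral_union (Ioc_disjoint_Ioc_of_le le_rfl) measurableSet_Ioc he.integrableOn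
      he.integrableOn, Ioc_union_Ioc_eq_Ioc ha hab]
  have h4 := h1.trans (ENNReal.toReal_mono hR hlin)
  rw [h2] at h4
  linarith

/-- A differential inequality for an energy, integrated over windows of length one. -/
lemma window_dissipation_le (hc : 0 < c) (he : Integrable e)
    (hE : ∀ t, 0 ≤ t → 0 ≤ ∫ s in Ioc 0 t, e s) (hD : Measurable D) (hD0 : ∀ t, 0 ≤ D t)
    (hS : ∀ a ∈ Icc 0 T, ∫⁻ t in Ioo a (min (a + 1) T), S t ≤ R)
    (h : ∀ᵐ t ∂(volume.restrict (Ioo 0 T)),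
      ENNReal.ofReal (e t + c * D t + c * ∫ s in Ioc 0 t, e s) ≤ S t)
    {a : ℝ} (ha : a ∈ Icc 0 T) :
    ∫⁻ t in Ioo a (min (a + 1) T), ENNReal.ofReal (D t) ≤
      ENNReal.ofReal ((1 + (1 + c) / c) / c) * R := by
  by_cases hR : R = ⊤
  · rw [hR, ENNReal.mul_top (by rw [ne_eq, ENNReal.ofReal_eq_zero, not_le]; positivity)]
    exact le_top
  set E : ℝ → ℝ := fun t => ∫ s in Ioc 0 t, e s with hEdef
  set r := R.toReal with hr
  have hr0 : 0 ≤ r := ENNReal.toReal_nonneg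
  -- The fixed point of `M ↦ (M + 1 + c) / (1 + c)`, the recursion for the energy from one window to
  -- the next.
  set M := (1 + c) / c with hM
  have hMc : M * c = 1 + c := by rw [hM]; field_simp
  have hM1 : 1 ≤ M := by rw [hM, le_div_iff₀ hc]; linarith
  have hwin := @window_energy_le c T e D S R hc he hE hD hD0 hR hS h
  have hE0 : E 0 = 0 := by simp [hEdef]
  have hstep : ∀ a b, 0 ≤ a → a ≤ b → b ≤ T → b ≤ a + 1 → E b ≤ E a + r := by
    intro a b h1 h2 h3 h4
    have h5 := (hwin h1 h2 h3 h4).2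
    have h6 : 0 ≤ c * ∫ t in Ioc a b, D t :=
      mul_nonneg hc.le (integral_nonneg fun t => hD0 t)
    have h7 : 0 ≤ c * ∫ t in Ioc a b, E t :=
      mul_nonneg hc.le (setIntegral_nonneg measurableSet_Ioc fun t ht => hE t (h1.trans ht.1.le))
    linarith
  have hbound : ∀ n : ℕ, ∀ t, 0 ≤ t → t ≤ T → t ≤ n + 1 → E t ≤ M * r := by
    intro n
    induction n with
    | zero =>
      intro t h1 h2 h3
      have := hstep 0 t le_rfl h1 h2 (by simpa using h3)
      nlinarith
    | succ n ih =>
      intro t h1 h2 h3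
      rcases le_total t 1 with h4 | h4
      · exact ih t h1 h2 (h4.trans (by simp))
      · have h5 := ih (t - 1) (by linarith) (by linarith) (by push_cast at h3; linarith)
        have h6 := (hwin (a := t - 1) (b := t) (by linarith) (by linarith) h2 (by linarith)).2
        have h7 : 0 ≤ c * ∫ s in Ioc (t - 1) t, D s :=
          mul_nonneg hc.le (integral_nonneg fun t => hD0 t)
        have hEi : IntegrableOn E (Ioc (t - 1) t) :=
          Measure.integrableOn_of_bounded (M := ∫ r, ‖e r‖) measure_Ioc_lt_top.ne
            (measurable_setIntegral_Ioc he).aestronglyMeasurable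
            (Eventually.of_forall fun t => norm_setIntegral_Ioc_le he t)
        -- The energy grows by at most `r` within a window, so its average over the preceding unit
        -- interval is at least `E t - r`. The damping term then gives `(1 + c) E(t) ≤ E(t-1) + (1 +
        -- c) r`.
        have h8 : E t - r ≤ ∫ s in Ioc (t - 1) t, E s := by
          have h9 : ∫ s in Ioc (t - 1) t, (E t - r) ≤ ∫ s in Ioc (t - 1) t, E s := by
            refine setIntegral_mono_on (integrableOn_const measure_Ioc_lt_top.ne) hEi
              measurableSet_Ioc fun s hs => ?_
            have := hstep s t (by linarith [hs.1]) hs.2 h2 (by linarith [hs.1])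
            linarith
          rw [setIntegral_const, Real.volume_real_Ioc_of_le (by linarith)] at h9
          simpa using h9
        have h10 : c * (E t - r) ≤ c * ∫ s in Ioc (t - 1) t, E s :=
          mul_le_mul_of_nonneg_left h8 hc.le
        change E t - E (t - 1) + _ + _ ≤ r at h6
        have h11 : (1 + c) * E t ≤ M * r + (1 + c) * r := by linarith
        have h12 : M * r + (1 + c) * r = (1 + c) * (M * r) := by
          rw [← hMc]
          have : M * c * (M * r) = (1 + c) * (M * r) := by rw [hMc]
          rw [this, hMc]
          have : c * (M * r) = (1 + c) * r := by rw [← hMc]; ring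
          linarith
        rw [h12] at h11
        exact le_of_mul_le_mul_left h11 (by linarith)
  have hb : a ≤ min (a + 1) T := le_min (by linarith) ha.2
  obtain ⟨hDi, h1⟩ := hwin ha.1 hb (min_le_right _ _) (min_le_left _ _)
  obtain ⟨n, hn⟩ := exists_nat_ge a
  have h2 := hbound n a ha.1 ha.2 (by linarith)
  have h3 : 0 ≤ c * ∫ t in Ioc a (min (a + 1) T), E t :=
    mul_nonneg hc.le (setIntegral_nonneg measurableSet_Ioc fun t ht => hE t (ha.1.trans ht.1.le))
  have h4 : 0 ≤ E (min (a + 1) T) := hE _ (ha.1.trans hb)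
  change E (min (a + 1) T) - E a + _ + _ ≤ r at h1
  have h5 : ∫ t in Ioc a (min (a + 1) T), D t ≤ (1 + M) / c * r := by
    rw [div_mul_eq_mul_div, le_div_iff₀ hc]
    linarith
  rw [restrict_Ioo_eq_restrict_Ioc, ← ofReal_integral_eq_lintegral_ofReal hDi
    (Eventually.of_forall hD0), ← ENNReal.ofReal_toReal hR,
    ← ENNReal.ofReal_mul (by positivity)]
  exact ENNReal.ofReal_le_ofReal h5

end Window

/-! ### The equation in Fourier space -/

/-- A smooth function equal to `x` for `x ^ 2 ≥ 2` and to `0` for `x ^ 2 ≤ 1`. -/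
def truncId (x : ℝ) : ℝ := x * Real.smoothTransition (x ^ 2 - 1)

lemma contDiff_truncId : ContDiff ℝ ∞ truncId :=
  contDiff_id.mul (Real.smoothTransition.contDiff.comp ((contDiff_id.pow 2).sub contDiff_const))

lemma truncId_of_le_sq {x : ℝ} (hx : 2 ≤ x ^ 2) : truncId x = x := by
  rw [truncId, Real.smoothTransition.one_of_one_le (by linarith), mul_one]

/-- Outside `[-2, 2]` the function is locally the identity; on the compact interval the derivative
is continuous. -/
lemma exists_deriv_truncId_le : ∃ C, 0 ≤ C ∧ ∀ x, |deriv truncId x| ≤ C := by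
  have hc : Continuous (deriv truncId) := contDiff_truncId.continuous_deriv (by simp)
  obtain ⟨C, hC⟩ := (isCompact_Icc (a := (-2 : ℝ)) (b := 2)).exists_bound_of_continuousOn
    hc.continuousOn
  refine ⟨max C 1, le_max_of_le_right zero_le_one, fun x => ?_⟩
  by_cases hx : x ∈ Icc (-2 : ℝ) 2
  · exact (hC x hx).trans (le_max_left _ _)
  · have h4 : 2 < x ^ 2 := by
      rw [mem_Icc, not_and_or, not_le, not_le] at hx
      rcases hx with h | h <;> nlinarith
    have h5 : truncId =ᶠ[nhds x] id := by
      have : ∀ᶠ y in nhds x, 2 < y ^ 2 := (continuous_pow 2).continuousAt.eventually (lt_mem_nhds h4)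
      filter_upwards [this] with y hy using truncId_of_le_sq hy.le
    rw [h5.deriv_eq, deriv_id, abs_one]
    exact le_max_right _ _

/-- A smooth approximation of `χ`, supported where `|χ|` is not small. -/
def damp (χ : ℝ → ℝ) (j : ℕ) (ξ : ℝ) : ℝ :=
  χ ξ * Real.smoothTransition ((((j : ℝ) + 1) * χ ξ) ^ 2 - 1)

lemma damp_eq (χ : ℝ → ℝ) (j : ℕ) (ξ : ℝ) :
    damp χ j ξ = ((j : ℝ) + 1)⁻¹ * truncId (((j : ℝ) + 1) * χ ξ) := by
  have : (j : ℝ) + 1 ≠ 0 := by positivity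
  rw [damp, truncId]
  field_simp

lemma tendsto_smoothTransition {x : ℝ} (hx : x ≠ 0) :
    Tendsto (fun j : ℕ => Real.smoothTransition ((((j : ℝ) + 1) * x) ^ 2 - 1)) atTop (nhds 1) := by
  obtain ⟨n, hn⟩ := exists_nat_ge (2 / |x|)
  refine tendsto_const_nhds.congr' ?_
  filter_upwards [eventually_ge_atTop n] with j hj
  refine (Real.smoothTransition.one_of_one_le ?_).symm
  have hx' := abs_pos.2 hx
  have h1 : 2 ≤ ((j : ℝ) + 1) * |x| := by
    have : (n : ℝ) ≤ j := by exact_mod_cast hj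
    rw [div_le_iff₀ hx'] at hn
    nlinarith
  have h2 : (((j : ℝ) + 1) * x) ^ 2 = (((j : ℝ) + 1) * |x|) ^ 2 := by
    rw [mul_pow, mul_pow, sq_abs]
  rw [h2]
  nlinarith

lemma isTest_ofReal {χ : ℝ → ℝ} (hs : ContDiff ℝ ∞ χ) (h0 : ∀ ξ, ξ ∉ J₂ → χ ξ = 0) :
    IsTest (fun ξ => (χ ξ : ℂ)) := by
  refine ⟨Complex.ofRealCLM.contDiff.comp hs, HasCompactSupport.of_support_subset_isCompact
    (K := Icc (Real.log (1 / 2)) (Real.log 2)) isCompact_Icc fun ξ hξ => ?_⟩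
  by_contra hn
  exact hξ (by simp [h0 ξ fun h => hn (Ioo_subset_Icc_self h)])

lemma isTest_damp {χ : ℝ → ℝ} (hχ : IsCutoff χ) (j : ℕ) : IsTest (fun ξ => (damp χ j ξ : ℂ)) := by
  refine isTest_ofReal ?_ fun ξ hξ => by rw [damp, hχ.eq_zero ξ hξ, zero_mul]
  exact hχ.smooth.mul (Real.smoothTransition.contDiff.comp
    (((contDiff_const.mul hχ.smooth).pow 2).sub contDiff_const))

/-- The cutoff vanishes outside the open interval, but its closed support may reach the endpoints,
where the equation admits no test function. The closed set where `(j + 1) |χ| ≥ 1` stays inside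
`J₂`. -/
lemma tsupport_damp {χ : ℝ → ℝ} (hχ : IsCutoff χ) (j : ℕ) :
    tsupport (fun ξ => (damp χ j ξ : ℂ)) ⊆ J₂ := by
  have hc : IsClosed {ξ | 1 ≤ (((j : ℝ) + 1) * χ ξ) ^ 2} :=
    isClosed_le continuous_const ((continuous_const.mul hχ.smooth.continuous).pow 2)
  have hsub : tsupport (fun ξ => (damp χ j ξ : ℂ)) ⊆ {ξ | 1 ≤ (((j : ℝ) + 1) * χ ξ) ^ 2} := by
    refine closure_minimal (fun ξ hξ => ?_) hc
    by_contra hn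
    rw [mem_ofPred_eq, not_le] at hn
    refine hξ ?_
    simp [damp, Real.smoothTransition.zero_of_nonpos (by linarith : (((j : ℝ) + 1) * χ ξ) ^ 2 - 1 ≤ 0)]
  intro ξ hξ
  by_contra hn
  have := hsub hξ
  rw [mem_ofPred_eq, hχ.eq_zero ξ hn] at this
  norm_num at this

lemma jap_mul_hat_le {φ : ℝ → ℂ} (hφ : IsTest φ) (k : ℝ) :
    jap k * ‖hat φ k‖ ≤ cpi * ((∫ ξ, ‖φ ξ‖) + ∫ ξ, ‖deriv φ ξ‖) := by
  have h1 := norm_hat_le φ k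
  have h2 := norm_hat_le (deriv φ) k
  rw [hat_deriv hφ, norm_mul, norm_mul, Complex.norm_I, one_mul, Complex.norm_real,
    Real.norm_eq_abs] at h2
  unfold jap
  linarith

lemma norm_damp_le (χ : ℝ → ℝ) (j : ℕ) (ξ : ℝ) : ‖(damp χ j ξ : ℂ)‖ ≤ ‖(χ ξ : ℂ)‖ := by
  rw [Complex.norm_real, Complex.norm_real, damp, norm_mul,
    Real.norm_of_nonneg (Real.smoothTransition.nonneg _)]
  exact mul_le_of_le_one_right (norm_nonneg _) (Real.smoothTransition.le_one _)

/-- `damp χ j` is the rescaling `x ↦ truncId ((j+1) x) / (j+1)` composed with `χ`, and this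
rescaling leaves the bound on the derivative of `truncId` unchanged. Only the first derivative is
uniform in `j`, hence only one order of decay. -/
lemma exists_jap_mul_hat_damp_le {χ : ℝ → ℝ} (hχ : IsCutoff χ) :
    ∃ C, 0 ≤ C ∧ ∀ j k, jap k * ‖hat (fun ξ => (damp χ j ξ : ℂ)) k‖ ≤ C := by
  obtain ⟨B, hB0, hB⟩ := exists_deriv_truncId_le
  have hχt := isTest_ofReal hχ.smooth hχ.eq_zero
  have hd := hχ.smooth.differentiable (by simp)
  refine ⟨cpi * ((∫ ξ, ‖(χ ξ : ℂ)‖) + ∫ ξ, B * ‖deriv (fun ξ => (χ ξ : ℂ)) ξ‖),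
    mul_nonneg cpi_pos.le (add_nonneg (integral_nonneg fun _ => norm_nonneg _)
      (integral_nonneg fun _ => by positivity)), fun j k => ?_⟩
  have ht := isTest_damp hχ j
  refine (jap_mul_hat_le ht k).trans (mul_le_mul_of_nonneg_left (add_le_add ?_ ?_) cpi_pos.le)
  · exact integral_mono ht.integrable.norm hχt.integrable.norm (norm_damp_le χ j)
  · refine integral_mono ht.deriv.integrable.norm (hχt.deriv.integrable.norm.const_mul B) fun ξ => ?_
    have hj : (j : ℝ) + 1 ≠ 0 := by positivity
    have h1 : HasDerivAt (fun ξ => (χ ξ : ℂ)) ((deriv χ ξ : ℝ) : ℂ) ξ := (hd ξ).hasDerivAt.ofReal_comp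
    have h2 : HasDerivAt (fun ξ => damp χ j ξ)
        (((j : ℝ) + 1)⁻¹ * (deriv truncId (((j : ℝ) + 1) * χ ξ) * (((j : ℝ) + 1) * deriv χ ξ))) ξ := by
      simp_rw [damp_eq]
      have h3 := (contDiff_truncId.differentiable (by simp) (((j : ℝ) + 1) * χ ξ)).hasDerivAt
      exact (h3.comp ξ ((hd ξ).hasDerivAt.const_mul _)).const_mul _
    have h3 : ((j : ℝ) + 1)⁻¹ * (deriv truncId (((j : ℝ) + 1) * χ ξ) * (((j : ℝ) + 1) * deriv χ ξ)) =
        deriv truncId (((j : ℝ) + 1) * χ ξ) * deriv χ ξ := by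
      field_simp
    rw [h3] at h2
    change ‖deriv (fun ξ => (damp χ j ξ : ℂ)) ξ‖ ≤ B * ‖deriv (fun ξ => (χ ξ : ℂ)) ξ‖
    rw [h1.deriv, h2.ofReal_comp.deriv, Complex.norm_real, Complex.norm_real, norm_mul]
    exact mul_le_mul_of_nonneg_right (hB _) (norm_nonneg _)

lemma ell_le_jap_rpow (k : ℝ) : ell k ≤ 4 * jap k ^ (1 / 4 : ℝ) := by
  have h := Real.log_le_sub_one_of_pos (Real.rpow_pos_of_pos (jap_pos k) (1 / 4 : ℝ))
  rw [Real.log_rpow (jap_pos k)] at h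
  unfold ell
  linarith

/-- One order of decay beats the logarithm in `L²`. Paired with `hat w` in `L²`, it gives the
integrable majorant for `damp χ j → χ`. -/
lemma memLp_rho0_div_jap : MemLp (fun l => rho0 l / (jap l : ℂ)) 2 := by
  have hm : Measurable (fun l => rho0 l / (jap l : ℂ)) :=
    continuous_rho0.measurable.div (Complex.measurable_ofReal.comp continuous_jap.measurable)
  rw [memLp_two_iff_integrable_sq_norm hm.aestronglyMeasurable]
  have hi : Integrable (fun l : ℝ => 64 * (1 + ‖l‖) ^ (-(3 / 2) : ℝ)) :=
    (integrable_one_add_norm (by simp; norm_num)).const_mul 64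
  refine hi.mono' (hm.norm.pow_const 2).aestronglyMeasurable (Eventually.of_forall fun l => ?_)
  have hj := jap_pos l
  rw [Real.norm_of_nonneg (by positivity), norm_div, Complex.norm_real, Real.norm_of_nonneg hj.le]
  change _ ≤ 64 * jap l ^ (-(3 / 2) : ℝ)
  have h1 : ‖rho0 l‖ ≤ 8 * jap l ^ (1 / 4 : ℝ) := by
    linarith [norm_rho0_le l, ell_le_jap_rpow l]
  calc (‖rho0 l‖ / jap l) ^ 2 ≤ (8 * jap l ^ (1 / 4 : ℝ) / jap l) ^ 2 := by gcongr
    _ = 64 * ((jap l ^ (1 / 4 : ℝ)) ^ 2 / jap l ^ 2) := by ring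
    _ = 64 * jap l ^ (-(3 / 2) : ℝ) := by
      rw [← Real.rpow_natCast, ← Real.rpow_mul hj.le, ← Real.rpow_natCast, ← Real.rpow_sub hj]
      norm_num

lemma integrable_rho0_mul_div_jap {W : ℝ → ℂ} (hW : MemLp W 2) :
    Integrable (fun l => ‖rho0 l * W l‖ / jap l) := by
  refine (memLp_rho0_div_jap.integrable_mul hW).norm.congr (Eventually.of_forall fun l => ?_)
  simp only [Pi.mul_apply]
  rw [norm_mul, norm_mul, norm_div, Complex.norm_real, Real.norm_of_nonneg (jap_pos l).le]
  ring

lemma tendsto_hat_damp {χ : ℝ → ℝ} (hχ : IsCutoff χ) (k : ℝ) :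
    Tendsto (fun j => hat (fun ξ => (damp χ j ξ : ℂ)) k) atTop
      (nhds (hat (fun ξ => (χ ξ : ℂ)) k)) := by
  have hχt := isTest_ofReal hχ.smooth hχ.eq_zero
  simp_rw [hat_eq]
  refine Tendsto.const_mul _ (tendsto_integral_of_dominated_convergence (fun ξ => ‖(χ ξ : ℂ)‖)
    (fun j => (integrable_mul_exp (isTest_damp hχ j).integrable (-1) k).1) hχt.integrable.norm
    (fun j => Eventually.of_forall fun ξ => ?_) (Eventually.of_forall fun ξ => ?_))
  · rw [norm_mul, norm_exp_I_mul, mul_one]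
    exact norm_damp_le χ j ξ
  · refine Tendsto.mul_const _ ((Complex.continuous_ofReal.tendsto _).comp ?_)
    by_cases h : χ ξ = 0
    · simp only [damp, h, zero_mul]
      exact tendsto_const_nhds
    · simpa [damp] using (tendsto_smoothTransition h).const_mul (χ ξ)

lemma tendsto_conv_damp {χ : ℝ → ℝ} (hχ : IsCutoff χ) {W : ℝ → ℂ} (hW : MemLp W 2)
    (hWm : Measurable W) (k : ℝ) :
    Tendsto (fun j => conv (fun ξ => (damp χ j ξ : ℂ)) (fun l => rho0 l * W l) k) atTop
      (nhds (conv (fun ξ => (χ ξ : ℂ)) (fun l => rho0 l * W l) k)) := by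
  obtain ⟨C, hC0, hC⟩ := exists_jap_mul_hat_damp_le hχ
  have hrW : Measurable (fun l => rho0 l * W l) := continuous_rho0.measurable.mul hWm
  refine tendsto_integral_of_dominated_convergence
    (fun l => cpi * C * jap k * (‖rho0 l * W l‖ / jap l))
    (fun j => ((((continuous_sharp (isTest_damp hχ j)).comp
      (continuous_const.sub continuous_id)).measurable.mul hrW)).aestronglyMeasurable)
    ((integrable_rho0_mul_div_jap hW).const_mul _) (fun j => Eventually.of_forall fun l => ?_)
    (Eventually.of_forall fun l => ?_)
  · rw [norm_mul, sharp, norm_mul, Complex.norm_real, Real.norm_of_nonneg cpi_pos.le]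
    have h1 := hC j (k - l)
    have hjl := jap_pos l
    have hjk := jap_pos k
    have h2 : jap l ≤ jap (k - l) * jap k := by
      rw [jap_sub_comm]; exact jap_le_mul l k
    have h3 : ‖hat (fun ξ => (damp χ j ξ : ℂ)) (k - l)‖ ≤ C * jap k / jap l := by
      rw [le_div_iff₀ hjl]
      calc _ ≤ ‖hat (fun ξ => (damp χ j ξ : ℂ)) (k - l)‖ * (jap (k - l) * jap k) := by gcongr
        _ = jap (k - l) * ‖hat (fun ξ => (damp χ j ξ : ℂ)) (k - l)‖ * jap k := by ring
        _ ≤ C * jap k := by gcongr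
    have hcp := cpi_pos.le
    calc _ ≤ cpi * (C * jap k / jap l) * ‖rho0 l * W l‖ := by gcongr
      _ = _ := by ring
  · exact ((tendsto_hat_damp hχ (k - l)).const_mul _).mul_const _

lemma tendsto_integral_damp {χ : ℝ → ℝ} {b h : ℝ → ℂ}
    (hb : IsTest b) (hh : Integrable (fun ξ => (χ ξ : ℂ) * h ξ)) (hχ : IsCutoff χ) (k : ℝ) :
    Tendsto (fun j => ∫ ξ : ℝ, h ξ * (b ξ * damp χ j ξ * Complex.exp (Complex.I * (-1 : ℝ) * k * ξ)))
      atTop (nhds (∫ ξ : ℝ, b ξ * ((χ ξ : ℂ) * h ξ) *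
        Complex.exp (Complex.I * (-1 : ℝ) * k * ξ))) := by
  obtain ⟨B, hB⟩ := hb.compact.exists_bound_of_continuous hb.continuous
  have e1 : ∀ j ξ, h ξ * (b ξ * damp χ j ξ * Complex.exp (Complex.I * (-1 : ℝ) * k * ξ)) =
      ((χ ξ : ℂ) * h ξ) * (b ξ * (Real.smoothTransition ((((j : ℝ) + 1) * χ ξ) ^ 2 - 1) : ℝ) *
        Complex.exp (Complex.I * (-1 : ℝ) * k * ξ)) := by
    intro j ξ
    rw [damp]
    push_cast
    ring
  simp_rw [e1]
  refine tendsto_integral_of_dominated_convergence (fun ξ => ‖(χ ξ : ℂ) * h ξ‖ * B)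
    (fun j => hh.1.mul (Continuous.aestronglyMeasurable ?_)) (hh.norm.mul_const B)
    (fun j => Eventually.of_forall fun ξ => ?_) (Eventually.of_forall fun ξ => ?_)
  · refine (hb.continuous.mul (Complex.continuous_ofReal.comp
      (Real.smoothTransition.continuous.comp ?_))).mul (by fun_prop)
    exact ((continuous_const.mul hχ.smooth.continuous).pow 2).sub continuous_const
  · rw [norm_mul, norm_mul, norm_mul, norm_exp_I_mul, mul_one, norm_mul (b ξ),
      Complex.norm_real (Real.smoothTransition _),
      Real.norm_of_nonneg (Real.smoothTransition.nonneg _)]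
    refine mul_le_mul_of_nonneg_left ?_ (by positivity)
    exact (mul_le_of_le_one_right (norm_nonneg _) (Real.smoothTransition.le_one _)).trans (hB ξ)
  · by_cases hξ : χ ξ = 0
    · simp [hξ]
    · have h1 := (Complex.continuous_ofReal.tendsto _).comp (tendsto_smoothTransition hξ)
      have h2 := ((h1.const_mul (b ξ)).mul_const
        (Complex.exp (Complex.I * (-1 : ℝ) * k * ξ))).const_mul ((χ ξ : ℂ) * h ξ)
      rw [Complex.ofReal_one, mul_one] at h2
      rw [show b ξ * ((χ ξ : ℂ) * h ξ) * Complex.exp (Complex.I * (-1 : ℝ) * k * ξ) =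
        (χ ξ : ℂ) * h ξ * (b ξ * Complex.exp (Complex.I * (-1 : ℝ) * k * ξ)) by ring]
      exact h2

/-- The factor `b = e^{ξ/2}` in the test function cancels `e^{-ξ/2}` in the symbol, and the
exponential `e^{-ikξ}` turns the pairing into a convolution evaluated at `k`. -/
lemma pairP_damp {χ : ℝ → ℝ} (hχ : IsCutoff χ) {b w : ℝ → ℂ}
    (hbe : ∀ ξ ∈ J₂, b ξ = (Real.exp (ξ / 2) : ℂ)) (j : ℕ) (k : ℝ) :
    cpi * pairP w (fun ξ => b ξ * damp χ j ξ * Complex.exp (Complex.I * (-1 : ℝ) * k * ξ)) =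
      -conv (fun ξ => (damp χ j ξ : ℂ)) (fun l => rho0 l * hat w l) k := by
  rw [pairP, conv, ← integral_const_mul, ← integral_neg]
  congr 1 with l
  have e1 : ∀ ξ : ℝ, b ξ * damp χ j ξ * Complex.exp (Complex.I * (-1 : ℝ) * k * ξ) * symbol ξ l *
      Complex.exp (Complex.I * l * ξ) =
      -rho0 l * ((damp χ j ξ : ℂ) * Complex.exp (Complex.I * (-1 : ℝ) * (k - l : ℝ) * ξ)) := by
    intro ξ
    by_cases hξ : ξ ∈ J₂
    · have h1 : (Real.exp (ξ / 2) : ℂ) * (Real.exp (-ξ / 2) : ℂ) = 1 := by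
        rw [← Complex.ofReal_mul, ← Real.exp_add]
        simp [neg_div]
      have h2 : Complex.exp (Complex.I * (-1 : ℝ) * k * ξ) * Complex.exp (Complex.I * l * ξ) =
          Complex.exp (Complex.I * (-1 : ℝ) * (k - l : ℝ) * ξ) := by
        rw [← Complex.exp_add]
        congr 1
        push_cast
        ring
      rw [hbe ξ hξ, symbol, ← h2]
      linear_combination (-rho0 l * damp χ j ξ * Complex.exp (Complex.I * (-1 : ℝ) * k * ξ) *
        Complex.exp (Complex.I * l * ξ)) * h1
    · have : damp χ j ξ = 0 := by rw [damp, hχ.eq_zero ξ hξ, zero_mul]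
      simp [this]
  simp_rw [e1]
  rw [integral_const_mul, sharp, hat_eq (fun ξ => (damp χ j ξ : ℂ))]
  change (cpi : ℂ) * (hat w l * ((cpi : ℂ) * _)) = _
  ring

/-- The equation `∂ₜ w = P w + Q`, localized and in Fourier space. -/
theorem conv_hat_eq {χ : ℝ → ℝ} (hχ : IsCutoff χ) {b w g Q : ℝ → ℂ} (hb : IsTest b)
    (hbe : ∀ ξ ∈ J₂, b ξ = (Real.exp (ξ / 2) : ℂ)) (hw : Integrable w) (hw2 : MemLp (hat w) 2)
    (hg : Integrable (fun ξ => (χ ξ : ℂ) * g ξ)) (hQ : Integrable (fun ξ => (χ ξ : ℂ) * Q ξ))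
    (heq : ∀ φ : ℝ → ℂ, ContDiff ℝ ∞ φ → HasCompactSupport φ → tsupport φ ⊆ J₂ →
      ∫ ξ, g ξ * φ ξ = pairP w φ + ∫ ξ, Q ξ * φ ξ) (k : ℝ) :
    conv b (hat fun ξ => (χ ξ : ℂ) * g ξ) k =
      -conv (fun ξ => (χ ξ : ℂ)) (fun l => rho0 l * hat w l) k +
        conv b (hat fun ξ => (χ ξ : ℂ) * Q ξ) k := by
  rw [← hat_mul' hb hg, ← hat_mul' hb hQ, hat_eq, hat_eq]
  have h1 := (tendsto_integral_damp hb hg hχ k).const_mul (cpi : ℂ)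
  have h2 := (tendsto_integral_damp hb hQ hχ k).const_mul (cpi : ℂ)
  have h3 := (tendsto_conv_damp hχ hw2 (continuous_hat hw).measurable k).neg
  -- The equation holds for each admissible test function `b · damp χ j · e^{-ikξ}`, and all three
  -- terms converge as `j → ∞`.
  refine tendsto_nhds_unique h1 ((h3.add h2).congr fun j => ?_)
  have ht : IsTest (fun ξ => (damp χ j ξ : ℂ) * (b ξ * Complex.exp (Complex.I * (-1 : ℝ) * k * ξ))) :=
    (isTest_damp hχ j).mul_smooth (hb.smooth.mul
      (contDiff_const.mul Complex.ofRealCLM.contDiff).cexp)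
  have he : (fun ξ : ℝ => b ξ * damp χ j ξ * Complex.exp (Complex.I * (-1 : ℝ) * k * ξ)) =
      fun ξ => (damp χ j ξ : ℂ) * (b ξ * Complex.exp (Complex.I * (-1 : ℝ) * k * ξ)) := by
    ext ξ; ring
  have h := heq _ (he ▸ ht.smooth) (he ▸ ht.compact) (he ▸ (closure_mono
    (Function.support_mul_subset_left _ _)).trans (tsupport_damp hχ j))
  rw [h, mul_add, pairP_damp hχ hbe]

/-! ### Dissipation estimate for solutions -/

lemma ofReal_nrm_sq {f : ℝ → ℂ} (hf : MemLp f 2) :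
    ENNReal.ofReal (nrm f ^ 2) = ∫⁻ k, ‖f k‖ₑ ^ 2 := by
  rw [nrm, ENNReal.ofReal_pow ENNReal.toReal_nonneg, ENNReal.ofReal_toReal hf.2.ne]
  exact enorm_sq_eq_lintegral f

lemma lintegral_enorm_mul_sq (m : ℝ → ℝ) (F : ℝ → ℂ) :
    ∫⁻ k, ‖(m k : ℂ) * F k‖ₑ ^ 2 = weightedSq (fun k => m k ^ 2) F := by
  unfold weightedSq
  congr 1 with k
  rw [← ofReal_norm, ← ENNReal.ofReal_pow (norm_nonneg _), norm_mul, Complex.norm_real, mul_pow,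
    Real.norm_eq_abs, sq_abs, mul_comm]

lemma Admissible.integrable {n : ℕ} {ν m : ℝ → ℝ} (hA : Admissible n ν m) : Integrable m := by
  obtain ⟨B, -, hB⟩ := hA.bounded
  refine (integrable_inv_jap_sq.const_mul B).mono' hA.cont.aestronglyMeasurable
    (Eventually.of_forall fun k => ?_)
  rw [Real.norm_of_nonneg (hA.slow.pos k).le, mul_one_div]
  exact (hB k).1

/-- Smooth weights with compact support, equal to `exp (± ξ / 2)` on `J₂`. -/
lemma exists_expWeights : ∃ a b : ℝ → ℂ, IsTest a ∧ IsTest b ∧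
    (∀ ξ, (starRingEnd ℂ) (b ξ) = b ξ) ∧ (∀ ξ, 0 ≤ (b ξ).re) ∧
    (∀ ξ ∈ J₂, b ξ = (Real.exp (ξ / 2) : ℂ)) ∧ ∀ ξ ∈ J₂, a ξ * b ξ = 1 := by
  set η : ContDiffBump (0 : ℝ) := ⟨1, 2, one_pos, one_lt_two⟩ with hη
  have h1 : ∀ ξ ∈ J₂, η ξ = 1 := by
    intro ξ hξ
    refine η.one_of_mem_closedBall ?_
    have h2 := Real.log_two_lt_d9
    have h3 : Real.log (1 / 2) = -Real.log 2 := by rw [one_div, Real.log_inv]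
    rw [J₂, h3] at hξ
    rw [mem_closedBall_zero_iff, Real.norm_eq_abs, abs_le]
    change -1 ≤ ξ ∧ ξ ≤ 1
    constructor <;> linarith [hξ.1, hξ.2]
  have htest : ∀ f : ℝ → ℝ, ContDiff ℝ ∞ f → IsTest (fun ξ => ((η ξ * f ξ : ℝ) : ℂ)) := by
    intro f hf
    refine ⟨Complex.ofRealCLM.contDiff.comp (η.contDiff.mul hf), ?_⟩
    exact (η.hasCompactSupport.mul_right (f' := f)).comp_left (g := fun x : ℝ => (x : ℂ)) rfl
  refine ⟨fun ξ => ((η ξ * Real.exp (-(ξ / 2)) : ℝ) : ℂ), fun ξ => ((η ξ * Real.exp (ξ / 2) : ℝ) : ℂ),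
    htest _ (contDiff_id.div_const 2).neg.exp, htest _ (contDiff_id.div_const 2).exp,
    fun ξ => Complex.conj_ofReal _, fun ξ => ?_, fun ξ hξ => ?_, fun ξ hξ => ?_⟩
  · rw [Complex.ofReal_re]
    exact mul_nonneg η.nonneg (Real.exp_nonneg _)
  · simp only [h1 ξ hξ, one_mul]
  · simp only [h1 ξ hξ, one_mul]
    rw [← Complex.ofReal_mul, ← Real.exp_add]
    simp

/-! ### Slices of solutions, their Fourier transforms, and the estimate with truncated weights. -/

section Solution

variable {T : ℝ} {w Q g : ℝ → ℝ → ℂ} {χ : ℝ → ℝ}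

lemma measurableSet_J₁ : MeasurableSet J₁ := measurableSet_Ioo

lemma volume_J₁_lt_top : volume J₁ < ⊤ := measure_Ioo_lt_top

/-- Almost every slice of a function bounded on the product is essentially bounded on `J₁`, which
has finite measure, and it vanishes elsewhere. -/
lemma IsSolution.ae_memLp (h : IsSolution T w Q) (p : ℝ≥0∞) :
    ∀ᵐ t ∂(volume.restrict (Ioo 0 T)), MemLp (w t) p := by
  have hb := h.bounded
  rw [Measure.volume_eq_prod, ← Measure.prod_restrict] at hb
  have h1 := hb.1.prodMk_left
  have h2 := Measure.ae_ae_of_ae_prod (ae_le_eLpNormEssSup (f := Function.uncurry w)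
    (μ := (volume.restrict (Ioo 0 T)).prod (volume.restrict J₁)))
  have h3 := hb.2
  rw [eLpNorm_exponent_top] at h3
  filter_upwards [h1, h2, ae_restrict_mem measurableSet_Ioo] with t ht1 ht2 ht3
  have h4 : MemLp (w t) ⊤ (volume.restrict J₁) := by
    refine memLp_top_of_bound ht1 (eLpNormEssSup (Function.uncurry w)
      ((volume.restrict (Ioo 0 T)).prod (volume.restrict J₁))).toReal ?_
    filter_upwards [ht2] with ξ hξ
    rw [← toReal_enorm]
    exact ENNReal.toReal_mono h3.ne hξ
  have hfin : IsFiniteMeasure (volume.restrict J₁) := ⟨by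
    rw [Measure.restrict_apply_univ]; exact volume_J₁_lt_top⟩
  have h5 := h4.mono_exponent (p := p) le_top
  rw [← memLp_indicator_iff_restrict measurableSet_J₁] at h5
  refine h5.ae_eq (Eventually.of_forall fun ξ => ?_)
  by_cases hξ : ξ ∈ J₁
  · rw [indicator_of_mem hξ]
  · rw [indicator_of_notMem hξ, h.support t ht3 ξ hξ]

lemma IsSolution.aemeasurable_lintegral (h : IsSolution T w Q) :
    AEMeasurable (fun t => ∫⁻ ξ in J₁, ‖w t ξ‖ₑ ^ 2) (volume.restrict (Ioo 0 T)) := by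
  have hb := h.bounded
  rw [Measure.volume_eq_prod, ← Measure.prod_restrict] at hb
  exact (hb.1.enorm.pow_const 2).lintegral_prod_right'

lemma lintegral_enorm_sq_le (f : ℝ → ℂ) :
    ∫⁻ ξ in J₁, ‖f ξ‖ₑ ^ 2 ≤ volume J₁ * normSqLinf f := by
  calc ∫⁻ ξ in J₁, ‖f ξ‖ₑ ^ 2 ≤ ∫⁻ _ in J₁, normSqLinf f := by
        refine lintegral_mono_ae ?_
        have := ae_le_eLpNormEssSup (f := f) (μ := volume.restrict J₁)
        filter_upwards [this] with ξ hξ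
        rw [normSqLinf, eLpNorm_exponent_top]
        exact pow_le_pow_left' hξ 2
    _ = volume J₁ * normSqLinf f := by
        rw [lintegral_const, Measure.restrict_apply_univ, mul_comm]

lemma nrm_hat_sq_le {f : ℝ → ℂ} (h1 : MemLp f 1) (h2 : MemLp f 2) (h0 : ∀ ξ, ξ ∉ J₁ → f ξ = 0) :
    MemLp (hat f) 2 ∧ ENNReal.ofReal (nrm (hat f) ^ 2) ≤ ∫⁻ ξ in J₁, ‖f ξ‖ₑ ^ 2 := by
  have hi := memLp_one_iff_integrable.1 h1
  have hle := eLpNorm_hat_le hi h2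
  have hL : MemLp (hat f) 2 :=
    ⟨(continuous_hat hi).aestronglyMeasurable, hle.trans_lt h2.2⟩
  refine ⟨hL, ?_⟩
  rw [ofReal_nrm_sq hL, ← enorm_sq_eq_lintegral]
  refine (pow_le_pow_left' hle 2).trans (le_of_eq ?_)
  rw [enorm_sq_eq_lintegral, ← lintegral_indicator measurableSet_J₁]
  congr 1 with ξ
  by_cases hξ : ξ ∈ J₁
  · simp [hξ]
  · rw [h0 ξ hξ]
    simp [hξ]

lemma ae_ae_swap {μ ν : Measure ℝ} [SFinite μ] [SFinite ν] {P : ℝ → ℝ → Prop}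
    (h : ∀ᵐ p ∂(μ.prod ν), P p.1 p.2) : ∀ᵐ y ∂ν, ∀ᵐ x ∂μ, P x y := by
  have := (Measure.measurePreserving_swap (μ := ν) (ν := μ)).quasiMeasurePreserving.ae h
  exact Measure.ae_ae_of_ae_prod this

/-- The localized time derivative, as a measurable family of Fourier transforms. -/
theorem exists_timeFamily (hχ : IsCutoff χ) (hg : HasH1TimeDeriv T J₂ w g 0) :
    ∃ V G, TimeFamily V G ∧
      (∀ᵐ t ∂(volume.restrict (Ioo 0 T)), Integrable (fun ξ => (χ ξ : ℂ) * g t ξ) ∧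
        V t = (hat fun ξ => (χ ξ : ℂ) * g t ξ)) ∧
      ∀ᵐ t ∂(volume.restrict (Ioo 0 T)), prim V t = hat (localize χ w t) := by
  have hgm := hg.memLp_deriv
  have hwg := hg.eq_integral
  rw [Measure.volume_eq_prod, ← Measure.prod_restrict] at hgm hwg
  have hχt := isTest_ofReal hχ.smooth hχ.eq_zero
  -- A Borel representative, extended below by zero, since `TimeFamily` requires joint measurability
  -- and bounds at every point.
  set γ := hgm.1.mk (Function.uncurry g) with hγ
  have hγm : Measurable γ := hgm.1.stronglyMeasurable_mk.measurable
  have hγe : ∀ᵐ p ∂((volume.restrict (Ioo 0 T)).prod (volume.restrict J₂)),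
      g p.1 p.2 = γ (p.1, p.2) := hgm.1.ae_eq_mk
  set s : Set (ℝ × ℝ) := Ioo 0 T ×ˢ J₂ with hs
  have hsm : MeasurableSet s := measurableSet_Ioo.prod measurableSet_Ioo
  set f : ℝ → ℝ → ℂ := fun t ξ => (χ ξ : ℂ) * s.indicator γ (t, ξ) with hf
  have hfm : Measurable (Function.uncurry f) :=
    (hχt.continuous.measurable.comp measurable_snd).mul (hγm.indicator hsm)
  have hfi : Integrable (Function.uncurry f) (volume.prod volume) := by
    obtain ⟨B, hB⟩ := hχt.compact.exists_bound_of_continuous hχt.continuous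
    refine Integrable.bdd_mul (c := B) ?_
      (hχt.continuous.comp continuous_snd).aestronglyMeasurable (Eventually.of_forall fun p => hB _)
    have hfin : IsFiniteMeasure ((volume.restrict (Ioo 0 T)).prod (volume.restrict J₂)) := by
      rw [Measure.prod_restrict]
      refine ⟨?_⟩
      rw [Measure.restrict_apply_univ, Measure.prod_prod]
      exact ENNReal.mul_lt_top measure_Ioo_lt_top measure_Ioo_lt_top
    have h1 : Integrable γ ((volume.restrict (Ioo 0 T)).prod (volume.restrict J₂)) :=
      ((hgm.ae_eq hgm.1.ae_eq_mk).integrable (by norm_num))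
    rw [Measure.prod_restrict] at h1
    exact (integrable_indicator_iff hsm).2 h1
  have hV : TimeFamily (fun t => hat (f t)) fun t => cpi * ∫ ξ, ‖f t ξ‖ := by
    refine ⟨?_, hfi.integral_norm_prod_left.const_mul cpi, fun t k => norm_hat_le _ _⟩
    have h1 : Measurable fun q : (ℝ × ℝ) × ℝ => f q.1.1 q.2 *
        Complex.exp (Complex.I * (-1 : ℝ) * q.1.2 * q.2) := by
      refine (hfm.comp ((measurable_fst.comp measurable_fst).prodMk measurable_snd)).mul ?_
      exact Continuous.measurable (by fun_prop)
    have h2 := (h1.stronglyMeasurable.integral_prod_right' (ν := volume)).measurable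
    have h3 : Function.uncurry (fun t => hat (f t)) = fun p : ℝ × ℝ => (cpi : ℂ) *
        ∫ ξ : ℝ, f p.1 ξ * Complex.exp (Complex.I * (-1 : ℝ) * p.2 * ξ) :=
      funext fun p => hat_eq _ _
    rw [h3]
    exact h2.const_mul _
  have hfg : ∀ t ∈ Ioo 0 T, ∀ ξ, (ξ ∈ J₂ → g t ξ = γ (t, ξ)) → f t ξ = (χ ξ : ℂ) * g t ξ := by
    intro t ht ξ h
    by_cases hξ : ξ ∈ J₂
    · simp only [hf]
      rw [indicator_of_mem (show (t, ξ) ∈ s from ⟨ht, hξ⟩), h hξ]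
    · simp only [hf, hχ.eq_zero ξ hξ, Complex.ofReal_zero, zero_mul]
  refine ⟨_, _, hV, ?_, ?_⟩
  · filter_upwards [Measure.ae_ae_of_ae_prod hγe, ae_restrict_mem measurableSet_Ioo,
      ae_restrict_of_ae hfi.prod_right_ae] with t h1 h2 h3
    have h4 : f t =ᵐ[volume] fun ξ => (χ ξ : ℂ) * g t ξ := by
      filter_upwards [(ae_restrict_iff' measurableSet_Ioo).1 h1] with ξ h5 using hfg t h2 ξ h5
    refine ⟨Integrable.congr h3 h4, funext fun k => ?_⟩
    unfold hat
    congr 1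
    refine integral_congr_ae ?_
    filter_upwards [h4] with ξ h5
    rw [h5]
  · have hswap := ae_ae_swap (P := fun t ξ => g t ξ = γ (t, ξ)) hγe
    filter_upwards [Measure.ae_ae_of_ae_prod hwg, ae_restrict_mem measurableSet_Ioo] with t h1 h2
    ext k
    -- The zero initial value on `J₂` makes `χ w` the pure time primitive of `χ ∂ₜ w`.
    have h3 : (localize χ w t) =ᵐ[volume] fun ξ => ∫ r in Ioc 0 t, f r ξ := by
      filter_upwards [(ae_restrict_iff' measurableSet_Ioo).1 h1,
        (ae_restrict_iff' measurableSet_Ioo).1 hswap] with ξ h5 h6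
      by_cases hξ : ξ ∈ J₂
      · have h7 := h6 hξ
        have h8 := h5 hξ
        simp only [Pi.zero_apply, zero_add] at h8
        rw [localize, h8, intervalIntegral.integral_of_le h2.1.le, ← integral_const_mul]
        have hsub : Ioc 0 t ⊆ Ioo 0 T := fun r hr => ⟨hr.1, hr.2.trans_lt h2.2⟩
        refine integral_congr_ae ?_
        filter_upwards [ae_restrict_of_ae_restrict_of_subset hsub h7,
          ae_restrict_mem measurableSet_Ioc] with r h9 h10
        exact (hfg r (hsub h10) ξ fun _ => h9).symm
      · simp only [localize, hf, hχ.eq_zero ξ hξ, Complex.ofReal_zero, zero_mul, integral_zero]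
    have h4 : hat (localize χ w t) k =
        cpi * ∫ ξ : ℝ, ∫ r in Ioc 0 t, f r ξ * Complex.exp (Complex.I * (-1 : ℝ) * k * ξ) := by
      rw [hat_eq]
      congr 1
      refine integral_congr_ae ?_
      filter_upwards [h3] with ξ h5
      rw [h5, ← integral_mul_const]
    have hint : Integrable (fun p : ℝ × ℝ => f p.1 p.2 *
        Complex.exp (Complex.I * (-1 : ℝ) * k * p.2)) ((volume.restrict (Ioc 0 t)).prod volume) := by
      have h5 : Integrable (Function.uncurry f) ((volume.restrict (Ioc 0 t)).prod volume) := by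
        rw [← Measure.restrict_univ (μ := (volume : Measure ℝ)),
          Measure.restrict_restrict_of_subset (subset_univ _), Measure.prod_restrict]
        exact hfi.restrict
      exact h5.mul_bdd (c := 1) (Continuous.aestronglyMeasurable (by fun_prop))
        (Eventually.of_forall fun p => (norm_exp_I_mul _ _ _).le)
    rw [h4, ← integral_integral_swap hint, ← integral_const_mul, prim]
    simp_rw [hat_eq]

lemma measurable_nrm_sq_prim {V : ℝ → ℝ → ℂ} {G : ℝ → ℝ} (hV : TimeFamily V G) {m : ℝ → ℝ}
    (hm : Measurable m) : Measurable fun t => nrm (fun k => (m k : ℂ) * prim V t k) ^ 2 := by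
  have h1 : Measurable fun p : ℝ × ℝ => ‖(m p.2 : ℂ) * prim V p.1 p.2‖ₑ ^ 2 :=
    ((Complex.measurable_ofReal.comp (hm.comp measurable_snd)).mul hV.measurable_prim).enorm.pow_const 2
  have h2 : (fun t => nrm (fun k => (m k : ℂ) * prim V t k) ^ 2) =
      fun t => (∫⁻ k, ‖(m k : ℂ) * prim V t k‖ₑ ^ 2).toReal := by
    ext t
    rw [nrm, ← ENNReal.toReal_pow]
    congr 1
    exact enorm_sq_eq_lintegral _
  rw [h2]
  exact h1.lintegral_prod_right'.ennreal_toReal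

/-- The dissipation estimate, with a constant which does not depend on the weights. -/
theorem exists_dissipation_le (hχ : IsCutoff χ) {ψ : ℝ → ℝ} (hψ : ContDiff ℝ ∞ ψ) {n : ℕ}
    (hn : 1 ≤ n) (hψχ : ∀ ξ, χ ξ = ψ ξ ^ n) :
    ∃ C : ℝ≥0, ∀ ν m, Admissible n ν m → ∀ T w Q, IsSolution T w Q →
      (∀ᵐ t ∂(volume.restrict (Ioo 0 T)), Integrable (localize χ Q t)) → ∀ R : ℝ≥0∞,
      (∀ a ∈ Icc 0 T, ∫⁻ t in Ioo a (min (a + 1) T),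
        weightedSq (fun k => (m k / sell k) ^ 2) (hat (localize χ Q t)) ≤ R) →
      ∀ a ∈ Icc 0 T, ∫⁻ t in Ioo a (min (a + 1) T),
        weightedSq (fun k => (m k * sell k) ^ 2) (hat (localize χ w t)) ≤
          C * ((∫⁻ t in Ioo 0 T, normSqLinf (w t)) + R) := by
  have hψ0 : ∀ ξ, ξ ∉ J₂ → ψ ξ = 0 := fun ξ hξ => by
    have h := hχ.eq_zero ξ hξ
    rw [hψχ] at h
    exact pow_eq_zero_iff (by omega) |>.1 h
  have hψt : IsTest (fun ξ => (ψ ξ : ℂ)) := isTest_ofReal hψ hψ0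
  obtain ⟨a, b, ha, hb, hbreal, hb0, hbe, hab⟩ := exists_expWeights
  obtain ⟨c, K, hc, hK, hmain⟩ := exists_energy_inequality hψt (fun ξ => Complex.conj_ofReal _) ha hb hn
  set κ := ENNReal.ofReal ((1 + (1 + c) / c) / c) with hκ
  refine ⟨((κ * ENNReal.ofReal K) * (volume J₁ + 1)).toNNReal, fun ν m hA T w Q hsol hQ R hR => ?_⟩
  have hCtop : (κ * ENNReal.ofReal K) * (volume J₁ + 1) ≠ ⊤ :=
    ENNReal.mul_ne_top (ENNReal.mul_ne_top ENNReal.ofReal_ne_top ENNReal.ofReal_ne_top)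
      (ENNReal.add_ne_top.2 ⟨volume_J₁_lt_top.ne, ENNReal.one_ne_top⟩)
  rw [ENNReal.coe_toNNReal hCtop]
  obtain ⟨g, hg, heq⟩ := hsol.equation
  obtain ⟨V, G, hV, hVg, hVw⟩ := exists_timeFamily hχ hg
  obtain ⟨hei, hE⟩ := energy_prim hb hbreal hA.integrable hA.cont.measurable hV
  set A := ∫⁻ t in Ioo 0 T, normSqLinf (w t) with hAdef
  set f : ℝ → ℝ≥0∞ := fun t => ∫⁻ ξ in J₁, ‖w t ξ‖ₑ ^ 2 with hf
  set Z : ℝ → ℝ≥0∞ := fun t => weightedSq (fun k => (m k / sell k) ^ 2) (hat (localize χ Q t)) with hZ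
  set D : ℝ → ℝ := fun t => nrm (fun k => ((m k * sell k : ℝ) : ℂ) * prim V t k) ^ 2 with hD
  have hχpow : (fun ξ => (χ ξ : ℂ)) = fun ξ => (ψ ξ : ℂ) ^ n := by
    ext ξ; rw [hψχ]; push_cast; rfl
  have hlocw : ∀ t, localize χ w t = loc (fun ξ => (ψ ξ : ℂ)) (w t) n := fun t => by
    ext ξ
    simp only [localize, loc, hψχ]
    push_cast
    rfl
  have hS : ∀ a ∈ Icc 0 T, ∫⁻ t in Ioo a (min (a + 1) T), ENNReal.ofReal K * (f t + Z t) ≤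
      ENNReal.ofReal K * (volume J₁ * A + R) := by
    intro a ha
    have hsub : Ioo a (min (a + 1) T) ⊆ Ioo 0 T := fun t ht =>
      ⟨ha.1.trans_lt ht.1, ht.2.trans_le (min_le_right _ _)⟩
    rw [lintegral_const_mul' _ _ ENNReal.ofReal_ne_top,
      lintegral_add_left' (hsol.aemeasurable_lintegral.mono_measure (Measure.restrict_mono_set _ hsub))]
    gcongr
    · calc ∫⁻ t in Ioo a (min (a + 1) T), f t ≤ ∫⁻ t in Ioo 0 T, f t := lintegral_mono_set hsub
        _ ≤ ∫⁻ t in Ioo 0 T, volume J₁ * normSqLinf (w t) :=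
          lintegral_mono fun t => lintegral_enorm_sq_le _
        _ = _ := lintegral_const_mul' _ _ volume_J₁_lt_top.ne
    · exact hR a ha
  have hpoint : ∀ᵐ t ∂(volume.restrict (Ioo 0 T)),
      ENNReal.ofReal (energyRate b m V t + c * D t + c * ∫ s in Ioc 0 t, energyRate b m V s) ≤
        ENNReal.ofReal K * (f t + Z t) := by
    filter_upwards [hsol.ae_memLp 1, hsol.ae_memLp 2, heq, hVg, hVw, hQ,
      ae_restrict_mem measurableSet_Ioo] with t hw1 hw2 heq hVg hVw hQ ht
    have hwi := memLp_one_iff_integrable.1 hw1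
    obtain ⟨hWL, hWf⟩ := nrm_hat_sq_le hw1 hw2 (hsol.support t ht)
    have hFeq := conv_hat_eq hχ hb hbe hwi hWL hVg.1 hQ heq
    rw [hχpow] at hFeq
    -- `χ` vanishes outside `J₂`, and on `J₂` one has `a b = 1`.
    have hG : hat (fun ξ => (χ ξ : ℂ) * g t ξ) =
        conv a (conv b (hat fun ξ => (χ ξ : ℂ) * g t ξ)) := by
      have hbi : Integrable fun ξ => b ξ * ((χ ξ : ℂ) * g t ξ) := by
        obtain ⟨B, hB⟩ := hb.compact.exists_bound_of_continuous hb.continuous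
        exact hVg.1.bdd_mul (c := B) hb.continuous.aestronglyMeasurable (Eventually.of_forall hB)
      rw [← hat_mul' hb hVg.1, ← hat_mul' ha hbi]
      congr 1 with ξ
      by_cases hξ : ξ ∈ J₂
      · rw [← mul_assoc, hab ξ hξ, one_mul]
      · simp [hχ.eq_zero ξ hξ]
    have hin := hmain ν m hA (w t) _ _ hwi hVg.1 hQ hWL hFeq hG
    rw [← hE t ht.1.le]
    rw [← hVg.2, ← hlocw, ← hVw] at hin
    have h1 : ENNReal.ofReal (energyRate b m V t + c * D t +
        c * energy b (fun k => (m k : ℂ) * prim V t k)) ≤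
        ENNReal.ofReal (K * (nrm (hat (w t)) ^ 2 +
          nrm (fun k => ((m k / sell k : ℝ) : ℂ) * hat (localize χ Q t) k) ^ 2)) :=
      ENNReal.ofReal_le_ofReal hin
    refine h1.trans ?_
    rw [ENNReal.ofReal_mul hK, ENNReal.ofReal_add (sq_nonneg _) (sq_nonneg _)]
    gcongr
    have hzL := hA.memLp_mul_hat hA.measurable_div_sell (fun k => hA.div_le_self' (one_le_sell k) k) hQ
    rw [ofReal_nrm_sq hzL, lintegral_enorm_mul_sq]
  intro a ha
  have hwin := window_dissipation_le hc hei (fun t ht => by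
      rw [← hE t ht]
      exact energy_nonneg hb hbreal hb0 (hV.integrable_mul_prim hA.integrable t))
    (measurable_nrm_sq_prim hV (hA.cont.mul continuous_sell).measurable) (fun t => sq_nonneg _)
    hS hpoint ha
  have hsub : Ioo a (min (a + 1) T) ⊆ Ioo 0 T := fun t ht =>
    ⟨ha.1.trans_lt ht.1, ht.2.trans_le (min_le_right _ _)⟩
  calc ∫⁻ t in Ioo a (min (a + 1) T),
        weightedSq (fun k => (m k * sell k) ^ 2) (hat (localize χ w t))
      ≤ ∫⁻ t in Ioo a (min (a + 1) T), ENNReal.ofReal (D t) := by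
        refine lintegral_mono_ae (ae_restrict_of_ae_restrict_of_subset hsub ?_)
        filter_upwards [hsol.ae_memLp 1, hsol.ae_memLp 2, hVw,
          ae_restrict_mem measurableSet_Ioo] with t hw1 hw2 hVw ht
        obtain ⟨hWL, -⟩ := nrm_hat_sq_le hw1 hw2 (hsol.support t ht)
        have hL := hA.memLp_mul_sell (memLp_hat_loc hψt (memLp_one_iff_integrable.1 hw1) hWL n)
        simp only [hD]
        rw [hVw, hlocw, ofReal_nrm_sq hL, lintegral_enorm_mul_sq]
    _ ≤ κ * (ENNReal.ofReal K * (volume J₁ * A + R)) := hwin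
    _ ≤ κ * ENNReal.ofReal K * (volume J₁ + 1) * (A + R) := by
        rw [← mul_assoc, mul_assoc (κ * _)]
        gcongr
        calc volume J₁ * A + R ≤ (volume J₁ + 1) * A + (volume J₁ + 1) * R := by
              gcongr
              · exact le_self_add
              · exact le_mul_of_one_le_left zero_le le_add_self
          _ = _ := (mul_add _ _ _).symm

end Solution

/-! ### Removal of the truncation of the weights -/

lemma weightedSq_le_mul {μ μ' : ℝ → ℝ} {F F' : ℝ → ℂ} {c : ℝ} (hc : 0 ≤ c)
    (h : ∀ k, ‖F k‖ ^ 2 * μ k ≤ c * (‖F' k‖ ^ 2 * μ' k)) :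
    weightedSq μ F ≤ ENNReal.ofReal c * weightedSq μ' F' := by
  unfold weightedSq
  rw [← lintegral_const_mul' _ _ ENNReal.ofReal_ne_top]
  refine lintegral_mono fun k => ?_
  rw [← ENNReal.ofReal_mul hc]
  exact ENNReal.ofReal_le_ofReal (h k)

/-- Fatou's lemma twice, in frequency and then in time; the second application is why a jointly
measurable family is required. -/
lemma lintegral_weightedSq_le_of_eventually_le {F : ℝ → ℝ → ℂ}
    (hF : Measurable (Function.uncurry F)) {μ : ℝ → ℝ} {p : ℕ → ℝ → ℝ} (hp : ∀ N, Measurable (p N))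
    (hlim : ∀ k, ∀ᶠ N in atTop, μ k ≤ p N k) {s : Set ℝ} {B : ℝ≥0∞}
    (h : ∀ N, ∫⁻ t in s, weightedSq (p N) (F t) ≤ B) : ∫⁻ t in s, weightedSq μ (F t) ≤ B := by
  have hm : ∀ N, Measurable fun q : ℝ × ℝ => ENNReal.ofReal (‖F q.1 q.2‖ ^ 2 * p N q.2) := fun N =>
    have h1 : Measurable fun q : ℝ × ℝ => ‖F q.1 q.2‖ ^ 2 := hF.norm.pow_const 2
    have h2 : Measurable fun q : ℝ × ℝ => p N q.2 := (hp N).comp measurable_snd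
    ENNReal.measurable_ofReal.comp (h1.mul h2)
  have h1 : ∀ t, weightedSq μ (F t) ≤ liminf (fun N => weightedSq (p N) (F t)) atTop := by
    intro t
    have hFt : Measurable (F t) := hF.comp (measurable_const.prodMk measurable_id)
    have h2 : ∀ N, Measurable fun k => ENNReal.ofReal (‖F t k‖ ^ 2 * p N k) := fun N =>
      ENNReal.measurable_ofReal.comp ((hFt.norm.pow_const 2).mul (hp N))
    have h3 : ∀ k, ENNReal.ofReal (‖F t k‖ ^ 2 * μ k) ≤
        liminf (fun N => ENNReal.ofReal (‖F t k‖ ^ 2 * p N k)) atTop := by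
      intro k
      have h4 : ∀ᶠ N in atTop, ENNReal.ofReal (‖F t k‖ ^ 2 * μ k) ≤
          ENNReal.ofReal (‖F t k‖ ^ 2 * p N k) := by
        filter_upwards [hlim k] with N hN
        exact ENNReal.ofReal_le_ofReal (mul_le_mul_of_nonneg_left hN (sq_nonneg _))
      rw [liminf_eq]
      exact le_sSup h4
    exact (lintegral_mono h3).trans (lintegral_liminf_le h2)
  calc ∫⁻ t in s, weightedSq μ (F t)
      ≤ ∫⁻ t in s, liminf (fun N => weightedSq (p N) (F t)) atTop := lintegral_mono h1
    _ ≤ liminf (fun N => ∫⁻ t in s, weightedSq (p N) (F t)) atTop :=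
        lintegral_liminf_le fun N => (hm N).lintegral_prod_right'
    _ ≤ liminf (fun _ : ℕ => B) atTop := liminf_le_liminf (Eventually.of_forall h)
    _ = B := liminf_const B

lemma IsSolution.exists_measurable_hat {T : ℝ} {w Q : ℝ → ℝ → ℂ} {χ : ℝ → ℝ} (hχ : IsCutoff χ)
    (h : IsSolution T w Q) : ∃ F : ℝ → ℝ → ℂ, Measurable (Function.uncurry F) ∧
      ∀ᵐ t ∂(volume.restrict (Ioo 0 T)), hat (localize χ w t) = F t := by
  obtain ⟨g, hg, -⟩ := h.equation
  obtain ⟨V, G, hV, -, hVw⟩ := exists_timeFamily hχ hg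
  exact ⟨prim V, hV.measurable_prim, hVw.mono fun t ht => ht.symm⟩

/-! ### The truncated powers and their comparison with the Sobolev weights. -/

section Weights

variable {σ : ℝ} {n : ℕ}

lemma omega_pos {a N : ℝ} (hN : 0 < N) (k : ℝ) : 0 < omega a N k :=
  mul_pos (Real.rpow_pos_of_pos (jap_pos k) a) (pow_pos (trunc_pos hN k) 4)

lemma admissible_omega_aux (hσ : 0 ≤ σ) (hn : 1 ≤ n) (hσn : σ ≤ n) :
    0 ≤ σ / n ∧ σ / n ≤ 1 := by
  have : (0 : ℝ) < n := by exact_mod_cast hn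
  exact ⟨by positivity, (div_le_one this).2 hσn⟩

lemma omega_pow_mul_jap_le (hσ : 0 ≤ σ) (hn : 1 ≤ n) (hσn : σ ≤ n) {N : ℝ} (hN : 0 < N) (k : ℝ) :
    omega (σ / n) N k ^ n * jap k ^ 3 ≤ N ^ (4 * n) := by
  have h := omega_pow_le (admissible_omega_aux hσ hn hσn).2 hN hn k
  rwa [le_div_iff₀ (pow_pos (jap_pos k) 3)] at h

lemma omega_bdd {a N : ℝ} (ha1 : a ≤ 1) (hN : 0 < N) : ∃ B, ∀ k, omega a N k ≤ B := by
  refine ⟨N ^ 4, fun k => ?_⟩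
  have h := omega_pow_le ha1 hN le_rfl k
  rw [pow_one] at h
  exact h.trans (div_le_self (by positivity) (one_le_pow₀ (one_le_jap k)))

/-- The choice for (i) and (ii): the source weight `m / sell` corresponds to `H^σ_{log⁻¹}`, and `m *
sell` already dominates `H^σ` in the limit. -/
lemma admissible_omega_pow (hσ : 0 ≤ σ) (hn : 1 ≤ n) (hσn : σ ≤ n) {N : ℝ} (hN : 0 < N) :
    Admissible n (omega (σ / n) N) (fun k => omega (σ / n) N k ^ n) := by
  obtain ⟨h0, h1⟩ := admissible_omega_aux hσ hn hσn
  have hpos := fun k => pow_pos (omega_pos (a := σ / n) hN k) n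
  have hs := slow_omega h0 h1 hN
  refine ⟨hs, continuous_omega _ _, omega_le_jap h1 hN, omega_bdd h1 hN,
    (hs.pow n).mono (Nat.le_succ _), (continuous_omega _ _).pow n,
    fun k => le_mul_of_one_le_right (hpos k).le (one_le_sell k),
    fun k => le_mul_of_one_le_right (hpos k).le (one_le_sell k), N ^ (4 * n), fun k => ?_⟩
  refine le_trans ?_ (omega_pow_mul_jap_le hσ hn hσn hN k)
  exact mul_le_mul_of_nonneg_left (pow_le_pow_right₀ (one_le_jap k) (by norm_num)) (hpos k).le

/-- The choice for (iii), the upper extreme of admissibility: `m / sell` is exactly the truncated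
`H^σ` weight, and `m * sell` carries the full logarithm `ell` that bounds `ρ₀`. -/
lemma admissible_omega_pow_mul_sell (hσ : 0 ≤ σ) (hn : 1 ≤ n) (hσn : σ ≤ n) {N : ℝ} (hN : 0 < N) :
    Admissible n (omega (σ / n) N) (fun k => omega (σ / n) N k ^ n * sell k) := by
  obtain ⟨h0, h1⟩ := admissible_omega_aux hσ hn hσn
  have hpos := fun k => pow_pos (omega_pos (a := σ / n) hN k) n
  have hs := slow_omega h0 h1 hN
  refine ⟨hs, continuous_omega _ _, omega_le_jap h1 hN, omega_bdd h1 hN,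
    (hs.pow n).mul slow_sell, ((continuous_omega _ _).pow n).mul continuous_sell,
    fun k => le_rfl, fun k => ?_, N ^ (4 * n), fun k => ?_⟩
  · have h2 := one_le_sell k
    rw [mul_assoc]
    exact le_mul_of_one_le_right (hpos k).le (by nlinarith)
  · refine le_trans ?_ (omega_pow_mul_jap_le hσ hn hσn hN k)
    rw [mul_assoc]
    refine mul_le_mul_of_nonneg_left ?_ (hpos k).le
    rw [pow_succ' (jap k) 2]
    exact mul_le_mul_of_nonneg_right (sell_le_jap k) (sq_nonneg _)

lemma jap_rpow_div_pow (hn : 1 ≤ n) (k : ℝ) : (jap k ^ (σ / n)) ^ n = jap k ^ σ := by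
  have : (n : ℝ) ≠ 0 := by exact_mod_cast (by omega : n ≠ 0)
  rw [← Real.rpow_natCast, ← Real.rpow_mul (jap_pos k).le, div_mul_cancel₀ _ this]

lemma sq_jap_rpow (k : ℝ) : (jap k ^ σ) ^ 2 = (jap k ^ 2) ^ σ := by
  rw [← Real.rpow_natCast, ← Real.rpow_mul (jap_pos k).le, ← Real.rpow_natCast (jap k),
    ← Real.rpow_mul (jap_pos k).le, mul_comm]

lemma weightH_nonneg (σ k : ℝ) : 0 ≤ weightH σ k := Real.rpow_nonneg (by positivity) σ

lemma weightH_le (hσ : 0 ≤ σ) (k : ℝ) : weightH σ k ≤ (jap k ^ σ) ^ 2 := by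
  rw [sq_jap_rpow]
  refine Real.rpow_le_rpow (by positivity) ?_ hσ
  unfold jap
  nlinarith [abs_nonneg k]

lemma sq_omega_pow_le (hσ : 0 ≤ σ) (hn : 1 ≤ n) {N : ℝ} (hN : 0 < N) (k : ℝ) :
    (omega (σ / n) N k ^ n) ^ 2 ≤ 2 ^ σ * weightH σ k := by
  have h1 : omega (σ / n) N k ^ n ≤ jap k ^ σ := by
    rw [← jap_rpow_div_pow hn]
    exact pow_le_pow_left₀ (omega_pos hN k).le (omega_le_jap_rpow hN k) n
  refine (pow_le_pow_left₀ (pow_pos (omega_pos hN k) n).le h1 2).trans ?_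
  rw [sq_jap_rpow, weightH, ← Real.mul_rpow (by positivity) (by positivity)]
  refine Real.rpow_le_rpow (by positivity) ?_ hσ
  unfold jap
  nlinarith [sq_nonneg (|k| - 1)]

/-- At a fixed frequency the truncation factor equals `1` once `N` exceeds `jap k`. -/
lemma eventually_weightH_le (hσ : 0 ≤ σ) (hn : 1 ≤ n) (k : ℝ) :
    ∀ᶠ N : ℕ in atTop, weightH σ k ≤ (omega (σ / n) ((N : ℝ) + 1) k ^ n) ^ 2 := by
  obtain ⟨M, hM⟩ := exists_nat_ge (jap k)
  filter_upwards [eventually_ge_atTop M] with N hN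
  have h1 : trunc ((N : ℝ) + 1) k = 1 := by
    refine min_eq_left ((one_le_div (jap_pos k)).2 ?_)
    have : (M : ℝ) ≤ N := by exact_mod_cast hN
    linarith
  rw [omega, h1, one_pow, mul_one, jap_rpow_div_pow hn]
  exact weightH_le hσ k

end Weights

lemma norm_hatT₁_le (h : ℝ → ℂ) (k : ℝ) : ‖hatT₁ h k‖ ≤ 2 * ell k * ‖hat h k‖ := by
  have h1 : |(rho0 k).re| ≤ 2 * ell k := (Complex.abs_re_le_norm _).trans (norm_rho0_le k)
  have h2 := ell_pos k
  rw [hatT₁, norm_neg, norm_mul, norm_mul, Complex.norm_real, Real.norm_eq_abs]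
  split_ifs
  · rw [norm_one, mul_one, mul_comm]
    exact mul_le_mul_of_nonneg_right h1 (norm_nonneg _)
  · rw [norm_zero, mul_zero]
    positivity

/-- The exponent `σ / n` of the base weight must not exceed `1`, so that it costs at most one
derivative per factor of `ψ`. For `σ ≤ 1`, `n = 1` and the cutoff itself will do; otherwise `n` is
the ceiling of `σ`. -/
lemma exists_root {χ : ℝ → ℝ} (hχ : IsCutoff χ) {σ : ℝ} (hroots : 1 < σ → HasSmoothRoots χ) :
    ∃ (n : ℕ) (ψ : ℝ → ℝ), 1 ≤ n ∧ σ ≤ n ∧ ContDiff ℝ ∞ ψ ∧ ∀ ξ, χ ξ = ψ ξ ^ n := by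
  rcases le_or_gt σ 1 with h | h
  · exact ⟨1, χ, le_rfl, by simpa using h, hχ.smooth, fun ξ => (pow_one _).symm⟩
  · have hn : 1 ≤ ⌈σ⌉₊ := Nat.one_le_ceil_iff.2 (by linarith)
    obtain ⟨ψ, h1, h2⟩ := hroots h ⌈σ⌉₊ hn
    exact ⟨⌈σ⌉₊, ψ, hn, Nat.le_ceil σ, h1, h2⟩

/-! ### Estimates with untruncated weights and passage to suprema over windows. -/

section Estimates

variable {χ : ℝ → ℝ} {σ : ℝ}

lemma window_lintegral_mono {T : ℝ} {f g : ℝ → ℝ≥0∞} {a : ℝ} (ha : a ∈ Icc 0 T)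
    (h : ∀ᵐ t ∂(volume.restrict (Ioo 0 T)), f t ≤ g t) :
    ∫⁻ t in Ioo a (min (a + 1) T), f t ≤ ∫⁻ t in Ioo a (min (a + 1) T), g t :=
  lintegral_mono_ae (ae_restrict_of_ae_restrict_of_subset
    (Ioo_subset_Ioo ha.1 (min_le_right _ _)) h)

/-- The dissipation estimate for weights which need not be truncated. -/
lemma exists_weighted_estimate (hχ : IsCutoff χ) {ψ : ℝ → ℝ} (hψ : ContDiff ℝ ∞ ψ) {n : ℕ}
    (hn : 1 ≤ n) (hψχ : ∀ ξ, χ ξ = ψ ξ ^ n) {ν m : ℕ → ℝ → ℝ}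
    (hA : ∀ N, Admissible n (ν N) (m N)) {μ μ' : ℝ → ℝ} {c : ℝ} (hc : 0 ≤ c)
    (hμ : ∀ k, ∀ᶠ N in atTop, μ k ≤ (m N k * sell k) ^ 2)
    (hμ' : ∀ N k, (m N k / sell k) ^ 2 ≤ c * μ' k) :
    ∃ C : ℝ≥0, ∀ T w Q, IsSolution T w Q →
      (∀ᵐ t ∂(volume.restrict (Ioo 0 T)), Integrable (localize χ Q t)) → ∀ R : ℝ≥0∞,
      (∀ a ∈ Icc 0 T, ∫⁻ t in Ioo a (min (a + 1) T), weightedSq μ' (hat (localize χ Q t)) ≤ R) →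
      ∀ a ∈ Icc 0 T, ∫⁻ t in Ioo a (min (a + 1) T), weightedSq μ (hat (localize χ w t)) ≤
          C * ((∫⁻ t in Ioo 0 T, normSqLinf (w t)) + R) := by
  obtain ⟨C, hC⟩ := exists_dissipation_le hχ hψ hn hψχ
  refine ⟨C * (1 + c.toNNReal), fun T w Q hsol hQ R hR a ha => ?_⟩
  obtain ⟨F, hF, hFw⟩ := hsol.exists_measurable_hat hχ
  have hR' : ∀ N, ∀ a ∈ Icc 0 T, ∫⁻ t in Ioo a (min (a + 1) T),
      weightedSq (fun k => (m N k / sell k) ^ 2) (hat (localize χ Q t)) ≤ ENNReal.ofReal c * R := by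
    intro N a ha
    calc _ ≤ ∫⁻ t in Ioo a (min (a + 1) T),
          ENNReal.ofReal c * weightedSq μ' (hat (localize χ Q t)) := by
          refine lintegral_mono fun t => weightedSq_le_mul hc fun k => ?_
          rw [mul_left_comm]
          exact mul_le_mul_of_nonneg_left (hμ' N k) (sq_nonneg _)
      _ ≤ _ := by
          rw [lintegral_const_mul' _ _ ENNReal.ofReal_ne_top]
          exact mul_le_mul_right (hR a ha) _
  have key : ∫⁻ t in Ioo a (min (a + 1) T), weightedSq μ (F t) ≤
      C * ((∫⁻ t in Ioo 0 T, normSqLinf (w t)) + ENNReal.ofReal c * R) := by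
    refine lintegral_weightedSq_le_of_eventually_le hF
      (p := fun N k => (m N k * sell k) ^ 2)
      (fun N => (((hA N).cont.mul continuous_sell).pow 2).measurable) hμ fun N => ?_
    refine le_trans ?_ (hC (ν N) (m N) (hA N) T w Q hsol hQ _ (hR' N) a ha)
    exact window_lintegral_mono ha (hFw.mono fun t ht => by rw [ht])
  refine (window_lintegral_mono ha (hFw.mono fun t ht => by rw [ht])).trans (key.trans ?_)
  push_cast
  rw [mul_assoc]
  refine mul_le_mul_right ?_ _
  rw [add_mul, one_mul]
  refine add_le_add le_self_add ?_
  change ENNReal.ofReal c * R ≤ ENNReal.ofReal c * _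
  exact mul_le_mul_right le_add_self _

theorem exists_normSqH_estimate (hχ : IsCutoff χ) (hσ : 0 ≤ σ)
    (hroots : 1 < σ → HasSmoothRoots χ) :
    ∃ C : ℝ≥0, ∀ T w Q, IsSolution T w Q →
      (∀ᵐ t ∂(volume.restrict (Ioo 0 T)), Integrable (localize χ Q t)) → ∀ R : ℝ≥0∞,
      (∀ a ∈ Icc 0 T, ∫⁻ t in Ioo a (min (a + 1) T), normSqHLogInv σ (localize χ Q t) ≤ R) →
      ∀ a ∈ Icc 0 T, ∫⁻ t in Ioo a (min (a + 1) T), normSqH σ (localize χ w t) ≤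
          C * ((∫⁻ t in Ioo 0 T, normSqLinf (w t)) + R) := by
  obtain ⟨n, ψ, hn, hσn, hψ, hψχ⟩ := exists_root hχ hroots
  -- The constant comes from `(1 + |k|)² ≤ 2 (1 + |k|²)` raised to the power `σ`.
  refine exists_weighted_estimate hχ hψ hn hψχ (c := 2 ^ σ)
    (fun N : ℕ => admissible_omega_pow hσ hn hσn (N := (N : ℝ) + 1) (by positivity))
    (by positivity) (fun k => ?_) fun N k => ?_
  · filter_upwards [eventually_weightH_le hσ hn k] with N hN
    refine hN.trans ?_
    rw [mul_pow]
    exact le_mul_of_one_le_right (sq_nonneg _) (one_le_pow₀ (one_le_sell k))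
  · have h1 := sq_omega_pow_le hσ hn (N := (N : ℝ) + 1) (by positivity) k
    have h2 : weightHLogInv σ k = weightH σ k / ell k := (div_eq_mul_inv _ _).symm
    rw [div_pow, sell_sq, h2, ← mul_div_assoc]
    exact div_le_div_of_nonneg_right h1 (ell_pos k).le

theorem exists_normSqHT₁_estimate (hχ : IsCutoff χ) (hσ : 0 ≤ σ)
    (hroots : 1 < σ → HasSmoothRoots χ) :
    ∃ C : ℝ≥0, ∀ T w Q, IsSolution T w Q →
      (∀ᵐ t ∂(volume.restrict (Ioo 0 T)), Integrable (localize χ Q t)) → ∀ R : ℝ≥0∞,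
      (∀ a ∈ Icc 0 T, ∫⁻ t in Ioo a (min (a + 1) T), normSqH σ (localize χ Q t) ≤ R) →
      ∀ a ∈ Icc 0 T, ∫⁻ t in Ioo a (min (a + 1) T), normSqHT₁ σ (localize χ w t) ≤
          C * ((∫⁻ t in Ioo 0 T, normSqLinf (w t)) + R) := by
  obtain ⟨n, ψ, hn, hσn, hψ, hψχ⟩ := exists_root hχ hroots
  obtain ⟨C, hC⟩ := exists_weighted_estimate hχ hψ hn hψχ (c := 2 ^ σ)
    (μ := fun k => ell k ^ 2 * weightH σ k) (μ' := weightH σ)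
    (fun N : ℕ => admissible_omega_pow_mul_sell hσ hn hσn (N := (N : ℝ) + 1) (by positivity))
    (by positivity) (fun k => by
      filter_upwards [eventually_weightH_le hσ hn k] with N hN
      rw [mul_assoc, ← sq, sell_sq, mul_pow, mul_comm]
      exact mul_le_mul_of_nonneg_right hN (sq_nonneg _)) (fun N k => by
      rw [mul_div_cancel_right₀ _ (sell_pos k).ne']
      exact sq_omega_pow_le hσ hn (by positivity) k)
  refine ⟨4 * C, fun T w Q hsol hQ R hR a ha => ?_⟩
  calc ∫⁻ t in Ioo a (min (a + 1) T), normSqHT₁ σ (localize χ w t)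
      ≤ ∫⁻ t in Ioo a (min (a + 1) T), ENNReal.ofReal 4 *
          weightedSq (fun k => ell k ^ 2 * weightH σ k) (hat (localize χ w t)) := by
        refine lintegral_mono fun t => weightedSq_le_mul (by norm_num) fun k => ?_
        have h1 := pow_le_pow_left₀ (norm_nonneg _) (norm_hatT₁_le (localize χ w t) k) 2
        have h2 := mul_le_mul_of_nonneg_right h1 (weightH_nonneg σ k)
        refine h2.trans (le_of_eq (by ring))
    _ ≤ ENNReal.ofReal 4 * (C * ((∫⁻ t in Ioo 0 T, normSqLinf (w t)) + R)) := by
        rw [lintegral_const_mul' _ _ ENNReal.ofReal_ne_top]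
        exact mul_le_mul_right (hC T w Q hsol hQ R hR a ha) _
    _ = _ := by
        rw [← mul_assoc]
        congr 1
        push_cast
        congr 1
        norm_num

/-- Passage from squared norms on windows to suprema of norms. -/
lemma supWindow_le {N N' : (ℝ → ℂ) → ℝ≥0∞} {T : ℝ} {f q : ℝ → ℝ → ℂ} {A : ℝ≥0∞} {C C' : ℝ≥0}
    (hC : C ≤ C') (hC' : 1 ≤ C')
    (h : ∀ R : ℝ≥0∞, (∀ a ∈ Icc 0 T, ∫⁻ t in Ioo a (min (a + 1) T), N' (q t) ≤ R) →
      ∀ a ∈ Icc 0 T, ∫⁻ t in Ioo a (min (a + 1) T), N (f t) ≤ C * (A + R)) :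
    supWindow N T f ≤ C' * A ^ (1 / 2 : ℝ) + C' * supWindow N' T q := by
  set S := supWindow N' T q with hS
  have hsq : ∀ x : ℝ≥0∞, (x ^ 2) ^ (1 / 2 : ℝ) = x := fun x => by
    rw [← ENNReal.rpow_natCast, ← ENNReal.rpow_mul]; simp
  have hsq' : ∀ x : ℝ≥0∞, (x ^ (1 / 2 : ℝ)) ^ 2 = x := fun x => by
    rw [← ENNReal.rpow_natCast, ← ENNReal.rpow_mul]; simp
  -- The admissible `R` is the square of the supremum of the source norms, so square roots can be
  -- taken at the end.
  have hR : ∀ a ∈ Icc 0 T, ∫⁻ t in Ioo a (min (a + 1) T), N' (q t) ≤ S ^ 2 := by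
    intro a ha
    rw [← hsq' (∫⁻ t in Ioo a (min (a + 1) T), N' (q t))]
    exact pow_le_pow_left' (le_iSup₂ (f := fun (a : ℝ) (_ : a ∈ Icc 0 T) =>
      (∫⁻ t in Ioo a (min (a + 1) T), N' (q t)) ^ (1 / 2 : ℝ)) a ha) 2
  refine iSup₂_le fun a ha => ?_
  have hhalf : (0 : ℝ) ≤ 1 / 2 := by norm_num
  calc (∫⁻ t in Ioo a (min (a + 1) T), N (f t)) ^ (1 / 2 : ℝ)
      ≤ ((C' : ℝ≥0∞) ^ 2 * (A + S ^ 2)) ^ (1 / 2 : ℝ) := by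
        refine ENNReal.rpow_le_rpow ((h _ hR a ha).trans (mul_le_mul_left ?_ _)) hhalf
        have : C ≤ C' ^ 2 := hC.trans (le_self_pow₀ hC' two_ne_zero)
        exact_mod_cast this
    _ = C' * (A + S ^ 2) ^ (1 / 2 : ℝ) := by rw [ENNReal.mul_rpow_of_nonneg _ _ hhalf, hsq]
    _ ≤ C' * (A ^ (1 / 2 : ℝ) + (S ^ 2) ^ (1 / 2 : ℝ)) := by
        gcongr
        exact ENNReal.rpow_add_le_add_rpow _ _ hhalf (by norm_num)
    _ = _ := by rw [hsq, mul_add]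

end Estimates

end LogKinetic

end

theorem theorem4p1 (χ₀ : ℝ → ℝ) (hχ₀ : LogKinetic.IsCutoff χ₀) (σ : ℝ) (hσ : 0 ≤ σ)
    (hroots : 1 < σ → LogKinetic.HasSmoothRoots χ₀) :
    ∃ C : ℝ≥0,
      -- (i)
      (∀ w Q : ℝ → ℝ → ℂ, LogKinetic.IsSolution 1 w Q →
        LogKinetic.MemL2Time (LogKinetic.normSqHLogInv σ) 1 (LogKinetic.localize χ₀ Q) →
        (∫⁻ t in Ioo 0 1, LogKinetic.normSqH σ (LogKinetic.localize χ₀ w t)) ≤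
          C * (∫⁻ t in Ioo 0 1, LogKinetic.normSqLinf (w t)) +
          C * (∫⁻ t in Ioo 0 1, LogKinetic.normSqHLogInv σ (LogKinetic.localize χ₀ Q t))) ∧
      -- (ii)
      (∀ Tmax : ℝ, 0 < Tmax → ∀ w Q : ℝ → ℝ → ℂ, LogKinetic.IsSolution Tmax w Q →
        LogKinetic.MemL2Time (LogKinetic.normSqHLogInv σ) Tmax (LogKinetic.localize χ₀ Q) →
        LogKinetic.supWindow (LogKinetic.normSqH σ) Tmax (LogKinetic.localize χ₀ w) ≤
          C * (∫⁻ t in Ioo 0 Tmax, LogKinetic.normSqLinf (w t)) ^ (1 / 2 : ℝ) +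
          C * LogKinetic.supWindow (LogKinetic.normSqHLogInv σ) Tmax
            (LogKinetic.localize χ₀ Q)) ∧
      -- (iii)
      (∀ Tmax : ℝ, 0 < Tmax → ∀ w Q : ℝ → ℝ → ℂ, LogKinetic.IsSolution Tmax w Q →
        LogKinetic.MemL2Time (LogKinetic.normSqH σ) Tmax (LogKinetic.localize χ₀ Q) →
        LogKinetic.supWindow (LogKinetic.normSqHT₁ σ) Tmax (LogKinetic.localize χ₀ w) ≤
          C * (∫⁻ t in Ioo 0 Tmax, LogKinetic.normSqLinf (w t)) ^ (1 / 2 : ℝ) +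
          C * LogKinetic.supWindow (LogKinetic.normSqH σ) Tmax (LogKinetic.localize χ₀ Q)) := by
  obtain ⟨C₁, h₁⟩ := LogKinetic.exists_normSqH_estimate hχ₀ hσ hroots
  obtain ⟨C₂, h₂⟩ := LogKinetic.exists_normSqHT₁_estimate hχ₀ hσ hroots
  refine ⟨C₁ + C₂ + 1, fun w Q hsol hQ => ?_, fun T _ w Q hsol hQ => ?_, fun T _ w Q hsol hQ => ?_⟩
  -- On the time interval `(0, 1)`, the window starting at `0` is the whole interval, and every
  -- other window lies inside it, so `R` may be the full integral.
  · have h := h₁ 1 w Q hsol hQ.integrable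
      (∫⁻ t in Ioo 0 1, LogKinetic.normSqHLogInv σ (LogKinetic.localize χ₀ Q t))
      (fun a ha => lintegral_mono_set
        fun t ht => ⟨ha.1.trans_lt ht.1, ht.2.trans_le (min_le_right _ _)⟩)
      0 ⟨le_rfl, zero_le_one⟩
    rw [zero_add, min_self] at h
    refine h.trans ?_
    rw [← mul_add]
    refine mul_le_mul_left ?_ _
    have : C₁ ≤ C₁ + C₂ + 1 := by rw [add_assoc]; exact le_self_add
    exact_mod_cast this
  · refine LogKinetic.supWindow_le ?_ le_add_self (h₁ T w Q hsol hQ.integrable)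
    rw [add_assoc]
    exact le_self_add
  · refine LogKinetic.supWindow_le ?_ le_add_self (h₂ T w Q hsol hQ.integrable)
    rw [add_right_comm]
    exact le_add_self
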